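/- **Diagrams.** Fix $m\ge 1$, $K\ge 2$ and the variable order $x_1,\dots,x_m$. An ordered multi-terminal binary decision diagram (OMTBDD) is a finite rooted directed acyclic graph in which every node is reachable from the root, there is at most one sink for each value in $\{0,\dots,K-1\}$, every internal node is labelled by a variable and has a $0$-edge and a $1$-edge, and the variable indices increase along every path. It represents a function $\{0,1\}^m\to\{0,\dots,K-1\}$ by following, at a node labelled $x_i$, the edge labelled by the $i$-th bit. It is reduced if no internal node has both edges ending in the same node and no two distinct nodes have the same label and the same successors. We write $D(\boldsymbol a)$ for the value of $D$ at $\boldsymbol a$, $\mathrm{pre}(\boldsymbol a,j)$ and $\mathrm{suf}(\boldsymbol a,j)$ for the prefix and suffix of length $j$, $\mathrm{cro}(\boldsymbol a,\boldsymbol b,j)=\mathrm{pre}(\boldsymbol a,|\boldsymbol a|-j)\,\mathrm{suf}(\boldsymbol b,j)$, $\lambda$ for the empty string, and $\dot{\boldsymbol t}$ for $\boldsymbol t$ with its first bit flipped. **Queries.** For an unknown reduced OMTBDD $D$, a membership query for $\boldsymbol a\in\{0,1\}^m$ returns $D(\boldsymbol a)$. An equivalence query for an ordered diagram $H$ returns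 YES if $H$ and $D$ represent the same function, and otherwise NO with an arbitrary counterexample $\boldsymbol e\in\{0,1\}^m$, $H(\boldsymbol e)\ne D(\boldsymbol e)$. (A hypothesis may contain nodes that cannot be reached from its root; they do not affect its function.) Queries are counted with repetitions. **Data of the algorithm QLearn-OMTBDD.** It keeps a hypothesis $S$ and trees $T_1,\dots,T_m$. The nodes of $S$ are strings: sinks have length $m$ and carry a value, an internal node $\boldsymbol v$ is labelled $x_{|\boldsymbol v|+1}$. An edge from $\boldsymbol u$ to $\boldsymbol v$ carries a string $l(\boldsymbol u,\boldsymbol v)$ of length $|\boldsymbol v|-|\boldsymbol u|$; the edges leaving a node have different first bits. The root is $\lambda$, which is a dummy if it has only one outgoing edge. The diagram $\mathcal D(S)$ is obtained from $S$ by removing a dummy root and keeping only the first bit of each edge label. The tree $T_i$ classifies strings $\boldsymbol a\in\{0,1\}^i$ into node ids or $\mu$. At a single-test node labelled $\boldsymbol r$ one follows the edge labelled $D(\boldsymbol a\boldsymbol r)$. At a twin-test node labelled $\boldsymbol r$ one follows the labelled edge if its label is $(D(\boldsymbol a\boldsymbol r),D(\boldsymbol a\dot{\boldsymbol r}))$,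 and the unlabelled edge otherwise. Leaves are labelled by node ids or $\mu$. If a single-test node has no edge with the required label, the classification is stuck there. **The algorithm.** 1. Ask an equivalence query for the constant $0$; on YES output it. On NO with $\boldsymbol e'$, put $\ell'=D(\boldsymbol e')$ and ask an equivalence query for the constant $\ell'$; on YES output it. On NO with $\boldsymbol e$, put $\ell=D(\boldsymbol e)$. 2. (Initial hypothesis.) By binary search find $i$ with $D(\mathrm{cro}(\boldsymbol e',\boldsymbol e,i-1))=\ell'\ne D(\mathrm{cro}(\boldsymbol e',\boldsymbol e,i))=:y$. Put $\boldsymbol v=\mathrm{pre}(\boldsymbol e',m-i)$ and $\boldsymbol w=\mathrm{cro}(\boldsymbol e',\boldsymbol e,i)$. $S$ has the root $\lambda$, the node $\boldsymbol v$, sinks $\boldsymbol e'$ (value $\ell'$) and $\boldsymbol w$ (value $y$), edges from $\boldsymbol v$ to them, and, if $\boldsymbol v\ne\lambda$, an edge $(\lambda,\boldsymbol v)$ labelled $\boldsymbol v$. $T_m$ is a single-test node $\lambda$ with leaves $\boldsymbol e'$, $\boldsymbol w$ on edges $\ell'$, $y$; $T_{m-i}$ (if $i<m$) is a twin-test node $\mathrm{suf}(\boldsymbol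 e,i)$ with leaf $\boldsymbol v$ on edge $(y,\ell')$ and leaf $\mu$; all other trees are a leaf $\mu$. 3. Repeat: if $S(\boldsymbol e)=\ell$, ask an equivalence query for $\mathcal D(S)$, output $\mathcal D(S)$ on YES, and on NO take the new counterexample $\boldsymbol e$ and $\ell=D(\boldsymbol e)$. Then perform the update in 4. 4. (Update.) Let $\boldsymbol p_1,\dots,\boldsymbol p_k$ be the nodes of $S$ passed by $\boldsymbol e$, let $\boldsymbol e_i=\mathrm{suf}(\boldsymbol e,m-|\boldsymbol p_i|)$ and let $c=D(\boldsymbol p_k)$ be the value of the sink reached. By binary search find $i$ with $D(\boldsymbol p_i\boldsymbol e_i)\ne D(\boldsymbol p_{i+1}\boldsymbol e_{i+1})=c$. Put $\boldsymbol q=l(\boldsymbol p_i,\boldsymbol p_{i+1})$ and $x=D(\boldsymbol p_i\boldsymbol q\boldsymbol e_{i+1})$. Apply 5 if $x\ne c$ and 6 if $x=c$. 5. (NodeSplit.) Put $\boldsymbol v=\boldsymbol p_i\boldsymbol q$, add it to $S$ and redirect the edge $(\boldsymbol p_i,\boldsymbol p_{i+1})$ to $\boldsymbol v$. Let $T'$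 be a single-test node $\boldsymbol e_{i+1}$ with leaves $\boldsymbol p_{i+1}$, $\boldsymbol v$ on edges $c$, $x$. Let $\boldsymbol t$ be the label of the last twin-test node above the leaf $\boldsymbol p_{i+1}$ of $T_{|\boldsymbol v|}$. Execute AddEdge$(\boldsymbol v,\boldsymbol t)$ and AddEdge$(\boldsymbol v,\dot{\boldsymbol t})$. For every remaining edge $(\boldsymbol v_1,\boldsymbol p_{i+1})$, labelled $\boldsymbol q'$, classify $\boldsymbol v_1\boldsymbol q'$ by $T'$; if a leaf is reached, redirect the edge to that node; if stuck, add a node $\boldsymbol v'=\boldsymbol v_1\boldsymbol q'$ to $S$ and a leaf $\boldsymbol v'$ to $T'$, redirect the edge to $\boldsymbol v'$, and execute AddEdge$(\boldsymbol v',\boldsymbol t)$ and AddEdge$(\boldsymbol v',\dot{\boldsymbol t})$. Finally replace the leaf $\boldsymbol p_{i+1}$ of $T_{|\boldsymbol v|}$ by $T'$. 6. (NewBranchingNode.) Let $\boldsymbol f=\mathrm{pre}(\boldsymbol e_i,|\boldsymbol q|)$. By binary search find $j\in\{1,\dots,|\boldsymbol q|\}$ with $z:=D(\boldsymbol p_i\,\mathrm{cro}(\boldsymbol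 q,\boldsymbol f,j)\,\boldsymbol e_{i+1})\ne D(\boldsymbol p_i\,\mathrm{cro}(\boldsymbol q,\boldsymbol f,j-1)\,\boldsymbol e_{i+1})=c$. Put $\boldsymbol v=\boldsymbol p_i\,\mathrm{pre}(\boldsymbol q,|\boldsymbol q|-j)$ and $\boldsymbol r=\mathrm{suf}(\boldsymbol e,m-|\boldsymbol v|)$. If $j\ne|\boldsymbol q|$: insert the node $\boldsymbol v$ into the edge $(\boldsymbol p_i,\boldsymbol p_{i+1})$, splitting its label; let $T'$ be a twin-test node $\boldsymbol r$ with leaf $\boldsymbol v$ on edge $(z,c)$ and leaf $\mu$; replace every edge $(\boldsymbol v_1,\boldsymbol v_2)$ with $|\boldsymbol v_1|<|\boldsymbol v|<|\boldsymbol v_2|$ for which $\boldsymbol g=\mathrm{pre}(l(\boldsymbol v_1,\boldsymbol v_2),|\boldsymbol v|-|\boldsymbol v_1|)$ satisfies $T'(\boldsymbol v_1\boldsymbol g)=\boldsymbol v$ by an edge $(\boldsymbol v_1,\boldsymbol v)$ labelled $\boldsymbol g$; replace the leaf $\mu$ of $T_{|\boldsymbol v|}$ by $T'$. In any case execute AddEdge$(\boldsymbol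 v,\boldsymbol r)$. 7. (AddEdge$(\boldsymbol v,\boldsymbol t)$.) For $j=1,2,\dots$ classify $\boldsymbol u'=\boldsymbol v\,\mathrm{pre}(\boldsymbol t,j)$ by $T_{|\boldsymbol v|+j}$ until the result is not $\mu$. If it is a leaf $\boldsymbol u$, add an edge $(\boldsymbol v,\boldsymbol u)$ labelled $\mathrm{pre}(\boldsymbol t,j)$. If the classification is stuck, add a leaf $\boldsymbol u'$ below the single-test node where it is stuck, with the edge label just observed, add $\boldsymbol u'$ to $S$ (as a sink with value $D(\boldsymbol u')$ if $|\boldsymbol u'|=m$) and an edge $(\boldsymbol v,\boldsymbol u')$ labelled $\mathrm{pre}(\boldsymbol t,j)$, and, if $|\boldsymbol u'|<m$, execute AddEdge$(\boldsymbol u',\boldsymbol t)$ and AddEdge$(\boldsymbol u',\dot{\boldsymbol t})$. **Theorem.** Let $D$ be any reduced OMTBDD over $m\ge1$ variables with $n$ nodes. Whatever counterexamples are returned, QLearn-OMTBDD terminates and outputs exactly $D$ (up to the names of the nodes). It asks at most $2n(\lceil\log_2 m\rceil+3n)$ membership queries. It asks at most $n$ equivalence queries, except that it asks exactly $2$ if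 $D$ consists of a single sink with a non-zero label. -/

import Mathlib

/-! ### Ordered multi-terminal binary decision diagrams -/

namespace OMTBDD

/-- Binary strings; assignments to `x₁, …, xₘ` are strings of length `m`. -/
abbrev Str := List Bool

/-- The content of a node: a sink with its value, or an internal node labelled by the variable
that is preceded by `i` variables in the order (that is, by `x_{i+1}`), with the end points of its
`0`-labelled and `1`-labelled edges. -/
inductive Cell (V L : Type*) where
  | sink (value : L)
  | branch (i : ℕ) (lo hi : V)

/-- Renaming the nodes in the content of a node. -/
def Cell.map {V W L : Type*} (f : V → W) : Cell V L → Cell W L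
  | .sink l => .sink l
  | .branch i lo hi => .branch i (f lo) (f hi)

/-- A decision diagram with nodes taken from `V` and function values in `L`. -/
structure Diagram (V L : Type*) where
  root : V
  nodes : Finset V
  cell : V → Cell V L

namespace Diagram

variable {V W L : Type*}

/-- Follow the path of the assignment `a` from node `v`, through at most `fuel` edges. -/
def evalFrom (D : Diagram V L) (a : Str) : (fuel : ℕ) → (v : V) → Option L
  | 0, v =>
    match D.cell v with
    | .sink l => some l
    | .branch _ _ _ => none
  | fuel + 1, v =>
    match D.cell v with
    | .sink l => some l
    | .branch i lo hi => D.evalFrom a fuel (if a.getD i false then hi else lo)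

/-- The value of the represented function at `a`. In a diagram over `m = |a|` variables that is
ordered, every path has at most `m` edges, so that the value is always defined. -/
def eval (D : Diagram V L) (a : Str) : Option L := D.evalFrom a a.length D.root

/-- There is an edge from `v` to `w`. -/
def Child (D : Diagram V L) (v w : V) : Prop :=
  ∃ i lo hi, D.cell v = .branch i lo hi ∧ (w = lo ∨ w = hi)

/-- `D` is a multi-terminal diagram over `m` variables that respects the variable order and has
at most one sink for each value. (Nodes that cannot be reached from the root are not excluded
here.) -/
structure IsOrdered (D : Diagram V L) (m : ℕ) : Prop where
  root_mem : D.root ∈ D.nodes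
  child_mem : ∀ v ∈ D.nodes, ∀ w, D.Child v w → w ∈ D.nodes
  var_lt : ∀ v ∈ D.nodes, ∀ i lo hi, D.cell v = .branch i lo hi → i < m
  ordered : ∀ v ∈ D.nodes, ∀ i lo hi, D.cell v = .branch i lo hi →
    ∀ w, D.Child v w → ∀ j lo' hi', D.cell w = .branch j lo' hi' → i < j
  sink_unique : ∀ v ∈ D.nodes, ∀ w ∈ D.nodes, ∀ l,
    D.cell v = .sink l → D.cell w = .sink l → v = w

/-- `D` is a reduced OMTBDD over `m` variables: every node can be reached from the root, no node
has its two edges ending in the same node, and no two nodes have the same label and the same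
successors. -/
structure IsReduced (D : Diagram V L) (m : ℕ) : Prop extends D.IsOrdered m where
  reachable : ∀ v ∈ D.nodes, Relation.ReflTransGen D.Child D.root v
  no_redundant : ∀ v ∈ D.nodes, ∀ i lo hi, D.cell v = .branch i lo hi → lo ≠ hi
  no_duplicate : ∀ v ∈ D.nodes, ∀ w ∈ D.nodes, D.cell v = D.cell w → v = w

/-- `D` and `E` are the same diagram, up to the names of the nodes. -/
def Iso (D : Diagram V L) (E : Diagram W L) : Prop :=
  ∃ f : V → W, Set.BijOn f (D.nodes : Set V) (E.nodes : Set W) ∧ f D.root = E.root ∧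
    ∀ v ∈ D.nodes, E.cell (f v) = (D.cell v).map f

/-- The diagram that consists of one sink. -/
def const (l : L) : Diagram Str L where
  root := []
  nodes := {[]}
  cell := fun _ => .sink l

end Diagram

/-! ### Learners with membership and equivalence queries -/

/-- Programs of a learner. The only access to the target is through the two kinds of queries:
`mem a k` asks a membership query for `a` and goes on with `k` applied to the answer; `equ H k`
asks an equivalence query for `H` and goes on with `k` applied to the answer, which is `none`
for 'YES' and `some e` for 'NO' with the counterexample `e`. -/
inductive Prog (L : Type) (α : Type) : Type where
  | ret (x : α) : Prog L α
  | mem (a : Str) (k : L → Prog L α) : Prog L α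
  | equ (H : Diagram Str L) (k : Option Str → Prog L α) : Prog L α

namespace Prog

variable {L α β : Type}

/-- Sequential composition. -/
def bind (p : Prog L α) (f : α → Prog L β) : Prog L β :=
  match p with
  | ret x => f x
  | mem a k => mem a fun l => (k l).bind f
  | equ H k => equ H fun r => (k r).bind f

instance : Monad (Prog L) where
  pure := ret
  bind := bind

/-- Run a program with membership oracle `MQ` and equivalence oracle `EQ`; the first argument of
`EQ` is the number of equivalence queries asked before, so that repeated queries may be answered
differently. The result is the output together with the numbers `nE` of equivalence queries and
`nM` of membership queries, counted with repetitions and from the given initial values. -/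
def run (MQ : Str → L) (EQ : ℕ → Diagram Str L → Option Str) :
    Prog L α → (nE nM : ℕ) → α × ℕ × ℕ
  | ret x, nE, nM => (x, nE, nM)
  | mem a k, nE, nM => (k (MQ a)).run MQ EQ nE (nM + 1)
  | equ H k, nE, nM => (k (EQ nE H)).run MQ EQ (nE + 1) nM

end Prog

/-- Ask a membership query. -/
def ask {L : Type} (a : Str) : Prog L L := .mem a .ret

/-- Ask an equivalence query. -/
def askEq {L : Type} (H : Diagram Str L) : Prog L (Option Str) := .equ H .ret

/-- `MQ` answers the membership queries for the target `D` correctly. -/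
def CorrectMQ {V L : Type*} (D : Diagram V L) (m : ℕ) (MQ : Str → L) : Prop :=
  ∀ a : Str, a.length = m → D.eval a = some (MQ a)

/-- `EQ` answers the equivalence queries for the target `D` correctly, with arbitrary
counterexamples. Nothing is demanded for hypotheses that are not ordered diagrams. -/
def CorrectEQ {V L : Type*} (D : Diagram V L) (m : ℕ)
    (EQ : ℕ → Diagram Str L → Option Str) : Prop :=
  ∀ (t : ℕ) (H : Diagram Str L), H.IsOrdered m →
    (EQ t H = none → ∀ a : Str, a.length = m → H.eval a = D.eval a) ∧
    (∀ e, EQ t H = some e → e.length = m ∧ H.eval e ≠ D.eval e)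

/-! ### Strings -/

/-- Flip the first bit. -/
def flip : Str → Str
  | [] => []
  | b :: a => (!b) :: a

/-- `cro a b j`: the first `|a| - j` bits of `a` followed by the last `j` bits of `b`. -/
def cro (a b : Str) (j : ℕ) : Str := a.take (a.length - j) ++ b.drop (b.length - j)

/-! ### Node classification trees -/

/-- Node classification trees. A leaf is labelled by a node id or by `μ`, which is `none`.
`single r dom child` is a single-test node labelled `r`; its outgoing edges are labelled by the
elements of `dom`, the edge labelled `l` leading to `child l` (`child l` is irrelevant for
`l ∉ dom`). `twin r x y hit miss` is a twin-test node labelled `r`; its edge labelled `(x, y)`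
leads to `hit` and its unlabelled edge leads to `miss`. -/
inductive CTree (L : Type) : Type where
  | leaf (v : Option Str) : CTree L
  | single (r : Str) (dom : List L) (child : L → CTree L) : CTree L
  | twin (r : Str) (x y : L) (hit miss : CTree L) : CTree L

/-- Results of a classification of `a`: the label of a leaf, or `stuck l grown` if a single-test
node labelled `r` without an edge labelled `l = D(a r)` has been reached; `grown` is then the
tree after adding a leaf labelled `a` as a child of that node, with an edge labelled `l`. -/
inductive CResult (L : Type) : Type where
  | label (v : Option Str) : CResult L
  | stuck (l : L) (grown : CTree L) : CResult L

/-- Apply `f` to the grown tree, if there is one. -/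
def CResult.mapTree {L : Type} (f : CTree L → CTree L) : CResult L → CResult L
  | .label v => .label v
  | .stuck l T => .stuck l (f T)

namespace CTree

variable {L : Type} [DecidableEq L]

/-- Classify `a` by membership queries. -/
def classify (a : Str) : CTree L → Prog L (CResult L)
  | leaf v => pure (.label v)
  | single r dom child => do
    let l ← ask (a ++ r)
    if l ∈ dom then
      let res ← (child l).classify a
      pure (res.mapTree fun T => single r dom (Function.update child l T))
    else
      pure (.stuck l (single r (l :: dom) (Function.update child l (leaf (some a)))))
  | twin r x y hit miss => do
    let l ← ask (a ++ r)
    let l' ← ask (a ++ flip r)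
    if l = x ∧ l' = y then
      let res ← hit.classify a
      pure (res.mapTree fun T => twin r x y T miss)
    else
      let res ← miss.classify a
      pure (res.mapTree fun T => twin r x y hit T)

/-- Replace the leaf labelled `v` by the tree `T'`. -/
def subst : CTree L → (v : Option Str) → (T' : CTree L) → CTree L
  | leaf w, v, T' => if w = v then T' else leaf w
  | single r dom child, v, T' => single r dom fun l => (child l).subst v T'
  | twin r x y hit miss, v, T' => twin r x y (hit.subst v T') (miss.subst v T')

/-- The label of the last twin-test node on the path from the root to the leaf labelled `v`;
`last` is the label of the last twin-test node above the given tree. -/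
def lastTwin (v : Str) : CTree L → (last : Str) → Option Str
  | leaf w, last => if w = some v then some last else none
  | single _ dom child, last => dom.findSome? fun l => (child l).lastTwin v last
  | twin r _ _ hit miss, _ => (hit.lastTwin v r).or (miss.lastTwin v r)

end CTree

/-! ### OMTBDDs with access strings -/

/-- An edge with its label string. -/
structure Edge where
  src : Str
  lab : Str
  tgt : Str
  deriving DecidableEq

/-- An OMTBDD with access strings: its internal nodes (the root `[]` included, dummy or not), its
sinks with their labels, and its edges. Nodes are given by their id strings; the node `v` that is
not a sink is labelled `x_{|v|+1}`. -/
structure OMTBDDAS (L : Type) where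
  inner : List Str
  sinks : List (Str × L)
  edges : List Edge

namespace OMTBDDAS

variable {L : Type}

/-- The edges that go out from `v`. -/
def out (S : OMTBDDAS L) (v : Str) : List Edge := S.edges.filter fun E => E.src = v

/-- The edge that goes out from `v` and begins with bit `b`. -/
def edge? (S : OMTBDDAS L) (v : Str) (b : Bool) : Option Edge :=
  (S.out v).find? fun E => E.lab.head? = some b

/-- The only outgoing edge of the root, if the root is a dummy. -/
def dummyEdge? (S : OMTBDDAS L) : Option Edge :=
  match S.out [] with
  | [E] => some E
  | _ => none

/-- The edge by which the assignment `e` leaves `v`. -/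
def next? (S : OMTBDDAS L) (e v : Str) : Option Edge :=
  match if v = [] then S.dummyEdge? else none with
  | some E => some E
  | none => S.edge? v (e.getD v.length false)

/-- The edges that `e` passes from `v` on, at most `fuel` many. -/
def pathFrom (S : OMTBDDAS L) (e : Str) : (fuel : ℕ) → (v : Str) → List Edge
  | 0, _ => []
  | fuel + 1, v =>
    match S.next? e v with
    | none => []
    | some E => E :: S.pathFrom e fuel E.tgt

/-- The edges that `e` passes. -/
def path (S : OMTBDDAS L) (e : Str) : List Edge := S.pathFrom e e.length []

/-- The ids of the nodes that `e` passes, beginning with the root. -/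
def ids (S : OMTBDDAS L) (e : Str) : List Str := [] :: (S.path e).map Edge.tgt

/-- The label of the sink `v`. -/
def sinkLabel [Zero L] (S : OMTBDDAS L) (v : Str) : L := (S.sinks.lookup v).getD 0

/-- The value `S(e)`: the label of the sink that `e` reaches. -/
def value [Zero L] (S : OMTBDDAS L) (e : Str) : L := S.sinkLabel ((S.ids e).getLastD [])

/-- Add an edge. -/
def addEdge (S : OMTBDDAS L) (E : Edge) : OMTBDDAS L := { S with edges := E :: S.edges }

/-- Remove the edge `E` and add the edge `E'`. -/
def replaceEdge (S : OMTBDDAS L) (E E' : Edge) : OMTBDDAS L :=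
  { S with edges := E' :: S.edges.erase E }

/-- Add an internal node. -/
def addInner (S : OMTBDDAS L) (v : Str) : OMTBDDAS L := { S with inner := v :: S.inner }

/-- Add a sink with label `l`. -/
def addSink (S : OMTBDDAS L) (v : Str) (l : L) : OMTBDDAS L :=
  { S with sinks := (v, l) :: S.sinks }

/-- The diagram represented by `S`: a dummy root is removed together with its edge, and only the
first bits of the label strings are kept. -/
def toDiagram (S : OMTBDDAS L) : Diagram Str L where
  root :=
    match S.dummyEdge? with
    | some E => E.tgt
    | none => []
  nodes :=
    match S.dummyEdge? with
    | some _ => (S.inner ++ S.sinks.map Prod.fst).toFinset.erase []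
    | none => (S.inner ++ S.sinks.map Prod.fst).toFinset
  cell := fun v =>
    match S.sinks.lookup v with
    | some l => .sink l
    | none => .branch v.length (((S.edge? v false).map Edge.tgt).getD [])
        (((S.edge? v true).map Edge.tgt).getD [])

end OMTBDDAS

/-- What the algorithm stores: an OMTBDDAS and the classification trees `T 1, …, T m`, where
`T i` classifies strings of length `i`. -/
structure Hyp (L : Type) where
  S : OMTBDDAS L
  T : ℕ → CTree L

/-- Replace the tree `T i`. -/
def Hyp.setTree {L : Type} (h : Hyp L) (i : ℕ) (T' : CTree L) : Hyp L :=
  { h with T := Function.update h.T i T' }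

/-- Update the OMTBDDAS. -/
def Hyp.mapS {L : Type} (h : Hyp L) (f : OMTBDDAS L → OMTBDDAS L) : Hyp L :=
  { h with S := f h.S }

/-! ### The algorithm -/

section Algorithm

variable {L : Type} [DecidableEq L]

/-- Binary search: given `phi lo = c` and `phi hi = y ≠ c`, find `i` with `lo < i ≤ hi` and
`phi (i - 1) = c ≠ phi i`, and return `i` and `phi i`. Called with `fuel = hi - lo`, which is
always enough. -/
def bsearch (phi : ℕ → Prog L L) (c : L) : (fuel lo hi : ℕ) → (y : L) → Prog L (ℕ × L)
  | 0, _, hi, y => pure (hi, y)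
  | fuel + 1, lo, hi, y =>
    if hi ≤ lo + 1 then pure (hi, y)
    else do
      let mid := (lo + hi) / 2
      let z ← phi mid
      if z = c then bsearch phi c fuel mid hi y
      else bsearch phi c fuel lo mid z

/-- Algorithm AddEdge: the `for`-loop from index `j` on. `fuel` is the number of indices that
are left, `m + 1 - (|v| + j)`, so that the loop is entered with `fuel = m - |v|` and `j = 1`. -/
def addEdgeFrom (m : ℕ) : (fuel : ℕ) → (v t : Str) → (j : ℕ) → Hyp L → Prog L (Hyp L)
  | 0, _, _, _, h => pure h
  | fuel + 1, v, t, j, h => do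
    let u' := v ++ t.take j
    let res ← (h.T (v.length + j)).classify u'
    match res with
    | .label none => addEdgeFrom m fuel v t (j + 1) h
    | .label (some u) => pure (h.mapS fun S => S.addEdge ⟨v, t.take j, u⟩)
    | .stuck l grown =>
      let h := h.setTree (v.length + j) grown
      if j = m - v.length then
        pure (h.mapS fun S => (S.addSink u' l).addEdge ⟨v, t.take j, u'⟩)
      else do
        let h := h.mapS fun S => (S.addInner u').addEdge ⟨v, t.take j, u'⟩
        let h ← addEdgeFrom m fuel u' t 1 h
        addEdgeFrom m fuel u' (flip t) 1 h

/-- Algorithm AddEdge. -/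
def addEdge (m : ℕ) (v t : Str) (h : Hyp L) : Prog L (Hyp L) :=
  addEdgeFrom m (m - v.length) v t 1 h

/-- The loop of NodeSplit over the edges that enter the node to be split; `Te` is the new part
of the classification tree. -/
def splitLoop (m : ℕ) (t : Str) : List Edge → Hyp L → CTree L → Prog L (Hyp L × CTree L)
  | [], h, Te => pure (h, Te)
  | F :: Fs, h, Te => do
    let v' := F.src ++ F.lab
    let res ← Te.classify v'
    match res with
    | .label none => splitLoop m t Fs h Te
    | .label (some u) =>
      splitLoop m t Fs (h.mapS fun S => S.replaceEdge F ⟨F.src, F.lab, u⟩) Te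
    | .stuck _ grown =>
      let h := h.mapS fun S => (S.addInner v').replaceEdge F ⟨F.src, F.lab, v'⟩
      let h ← addEdge m v' t h
      let h ← addEdge m v' (flip t) h
      splitLoop m t Fs h grown

/-- Algorithm NodeSplit for the edge `E = (pᵢ, pᵢ₊₁)`, with `c = D(p_k)` and
`x = D(pᵢ · l(pᵢ, pᵢ₊₁) · eᵢ₊₁)`. -/
def nodeSplit (m : ℕ) (h : Hyp L) (e : Str) (E : Edge) (c x : L) : Prog L (Hyp L) := do
  let e1 := e.drop E.tgt.length
  let v := E.src ++ E.lab
  let h := h.mapS fun S => (S.addInner v).replaceEdge E ⟨E.src, E.lab, v⟩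
  let Te := CTree.single e1 [c, x] fun l => if l = c then .leaf (some E.tgt) else .leaf (some v)
  let t := ((h.T v.length).lastTwin E.tgt []).getD []
  let h ← addEdge m v t h
  let h ← addEdge m v (flip t) h
  let (h, Te) ← splitLoop m t (h.S.edges.filter fun F => F.tgt = E.tgt) h Te
  pure (h.setTree v.length ((h.T v.length).subst (some E.tgt) Te))

/-- The loop of NewBranchingNode over edges that pass the level of the new node `v`; `Tr` is the
new part of the classification tree. -/
def branchLoop (v : Str) (Tr : CTree L) : List Edge → Hyp L → Prog L (Hyp L)
  | [], h => pure h
  | F :: Fs, h => do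
    let g := F.lab.take (v.length - F.src.length)
    let res ← Tr.classify (F.src ++ g)
    match res with
    | .label (some _) => branchLoop v Tr Fs (h.mapS fun S => S.replaceEdge F ⟨F.src, g, v⟩)
    | _ => branchLoop v Tr Fs h

/-- Algorithm NewBranchingNode for the edge `E = (pᵢ, pᵢ₊₁)`, with `c = D(p_k)` and
`y = D(pᵢ · eᵢ)`. -/
def newBranchingNode (m : ℕ) (h : Hyp L) (e : Str) (E : Edge) (c y : L) : Prog L (Hyp L) := do
  let e1 := e.drop E.tgt.length
  let q := E.lab
  let f := (e.drop E.src.length).take q.length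
  let (j, z) ← bsearch (fun j => ask (E.src ++ cro q f j ++ e1)) c q.length 0 q.length y
  let v := E.src ++ q.take (q.length - j)
  let r := e.drop v.length
  if j ≠ q.length then
    let h := h.mapS fun S =>
      ((S.addInner v).replaceEdge E ⟨E.src, q.take (q.length - j), v⟩).addEdge
        ⟨v, q.drop (q.length - j), E.tgt⟩
    let Tr := CTree.twin r z c (.leaf (some v)) (.leaf none)
    let h ← branchLoop v Tr
      (h.S.edges.filter fun F => F.src.length < v.length ∧ v.length < F.tgt.length) h
    let h := h.setTree v.length ((h.T v.length).subst none Tr)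
    addEdge m v r h
  else
    addEdge m v r h

/-- Algorithm Update-Hypothesis for the counterexample `e` with `l = D(e)`. The binary search
runs along the path of `e` from its end: the node at distance `s` from the sink `p_k` is
`p (k - s)`, where `k` is the number of edges of the path and the root is `p 0`. -/
def updateHypothesis [Zero L] (m : ℕ) (h : Hyp L) (e : Str) (l : L) : Prog L (Hyp L) := do
  let k := (h.S.path e).length
  let p := fun i => (h.S.ids e).getD i []
  let c := h.S.value e
  let (s, y) ← bsearch (fun s => ask (p (k - s) ++ e.drop (p (k - s)).length)) c k 0 k l
  match (h.S.path e)[k - s]? with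
  | none => pure h
  | some E =>
    let x ← ask (E.src ++ E.lab ++ e.drop E.tgt.length)
    if x ≠ c then nodeSplit m h e E c x
    else newBranchingNode m h e E c y

/-- Algorithm Initial-Hypothesis for `e'` and `e` with `D(e') = l' ≠ l = D(e)`. -/
def initialHypothesis (m : ℕ) (e' : Str) (l' : L) (e : Str) (l : L) : Prog L (Hyp L) := do
  let (i, y) ← bsearch (fun i => ask (cro e' e i)) l' m 0 m l
  let v := e'.take (m - i)
  let w := cro e' e i
  let E' : Edge := ⟨v, e'.drop (m - i), e'⟩
  let E : Edge := ⟨v, e.drop (m - i), w⟩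
  pure {
    S := {
      inner := if i = m then [[]] else [[], v]
      sinks := [(e', l'), (w, y)]
      edges := if i = m then [E', E] else [⟨[], v, v⟩, E', E] }
    T := fun d =>
      if d = m then
        .single [] [l', y] fun a => if a = l' then .leaf (some e') else .leaf (some w)
      else if d = m - i then .twin (e.drop (m - i)) y l' (.leaf (some v)) (.leaf none)
      else .leaf none }

/-- The main loop of QLearn-OMTBDD, cut off after `fuel` iterations (with result `none`). -/
def mainLoop [Zero L] (m : ℕ) :
    (fuel : ℕ) → Hyp L → (e : Str) → (l : L) → Prog L (Option (Diagram Str L))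
  | 0, _, _, _ => pure none
  | fuel + 1, h, e, l =>
    if h.S.value e = l then do
      match ← askEq h.S.toDiagram with
      | none => pure (some h.S.toDiagram)
      | some e =>
        let l ← ask e
        let h ← updateHypothesis m h e l
        mainLoop m fuel h e l
    else do
      let h ← updateHypothesis m h e l
      mainLoop m fuel h e l

/-- Algorithm QLearn-OMTBDD for `m` variables, with its main loop cut off after `fuel`
iterations. -/
def qLearn [Zero L] (m fuel : ℕ) : Prog L (Option (Diagram Str L)) := do
  match ← askEq (Diagram.const 0) with
  | none => pure (some (Diagram.const 0))
  | some e' =>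
    let l' ← ask e'
    match ← askEq (Diagram.const l') with
    | none => pure (some (Diagram.const l'))
    | some e =>
      let l ← ask e
      let h ← initialHypothesis m e' l' e l
      mainLoop m fuel h e l

end Algorithm

end OMTBDD

namespace OMTBDD

/-! ### Running programs -/

/-! The nodes of the hypothesis are access strings. Two facts are kept about them. A string of
length i < m that does not reach `μ` in its tree is essential: the target depends on the very next
bit. Each node of positive length reaches its own leaf, and the leaf reached depends only on the
residual function of the string (`CTree.WF.lbl_congr`). So, apart from a dummy root, the nodes have
pairwise different residuals or lengths, and walking them through D ends at distinct nodes of D,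
each exactly at the level of the string (`card_le_of_separated`). A hypothesis therefore never has
more than n nodes. The edges are tied to the trees by `EdgeOK`: source plus label is classified as
the target, and the intermediate prefixes as `μ`.

A counterexample always yields an update. Binary search on its path finds an edge where the value
changes. Either the edge end and its target have different residuals (NodeSplit), or some position
inside the label is essential (NewBranchingNode). Either way `progress`, the number of nodes of the
represented diagram plus one, strictly increases. It starts at 4 or more and is at most n + 1, which
leaves at most n - 3 updates. Two queries for constants, n - 3 for counterexamples and one final YES
make n equivalence queries. After YES, the hypothesis is an ordered diagram for the same function
with at most n nodes, and canonicity of reduced diagrams (`Diagram.IsReduced.iso`) makes it a copy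
of D.

Membership queries for classification are paid from the potential `weight` = 2·(edges)·(nodes).
Classifying a string of length i costs at most twice the number of nodes of that length. AddEdge
tries each level at most once per edge, so one edge costs at most 2·(nodes), the growth of the
potential for that edge. The tests for old edges in the two kinds of update are paid by the
2·(edges) gained with the new node. The final potential is at most 4n(n + 1). Each update needs
besides at most two binary searches, one query for x and one for the value of the counterexample.
The sum is below 2n(⌈log₂ m⌉ + 3n) as n ≥ 3 once a hypothesis exists. -/

theorem Prog.run_bind {L α β : Type} (MQ : Str → L) (EQ : ℕ → Diagram Str L → Option Str)
    (p : Prog L α) (g : α → Prog L β) (nE nM : ℕ) :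
    (p >>= g).run MQ EQ nE nM =
      (g (p.run MQ EQ nE nM).1).run MQ EQ (p.run MQ EQ nE nM).2.1 (p.run MQ EQ nE nM).2.2 := by
  change (p.bind g).run MQ EQ nE nM = _
  induction p generalizing nE nM with
  | ret x => rfl
  | mem a k ih => exact ih _ _ _
  | equ H k ih => exact ih _ _ _

/-- The program `p` asks no equivalence queries and `c` membership queries, and returns `x`, if
membership queries are answered by `f`. -/
def Yields {L α : Type} (f : Str → L) (p : Prog L α) (x : α) (c : ℕ) : Prop :=
  ∀ (EQ : ℕ → Diagram Str L → Option Str) (nE nM : ℕ), p.run f EQ nE nM = (x, nE, nM + c)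

section Yields

variable {L α β : Type} {f : Str → L}

theorem Yields.pure (x : α) : Yields f (pure x : Prog L α) x 0 := fun _ _ _ => rfl

theorem Yields.ask (a : Str) : Yields f (ask a) (f a) 1 := fun _ _ _ => rfl

theorem Yields.bind {p : Prog L α} {g : α → Prog L β} {x : α} {y : β} {c d : ℕ}
    (hp : Yields f p x c) (hg : Yields f (g x) y d) : Yields f (p >>= g) y (c + d) := by
  intro EQ nE nM
  rw [Prog.run_bind, hp]
  simp only
  rw [hg, Nat.add_assoc]

/-- Each query halves the interval, so an interval of length at most 2 ^ k needs at most k queries.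
The fuel only serves the recursion and is independent of this count. -/
theorem Yields.bsearch [DecidableEq L] {phi : ℕ → Prog L L} {g : ℕ → L} {c : L}
    (hphi : ∀ i, Yields f (phi i) (g i) 1) (fuel lo hi k : ℕ) (hlt : lo < hi)
    (hfuel : hi ≤ lo + fuel) (hk : hi ≤ lo + 2 ^ k) (hlo : g lo = c) (hhi : g hi ≠ c) :
    ∃ i q, lo < i ∧ i ≤ hi ∧ g (i - 1) = c ∧ g i ≠ c ∧ q ≤ k ∧
      Yields f (OMTBDD.bsearch phi c fuel lo hi (g hi)) (i, g i) q := by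
  induction fuel generalizing lo hi k with
  | zero => omega
  | succ fuel ih =>
    unfold OMTBDD.bsearch
    split_ifs with h
    · have : hi - 1 = lo := by omega
      exact ⟨hi, 0, hlt, le_rfl, by rw [this, hlo], hhi, Nat.zero_le _, Yields.pure _⟩
    · obtain _ | k := k
      · simp at hk; omega
      rw [pow_succ] at hk
      by_cases hz : g ((lo + hi) / 2) = c
      · obtain ⟨i, q, h1, h2, h3, h4, h5, h6⟩ := ih ((lo + hi) / 2) hi k (by omega) (by omega)
          (by omega) hz hhi
        refine ⟨i, 1 + q, by omega, h2, h3, h4, by omega, ?_⟩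
        refine (hphi _).bind ?_
        rw [if_pos hz]
        exact h6
      · obtain ⟨i, q, h1, h2, h3, h4, h5, h6⟩ := ih lo ((lo + hi) / 2) k (by omega) (by omega)
          (by omega) hlo hz
        refine ⟨i, 1 + q, by omega, by omega, h3, h4, by omega, ?_⟩
        refine (hphi _).bind ?_
        rw [if_neg hz]
        exact h6

end Yields

/-! ### Strings -/

@[simp] theorem length_flip (a : Str) : (flip a).length = a.length := by
  cases a <;> simp [flip]

theorem head?_flip_ne {a : Str} (ha : a ≠ []) : (flip a).head? ≠ a.head? := by
  cases a with
  | nil => exact absurd rfl ha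
  | cons b a => cases b <;> simp [flip]

theorem flip_ne_nil {a : Str} (ha : a ≠ []) : flip a ≠ [] := by
  cases a with
  | nil => exact absurd rfl ha
  | cons b a => simp [flip]

/-! ### Classification -/

/-- The function `f` of the bits of a string of length `m` depends, after the prefix `a`, on the
bit that follows `a`. -/
def Essential {L : Type} (f : Str → L) (m : ℕ) (a : Str) : Prop :=
  ∃ r : Str, r ≠ [] ∧ a.length + r.length = m ∧ f (a ++ r) ≠ f (a ++ flip r)

namespace CTree

variable {L : Type} [DecidableEq L]

/-- The label of the leaf that `a` reaches, or `none` if `a` is stuck. -/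
def lbl (f : Str → L) (a : Str) : CTree L → Option (Option Str)
  | leaf v => some v
  | single r dom child => if f (a ++ r) ∈ dom then (child (f (a ++ r))).lbl f a else none
  | twin r x y hit miss =>
    if f (a ++ r) = x ∧ f (a ++ flip r) = y then hit.lbl f a else miss.lbl f a

/-- The number of queries asked for the classification of `a`. -/
def cost (f : Str → L) (a : Str) : CTree L → ℕ
  | leaf _ => 0
  | single r dom child => 1 + if f (a ++ r) ∈ dom then (child (f (a ++ r))).cost f a else 0
  | twin r x y hit miss =>
    2 + if f (a ++ r) = x ∧ f (a ++ flip r) = y then hit.cost f a else miss.cost f a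

/-- The tree after adding a leaf labelled `a` where `a` is stuck. -/
def grow (f : Str → L) (a : Str) : CTree L → CTree L
  | leaf v => leaf v
  | single r dom child =>
    if f (a ++ r) ∈ dom then
      single r dom (Function.update child (f (a ++ r)) ((child (f (a ++ r))).grow f a))
    else single r (f (a ++ r) :: dom) (Function.update child (f (a ++ r)) (leaf (some a)))
  | twin r x y hit miss =>
    if f (a ++ r) = x ∧ f (a ++ flip r) = y then twin r x y (hit.grow f a) miss
    else twin r x y hit (miss.grow f a)

/-- The value observed at the single-test node at which `a` is stuck. -/
def stuckVal (f : Str → L) (a : Str) : CTree L → L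
  | leaf _ => f a
  | single r dom child =>
    if f (a ++ r) ∈ dom then (child (f (a ++ r))).stuckVal f a else f (a ++ r)
  | twin r x y hit miss =>
    if f (a ++ r) = x ∧ f (a ++ flip r) = y then hit.stuckVal f a else miss.stuckVal f a

/-- The result of the classification of `a`. -/
def result (f : Str → L) (a : Str) (T : CTree L) : CResult L :=
  match T.lbl f a with
  | some v => .label v
  | none => .stuck (T.stuckVal f a) (T.grow f a)

theorem result_of_lbl {f : Str → L} {a : Str} {T : CTree L} {v : Option Str}
    (h : T.lbl f a = some v) : T.result f a = .label v := by
  simp [result, h]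

theorem result_of_stuck {f : Str → L} {a : Str} {T : CTree L}
    (h : T.lbl f a = none) : T.result f a = .stuck (T.stuckVal f a) (T.grow f a) := by
  simp [result, h]

/-- From here on the monadic classification is replaced by the pure functions `lbl`, `cost`, `grow`
and `stuckVal`. -/
theorem yields_classify (f : Str → L) (a : Str) (T : CTree L) :
    Yields f (T.classify a) (T.result f a) (T.cost f a) := by
  induction T with
  | leaf v => exact Yields.pure _
  | single r dom child ih =>
    unfold classify
    refine (Yields.ask (a ++ r)).bind ?_
    by_cases h : f (a ++ r) ∈ dom
    · rw [if_pos h, if_pos h]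
      refine Eq.subst (motive := fun c => Yields f _ _ c) (Nat.add_zero _)
        ((ih (f (a ++ r))).bind ?_)
      have : (single r dom child).result f a = ((child (f (a ++ r))).result f a).mapTree
          fun T => single r dom (Function.update child (f (a ++ r)) T) := by
        simp only [result, lbl, stuckVal, grow, if_pos h]
        cases (child (f (a ++ r))).lbl f a <;> rfl
      rw [this]
      exact Yields.pure _
    · rw [if_neg h, if_neg h]
      have : (single r dom child).result f a = .stuck (f (a ++ r)) (single r (f (a ++ r) :: dom)
          (Function.update child (f (a ++ r)) (leaf (some a)))) := by
        simp only [result, lbl, stuckVal, grow, if_neg h]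
      rw [this]
      exact Yields.pure _
  | twin r x y hit miss ih1 ih2 =>
    unfold classify
    have e : (twin r x y hit miss).cost f a =
        1 + (1 + ((if f (a ++ r) = x ∧ f (a ++ flip r) = y then hit.cost f a
          else miss.cost f a) + 0)) := by
      simp only [cost]; omega
    rw [e]
    refine (Yields.ask (a ++ r)).bind ((Yields.ask (a ++ flip r)).bind ?_)
    by_cases h : f (a ++ r) = x ∧ f (a ++ flip r) = y
    · rw [if_pos h, if_pos h]
      refine ih1.bind ?_
      have : (twin r x y hit miss).result f a =
          (hit.result f a).mapTree fun T => twin r x y T miss := by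
        simp only [result, lbl, stuckVal, grow, if_pos h]
        cases hit.lbl f a <;> rfl
      rw [this]
      exact Yields.pure _
    · rw [if_neg h, if_neg h]
      refine ih2.bind ?_
      have : (twin r x y hit miss).result f a =
          (miss.result f a).mapTree fun T => twin r x y hit T := by
        simp only [result, lbl, stuckVal, grow, if_neg h]
        cases miss.lbl f a <;> rfl
      rw [this]
      exact Yields.pure _

theorem lbl_subst (f : Str → L) (a : Str) (T : CTree L) (v : Option Str) (T' : CTree L) :
    (T.subst v T').lbl f a = if T.lbl f a = some v then T'.lbl f a else T.lbl f a := by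
  induction T with
  | leaf w =>
    by_cases h : w = v <;> simp [subst, lbl, h]
  | single r dom child ih =>
    by_cases h : f (a ++ r) ∈ dom <;> simp [subst, lbl, h, ih]
  | twin r x y hit miss ih1 ih2 =>
    by_cases h : f (a ++ r) = x ∧ f (a ++ flip r) = y <;> simp [subst, lbl, h, ih1, ih2]

/-- Only the strings that reached the replaced leaf pay for the new tests. This is what bounds the
price of a substitution in the tree of a level. -/
theorem cost_subst (f : Str → L) (a : Str) (T : CTree L) (v : Option Str) (T' : CTree L) :
    (T.subst v T').cost f a = T.cost f a + if T.lbl f a = some v then T'.cost f a else 0 := by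
  induction T with
  | leaf w =>
    by_cases h : w = v <;> simp [subst, lbl, cost, h]
  | single r dom child ih =>
    by_cases h : f (a ++ r) ∈ dom <;> simp [subst, lbl, cost, h, ih, add_assoc]
  | twin r x y hit miss ih1 ih2 =>
    by_cases h : f (a ++ r) = x ∧ f (a ++ flip r) = y <;>
      simp [subst, lbl, cost, h, ih1, ih2, add_assoc]

theorem lbl_grow_self {f : Str → L} {a : Str} {T : CTree L} (h : T.lbl f a = none) :
    (T.grow f a).lbl f a = some (some a) := by
  induction T with
  | leaf w => simp [lbl] at h
  | single r dom child ih =>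
    by_cases hd : f (a ++ r) ∈ dom
    · simp only [lbl, if_pos hd] at h
      simp [grow, lbl, hd, ih _ h]
    · simp [grow, lbl, hd]
  | twin r x y hit miss ih1 ih2 =>
    by_cases hd : f (a ++ r) = x ∧ f (a ++ flip r) = y
    · simp only [lbl, if_pos hd] at h
      simp only [grow, if_pos hd, lbl, ih1 h]
    · simp only [lbl, if_neg hd] at h
      simp only [grow, if_neg hd, lbl, ih2 h]

/-- The new leaf hangs on an edge that did not exist, so only strings that were stuck can notice it,
and their new label is `a`. -/
theorem lbl_grow (f : Str → L) (a b : Str) (T : CTree L) :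
    (T.grow f a).lbl f b = T.lbl f b ∨
      T.lbl f b = none ∧ (T.grow f a).lbl f b = some (some a) := by
  induction T with
  | leaf w => exact Or.inl rfl
  | single r dom child ih =>
    by_cases hd : f (a ++ r) ∈ dom
    · simp only [grow, if_pos hd, lbl]
      by_cases hb : f (b ++ r) = f (a ++ r)
      · simpa [hb, hd] using ih (f (a ++ r))
      · simp [hb]
    · simp only [grow, if_neg hd, lbl]
      by_cases hb : f (b ++ r) = f (a ++ r)
      · simp [hb, hd, lbl]
      · simp [hb]
  | twin r x y hit miss ih1 ih2 =>
    by_cases hd : f (a ++ r) = x ∧ f (a ++ flip r) = y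
    · simp only [grow, if_pos hd, lbl]
      split_ifs
      · exact ih1
      · exact Or.inl rfl
    · simp only [grow, if_neg hd, lbl]
      split_ifs
      · exact Or.inl rfl
      · exact ih2

theorem lbl_grow_of_some {f : Str → L} {a b : Str} {T : CTree L} {v : Option Str}
    (h : T.lbl f b = some v) : (T.grow f a).lbl f b = some v := by
  rcases lbl_grow f a b T with h1 | ⟨h1, -⟩
  · rw [h1, h]
  · rw [h] at h1; exact absurd h1 (by simp)

/-- A new leaf adds no test: a string that was stuck had already asked its last query. -/
theorem cost_grow (f : Str → L) (a b : Str) (T : CTree L) :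
    (T.grow f a).cost f b = T.cost f b := by
  induction T with
  | leaf w => rfl
  | single r dom child ih =>
    by_cases hd : f (a ++ r) ∈ dom
    · simp only [grow, if_pos hd, cost]
      by_cases hb : f (b ++ r) = f (a ++ r)
      · simp [hb, hd, ih]
      · simp [hb]
    · simp only [grow, if_neg hd, cost]
      by_cases hb : f (b ++ r) = f (a ++ r)
      · simp [hb, hd, cost]
      · simp [hb]
  | twin r x y hit miss ih1 ih2 =>
    by_cases hd : f (a ++ r) = x ∧ f (a ++ flip r) = y
    · simp only [grow, if_pos hd, cost, ih1]
    · simp only [grow, if_neg hd, cost, ih2]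

/-- All tests use strings of length `k`, and every labelled leaf lies below a twin-test node or
`last` has length `k`, where `last` is the label of the last twin-test node above the tree. -/
def WF (k : ℕ) : CTree L → (last : Str) → Prop
  | leaf none, _ => True
  | leaf (some _), last => last.length = k
  | single r dom child, last => r.length = k ∧ last.length = k ∧ ∀ l ∈ dom, (child l).WF k last
  | twin r _ _ hit miss, _ => r.length = k ∧ hit.WF k r ∧ miss.WF k r

/-- A leaf labelled `μ` may lie below no twin test at all, so the length of `last` is available only
when a labelled leaf is replaced. -/
theorem WF.subst {L : Type} {k : ℕ} {T T' : CTree L} {v : Option Str} {last : Str} (h : T.WF k last)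
    (h' : ∀ last : Str, (v ≠ none → last.length = k) → T'.WF k last) :
    (T.subst v T').WF k last := by
  induction T generalizing last with
  | leaf w =>
    by_cases hw : w = v
    · subst hw
      simp only [CTree.subst, if_true]
      refine h' _ fun hv => ?_
      cases w with
      | none => exact absurd rfl hv
      | some u => exact h
    · simpa [CTree.subst, hw] using h
  | single r dom child ih => exact ⟨h.1, h.2.1, fun l hl => ih l (h.2.2 l hl)⟩
  | twin r x y hit miss ih1 ih2 => exact ⟨h.1, ih1 h.2.1, ih2 h.2.2⟩

theorem WF.grow {k : ℕ} {T : CTree L} {last : Str} (h : T.WF k last) (f : Str → L) (a : Str) :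
    (T.grow f a).WF k last := by
  induction T generalizing last with
  | leaf w => exact h
  | single r dom child ih =>
    by_cases hd : f (a ++ r) ∈ dom
    · simp only [CTree.grow, if_pos hd]
      refine ⟨h.1, h.2.1, fun l hl => ?_⟩
      by_cases hl' : l = f (a ++ r)
      · subst hl'
        simpa using ih _ (h.2.2 _ hl)
      · simpa [Function.update_of_ne hl'] using h.2.2 l hl
    · simp only [CTree.grow, if_neg hd]
      refine ⟨h.1, h.2.1, fun l hl => ?_⟩
      by_cases hl' : l = f (a ++ r)
      · subst hl'
        simpa [WF] using h.2.1
      · simpa [Function.update_of_ne hl'] using h.2.2 l ((List.mem_cons.1 hl).resolve_left hl')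
  | twin r x y hit miss ih1 ih2 =>
    by_cases hd : f (a ++ r) = x ∧ f (a ++ flip r) = y
    · simp only [CTree.grow, if_pos hd]
      exact ⟨h.1, ih1 h.2.1, h.2.2⟩
    · simp only [CTree.grow, if_neg hd]
      exact ⟨h.1, h.2.1, ih2 h.2.2⟩

theorem WF.length_lastTwin {L : Type} {k : ℕ} {T : CTree L} {last p t : Str} (h : T.WF k last)
    (ht : T.lastTwin p last = some t) : t.length = k := by
  induction T generalizing last with
  | leaf w =>
    by_cases hw : w = some p
    · subst hw
      simp [lastTwin] at ht
      exact ht ▸ h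
    · simp [lastTwin, hw] at ht
  | single r dom child ih =>
    obtain ⟨l, hl, hl'⟩ := List.exists_of_findSome?_eq_some ht
    exact ih l (h.2.2 l hl) hl'
  | twin r x y hit miss ih1 ih2 =>
    rcases Option.or_eq_some_iff.1 ht with h1 | ⟨-, h1⟩
    · exact ih1 h.2.1 h1
    · exact ih2 h.2.2 h1

theorem isSome_lastTwin {f : Str → L} {T : CTree L} {a p : Str} (last : Str)
    (h : T.lbl f a = some (some p)) : (T.lastTwin p last).isSome := by
  induction T generalizing last with
  | leaf w =>
    simp only [lbl, Option.some.injEq] at h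
    simp [lastTwin, h]
  | single r dom child ih =>
    by_cases hd : f (a ++ r) ∈ dom
    · simp only [lbl, if_pos hd] at h
      exact List.findSome?_isSome_iff.2 ⟨_, hd, ih _ _ h⟩
    · simp [lbl, hd] at h
  | twin r x y hit miss ih1 ih2 =>
    rw [lastTwin, Option.isSome_or, Bool.or_eq_true]
    by_cases hd : f (a ++ r) = x ∧ f (a ++ flip r) = y
    · simp only [lbl, if_pos hd] at h
      exact Or.inl (ih1 _ h)
    · simp only [lbl, if_neg hd] at h
      exact Or.inr (ih2 _ h)

/-- All tests append strings of length k, so classification sees only the residual after the string.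
Read contrapositively: different leaves certify different residuals. -/
theorem WF.lbl_congr {k : ℕ} {T : CTree L} {last : Str} (h : T.WF k last) {f : Str → L}
    {a b : Str} (hab : ∀ s : Str, s.length = k → f (a ++ s) = f (b ++ s)) :
    T.lbl f a = T.lbl f b := by
  induction T generalizing last with
  | leaf w => rfl
  | single r dom child ih =>
    simp only [lbl, hab r h.1]
    split_ifs with hd
    · exact ih _ (h.2.2 _ hd)
    · rfl
  | twin r x y hit miss ih1 ih2 =>
    simp only [lbl, hab r h.1, hab (flip r) (by rw [length_flip, h.1])]
    rw [ih1 h.2.1, ih2 h.2.2]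

/-- The form of the tree that classifies strings of full length: a single test of the value. -/
def IsTop (f : Str → L) (T : CTree L) : Prop :=
  ∃ dom child, T = single [] dom child ∧ ∀ l ∈ dom, ∃ u, child l = leaf (some u) ∧ f u = l

/-- Full strings are never classified as `μ`, which is why the loop of AddEdge must stop, and on the
last level agreement of leaves means agreement of values. -/
theorem IsTop.eq_of_lbl {f : Str → L} {T : CTree L} (h : T.IsTop f) {a : Str} {v : Option Str}
    (hv : T.lbl f a = some v) : ∃ u, v = some u ∧ f u = f a := by
  obtain ⟨dom, child, rfl, hc⟩ := h
  simp only [lbl, List.append_nil] at hv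
  split_ifs at hv with hd
  obtain ⟨u, hu, hfu⟩ := hc _ hd
  rw [hu] at hv
  exact ⟨u, by simpa [lbl] using hv.symm, hfu⟩

theorem IsTop.stuckVal_eq {f : Str → L} {T : CTree L} (h : T.IsTop f) (a : Str) :
    T.stuckVal f a = f a := by
  obtain ⟨dom, child, rfl, hc⟩ := h
  simp only [stuckVal, List.append_nil]
  split_ifs with hd
  · obtain ⟨u, hu, -⟩ := hc _ hd
    rw [hu]; rfl
  · rfl

theorem IsTop.grow {f : Str → L} {T : CTree L} (h : T.IsTop f) (a : Str) :
    (T.grow f a).IsTop f := by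
  obtain ⟨dom, child, rfl, hc⟩ := h
  simp only [CTree.grow, List.append_nil]
  split_ifs with hd
  · refine ⟨_, _, rfl, fun l hl => ?_⟩
    by_cases hl' : l = f a
    · obtain ⟨u, hu, hfu⟩ := hc _ hd
      exact ⟨u, by simp [hl', hu, CTree.grow], hl' ▸ hfu⟩
    · simpa [Function.update_of_ne hl'] using hc l hl
  · refine ⟨_, _, rfl, fun l hl => ?_⟩
    by_cases hl' : l = f a
    · exact ⟨a, by simp [hl'], hl'.symm⟩
    · simpa [Function.update_of_ne hl'] using hc l ((List.mem_cons.1 hl).resolve_left hl')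

end CTree

end OMTBDD

/-! ### Ordered diagrams: evaluation, residual functions, canonicity of reduced diagrams -/

namespace OMTBDD

namespace Diagram

variable {V W L : Type*}

/-- The number of variables that precede the label of the node `v`; `m` if `v` is a sink. -/
def level (D : Diagram V L) (m : ℕ) (v : V) : ℕ :=
  match D.cell v with
  | .sink _ => m
  | .branch i _ _ => i

theorem level_of_sink {D : Diagram V L} {m : ℕ} {v : V} {l : L} (h : D.cell v = .sink l) :
    D.level m v = m := by simp [level, h]

theorem level_of_branch {D : Diagram V L} {m i : ℕ} {v lo hi : V}
    (h : D.cell v = .branch i lo hi) : D.level m v = i := by simp [level, h]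

theorem evalFrom_of_sink {D : Diagram V L} {v : V} {l : L} (h : D.cell v = .sink l) (a : Str)
    (n : ℕ) : D.evalFrom a n v = some l := by
  cases n <;> simp [evalFrom, h]

theorem evalFrom_succ {D : Diagram V L} {v lo hi : V} {i : ℕ} (h : D.cell v = .branch i lo hi)
    (a : Str) (n : ℕ) :
    D.evalFrom a (n + 1) v = D.evalFrom a n (if a.getD i false then hi else lo) := by
  simp [evalFrom, h]

theorem child_ite {D : Diagram V L} {v lo hi : V} {i : ℕ} (h : D.cell v = .branch i lo hi)
    (b : Bool) : D.Child v (if b then hi else lo) :=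
  ⟨i, lo, hi, h, by cases b <;> simp⟩

section Ordered

variable {D : Diagram V L} {m : ℕ} (hD : D.IsOrdered m)

include hD

theorem IsOrdered.level_le {v : V} (hv : v ∈ D.nodes) : D.level m v ≤ m := by
  cases h : D.cell v with
  | sink l => rw [level_of_sink h]
  | branch i lo hi => rw [level_of_branch h]; exact (hD.var_lt v hv i lo hi h).le

theorem IsOrdered.level_lt_child {v w : V} (hv : v ∈ D.nodes) (h : D.Child v w) :
    D.level m v < D.level m w := by
  obtain ⟨i, lo, hi, hc, hw⟩ := h
  rw [level_of_branch hc]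
  cases hcw : D.cell w with
  | sink l => rw [level_of_sink hcw]; exact hD.var_lt v hv i lo hi hc
  | branch j lo' hi' =>
    rw [level_of_branch hcw]
    exact hD.ordered v hv i lo hi hc w ⟨i, lo, hi, hc, hw⟩ j lo' hi' hcw

/-- Levels increase along edges and are bounded by m, so one may induct from the sinks upwards. -/
theorem IsOrdered.induction {P : (v : V) → v ∈ D.nodes → Prop}
    (step : ∀ (v : V) (hv : v ∈ D.nodes),
      (∀ (w : V) (hw : w ∈ D.nodes), D.level m v < D.level m w → P w hw) → P v hv) :
    ∀ (v : V) (hv : v ∈ D.nodes), P v hv := by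
  suffices ∀ k, ∀ (v : V) (hv : v ∈ D.nodes), m - D.level m v = k → P v hv from
    fun v hv => this _ v hv rfl
  intro k
  induction k using Nat.strong_induction_on with
  | _ k ih =>
    intro v hv hk
    refine step v hv fun w hw hlt => ih _ ?_ w hw rfl
    have := hD.level_le hw
    omega

/-- Below `v` a path has at most m minus the level of `v` edges; any larger fuel gives the same
value. Afterwards fuel m is used at every node, which makes `evalFrom` at a node a function of the
assignment alone. -/
theorem IsOrdered.evalFrom_fuel {v : V} (hv : v ∈ D.nodes) (a : Str) {n n' : ℕ}
    (hn : m ≤ n + D.level m v) (hn' : m ≤ n' + D.level m v) :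
    D.evalFrom a n v = D.evalFrom a n' v := by
  induction v, hv using hD.induction generalizing n n' with
  | step v hv ih =>
    cases h : D.cell v with
    | sink l => rw [evalFrom_of_sink h, evalFrom_of_sink h]
    | branch i lo hi =>
      have h1 := hD.var_lt v hv i lo hi h
      rw [level_of_branch h] at hn hn'
      obtain ⟨k, rfl⟩ : ∃ k, n = k + 1 := ⟨n - 1, by omega⟩
      obtain ⟨k', rfl⟩ : ∃ k, n' = k + 1 := ⟨n' - 1, by omega⟩
      have hc := child_ite h (a.getD i false)
      have hl := hD.level_lt_child hv hc
      rw [evalFrom_succ h, evalFrom_succ h]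
      rw [level_of_branch h] at hl
      exact ih _ (hD.child_mem v hv _ hc) (by rwa [level_of_branch h]) (by omega) (by omega)

theorem IsOrdered.evalFrom_branch {v lo hi : V} {i : ℕ} (hv : v ∈ D.nodes)
    (h : D.cell v = .branch i lo hi) (a : Str) :
    D.evalFrom a m v = D.evalFrom a m (if a.getD i false then hi else lo) := by
  have hc := child_ite h (a.getD i false)
  rw [hD.evalFrom_fuel hv a (n' := m + 1) (by omega) (by omega), evalFrom_succ h]

theorem IsOrdered.evalFrom_congr {v : V} (hv : v ∈ D.nodes) {a b : Str}
    (hab : ∀ j, D.level m v ≤ j → a.getD j false = b.getD j false) :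
    D.evalFrom a m v = D.evalFrom b m v := by
  induction v, hv using hD.induction with
  | step v hv ih =>
    cases h : D.cell v with
    | sink l => rw [evalFrom_of_sink h, evalFrom_of_sink h]
    | branch i lo hi =>
      have hc := child_ite h (a.getD i false)
      have hl := hD.level_lt_child hv hc
      rw [hD.evalFrom_branch hv h, hD.evalFrom_branch hv h,
        ← hab i (level_of_branch h).le]
      exact ih _ (hD.child_mem v hv _ hc) hl fun j hj => hab j (by omega)

theorem IsOrdered.evalFrom_set {v lo hi : V} {i : ℕ} (hv : v ∈ D.nodes)
    (h : D.cell v = .branch i lo hi) {a : Str} (ha : a.length = m) (b : Bool) :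
    D.evalFrom (a.set i b) m v = D.evalFrom a m (if b then hi else lo) := by
  have hi' := hD.var_lt v hv i lo hi h
  have hg : (a.set i b).getD i false = b := by simp [List.getD, ha, hi']
  have hc := child_ite h b
  have hl := hD.level_lt_child hv hc
  rw [level_of_branch h] at hl
  rw [hD.evalFrom_branch hv h, hg]
  refine hD.evalFrom_congr (hD.child_mem v hv _ hc) fun j hj => ?_
  have : i ≠ j := by omega
  simp [List.getD, List.getElem?_set_ne this]

theorem IsOrdered.evalFrom_set_lt {v : V} {i : ℕ} (hv : v ∈ D.nodes) (hi : i < D.level m v)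
    (a : Str) (b : Bool) : D.evalFrom (a.set i b) m v = D.evalFrom a m v := by
  refine hD.evalFrom_congr hv fun j hj => ?_
  have : i ≠ j := by omega
  simp [List.getD, List.getElem?_set_ne this]

/-- The node at which one is when a prefix `p` has been read from the node `v`. -/
theorem IsOrdered.exists_walk {v : V} (hv : v ∈ D.nodes) (p : Str) (hp : p.length ≤ m) :
    ∃ w ∈ D.nodes, p.length ≤ D.level m w ∧
      ∀ a : Str, D.evalFrom (p ++ a) m v = D.evalFrom (p ++ a) m w := by
  induction v, hv using hD.induction with
  | step v hv ih =>
    by_cases hl : p.length ≤ D.level m v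
    · exact ⟨v, hv, hl, fun a => rfl⟩
    · cases h : D.cell v with
      | sink l => rw [level_of_sink h] at hl; exact absurd hp hl
      | branch i lo hi =>
        have hc := child_ite h (p.getD i false)
        have hl' := hD.level_lt_child hv hc
        obtain ⟨w, hw, h1, h2⟩ := ih _ (hD.child_mem v hv _ hc) hl'
        refine ⟨w, hw, h1, fun a => ?_⟩
        rw [level_of_branch h] at hl
        rw [← h2, hD.evalFrom_branch hv h]
        rw [List.getD_append _ _ _ _ (by omega)]

end Ordered

/-- Distinct nodes of `D` represent distinct functions. -/
def Separated (D : Diagram V L) (m : ℕ) : Prop :=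
  ∀ v ∈ D.nodes, ∀ w ∈ D.nodes,
    (∀ a : Str, a.length = m → D.evalFrom a m v = D.evalFrom a m w) → v = w

theorem IsOrdered.evalFrom_lo_eq_hi {D : Diagram V L} {m : ℕ} (hD : D.IsOrdered m)
    {v lo hi : V} {i : ℕ} (hv : v ∈ D.nodes) (h : D.cell v = .branch i lo hi)
    (hind : ∀ a : Str, a.length = m →
      D.evalFrom (a.set i false) m v = D.evalFrom (a.set i true) m v)
    {a : Str} (ha : a.length = m) : D.evalFrom a m lo = D.evalFrom a m hi := by
  have h1 := hD.evalFrom_set hv h ha false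
  have h2 := hD.evalFrom_set hv h ha true
  simp only [Bool.false_eq_true, if_false, if_true] at h1 h2
  rw [← h1, ← h2, hind a ha]

/-- Induction on the distance from the last level. Nodes on different levels differ because the
upper one depends on its own variable, which the lower one ignores. Nodes on the same level with
equal functions have equal cofactors, hence by induction equal successors, and are then duplicates.
-/
theorem IsReduced.separated {D : Diagram V L} {m : ℕ} (hD : D.IsReduced m) :
    D.Separated m := by
  have hO := hD.toIsOrdered
  suffices ∀ k, ∀ v ∈ D.nodes, ∀ w ∈ D.nodes, m ≤ k + D.level m v → m ≤ k + D.level m w →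
      (∀ a : Str, a.length = m → D.evalFrom a m v = D.evalFrom a m w) → v = w from
    fun v hv w hw h => this m v hv w hw (by omega) (by omega) h
  intro k
  induction k with
  | zero =>
    intro v hv w hw h1 h2 h
    cases hcv : D.cell v with
    | branch i lo hi =>
      rw [level_of_branch hcv] at h1
      have := hO.var_lt v hv i lo hi hcv
      omega
    | sink l =>
      cases hcw : D.cell w with
      | branch i lo hi =>
        rw [level_of_branch hcw] at h2
        have := hO.var_lt w hw i lo hi hcw
        omega
      | sink l' =>
        have := h (List.replicate m false) (by simp)
        rw [evalFrom_of_sink hcv, evalFrom_of_sink hcw, Option.some.injEq] at this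
        exact hD.no_duplicate v hv w hw (by rw [hcv, hcw, this])
  | succ k ih =>
    -- A branching node depends on its own variable: otherwise its successors represent the same
    -- function and coincide by induction, making the node redundant.
    have key : ∀ v ∈ D.nodes, m ≤ k + 1 + D.level m v → ∀ i lo hi, D.cell v = .branch i lo hi →
        ¬ ∀ a : Str, a.length = m →
          D.evalFrom (a.set i false) m v = D.evalFrom (a.set i true) m v := by
      intro v hv hlv i lo hi hc hind
      have hlo := child_ite hc false
      have hhi := child_ite hc true
      simp only [Bool.false_eq_true, if_false, if_true] at hlo hhi
      have h1 := hO.level_lt_child hv hlo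
      have h2 := hO.level_lt_child hv hhi
      exact hD.no_redundant v hv i lo hi hc
        (ih lo (hO.child_mem v hv _ hlo) hi (hO.child_mem v hv _ hhi) (by omega) (by omega)
          fun a ha => hO.evalFrom_lo_eq_hi hv hc hind ha)
    have key2 : ∀ v ∈ D.nodes, ∀ w ∈ D.nodes, m ≤ k + 1 + D.level m v →
        (∀ a : Str, a.length = m → D.evalFrom a m v = D.evalFrom a m w) →
        D.level m v < D.level m w → False := by
      intro v hv w hw hlv h hlt
      cases hcv : D.cell v with
      | sink l =>
        rw [level_of_sink hcv] at hlt
        have := hO.level_le hw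
        omega
      | branch i lo hi =>
        refine key v hv hlv i lo hi hcv fun a ha => ?_
        rw [level_of_branch hcv] at hlt
        rw [h _ (by simpa using ha), h _ (by simpa using ha), hO.evalFrom_set_lt hw hlt,
          hO.evalFrom_set_lt hw hlt]
    intro v hv w hw h1 h2 h
    rcases lt_trichotomy (D.level m v) (D.level m w) with hlt | heq | hlt
    · exact (key2 v hv w hw h1 h hlt).elim
    · cases hcv : D.cell v with
      | sink l =>
        cases hcw : D.cell w with
        | branch i lo hi =>
          rw [level_of_sink hcv, level_of_branch hcw] at heq
          have := hO.var_lt w hw i lo hi hcw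
          omega
        | sink l' =>
          have := h (List.replicate m false) (by simp)
          rw [evalFrom_of_sink hcv, evalFrom_of_sink hcw, Option.some.injEq] at this
          exact hD.no_duplicate v hv w hw (by rw [hcv, hcw, this])
      | branch i lo hi =>
        cases hcw : D.cell w with
        | sink l' =>
          rw [level_of_sink hcw, level_of_branch hcv] at heq
          have := hO.var_lt v hv i lo hi hcv
          omega
        | branch j lo' hi' =>
          rw [level_of_branch hcw, level_of_branch hcv] at heq
          subst heq
          -- Setting the bit of the common variable to b turns the function of either node into that
          -- of its b-successor.
          have hb : ∀ b : Bool, (if b then hi else lo) = (if b then hi' else lo') := by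
            intro b
            have hv' := hO.level_lt_child hv (child_ite hcv b)
            have hw' := hO.level_lt_child hw (child_ite hcw b)
            refine ih _ (hO.child_mem v hv _ (child_ite hcv b)) _
              (hO.child_mem w hw _ (child_ite hcw b)) (by omega) (by omega) fun a ha => ?_
            rw [← hO.evalFrom_set hv hcv ha b, ← hO.evalFrom_set hw hcw ha b,
              h _ (by simpa using ha)]
          have e1 := hb false
          have e2 := hb true
          simp only [Bool.false_eq_true, if_false, if_true] at e1 e2
          exact hD.no_duplicate v hv w hw (by rw [hcv, hcw, e1, e2])
    · exact (key2 w hw v hv h2 (fun a ha => (h a ha).symm) hlt).elim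

/-- If the node ignored its variable, its successors would coincide by separation, and then the node
would represent the function of its successor on a strictly larger level. Only separation is
assumed, so that this applies to a hypothesis that is not yet known to be reduced. -/
theorem Separated.exists_ne {D : Diagram V L} {m : ℕ} (hS : D.Separated m) (hD : D.IsOrdered m)
    {v lo hi : V} {i : ℕ} (hv : v ∈ D.nodes) (h : D.cell v = .branch i lo hi) :
    ∃ a : Str, a.length = m ∧
      D.evalFrom (a.set i false) m v ≠ D.evalFrom (a.set i true) m v := by
  by_contra! hind
  have hlo := child_ite h false
  have hhi := child_ite h true
  simp only [Bool.false_eq_true, if_false, if_true] at hlo hhi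
  have hl := hD.child_mem v hv _ hlo
  have e := hS lo hl hi (hD.child_mem v hv _ hhi)
    fun a ha => hD.evalFrom_lo_eq_hi hv h hind ha
  have := hS v hv lo hl fun a ha => by rw [hD.evalFrom_branch hv h, ← e, ite_self]
  have hlt := hD.level_lt_child hv hlo
  rw [← this] at hlt
  exact lt_irrefl _ hlt

/-- A node is determined by any path to it: the function that it represents is a residual of the
function that the diagram represents. -/
theorem IsReduced.exists_access {D : Diagram V L} {m : ℕ} (hD : D.IsReduced m) {d : V}
    (hd : d ∈ D.nodes) :
    ∃ p : Str, p.length = D.level m d ∧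
      ∀ a : Str, D.evalFrom (p ++ a) m D.root = D.evalFrom (p ++ a) m d := by
  have hO := hD.toIsOrdered
  suffices d ∈ D.nodes ∧ ∃ p : Str, p.length = D.level m d ∧
      ∀ a : Str, D.evalFrom (p ++ a) m D.root = D.evalFrom (p ++ a) m d from this.2
  induction hD.reachable d hd with
  -- The bits before the level of a node are not read, so arbitrary padding makes the access string
  -- exactly as long as the level.
  | refl => exact ⟨hd, List.replicate (D.level m D.root) false, by simp, fun a => rfl⟩
  | @tail u w _ hc ih =>
    have hu : u ∈ D.nodes := by
      rename_i hr
      clear ih hc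
      induction hr with
      | refl => exact hO.root_mem
      | tail _ hc ih => exact hO.child_mem _ ih _ hc
    obtain ⟨-, p, hp, h⟩ := ih hu
    have hlt := hO.level_lt_child hu hc
    obtain ⟨i, lo, hi, hcu, hw⟩ := hc
    obtain ⟨b, rfl⟩ : ∃ b : Bool, w = if b then hi else lo := by
      rcases hw with rfl | rfl
      · exact ⟨false, rfl⟩
      · exact ⟨true, rfl⟩
    rw [level_of_branch hcu] at hp hlt
    refine ⟨hO.child_mem _ hu _ (child_ite hcu b), p ++ b :: List.replicate
      (D.level m (if b then hi else lo) - i - 1) false, ?_, fun a => ?_⟩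
    · simp [hp]; omega
    · have : (p ++ b :: (List.replicate (D.level m (if b then hi else lo) - i - 1) false ++ a)).getD
          i false = b := by simp [List.getD, ← hp]
      rw [List.append_assoc, h, hO.evalFrom_branch hu hcu]
      rw [List.cons_append, this]

/-- Canonicity of reduced diagrams. -/
theorem IsReduced.iso {D : Diagram V L} {H : Diagram W L} {m : ℕ} (hD : D.IsReduced m)
    (hH : H.IsOrdered m) (heq : ∀ a : Str, a.length = m → H.eval a = D.eval a)
    (hcard : H.nodes.card ≤ D.nodes.card) : D.Iso H := by
  have hO := hD.toIsOrdered
  have hS := hD.separated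
  -- The counterpart of d is found by reading an access string of d in `H`: both nodes then
  -- represent the same residual of the common function.
  have hex : ∀ d ∈ D.nodes, ∃ w ∈ H.nodes,
      ∀ a : Str, a.length = m → H.evalFrom a m w = D.evalFrom a m d := by
    intro d hd
    obtain ⟨p, hp, h⟩ := hD.exists_access hd
    have hpm : p.length ≤ m := hp ▸ hO.level_le hd
    obtain ⟨w, hw, h1, h2⟩ := hH.exists_walk hH.root_mem p hpm
    refine ⟨w, hw, fun a ha => ?_⟩
    have hlen : (p ++ a.drop p.length).length = m := by simp [ha]; omega
    have hagree : ∀ j, p.length ≤ j →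
        a.getD j false = (p ++ a.drop p.length).getD j false := by
      intro j hj
      rw [List.getD_append_right _ _ _ _ hj]
      simp [List.getD, List.getElem?_drop, Nat.add_sub_cancel' hj]
    have h3 := heq _ hlen
    simp only [eval, hlen] at h3
    rw [hH.evalFrom_congr hw fun j hj => hagree j (h1.trans hj), ← h2, h3, h,
      ← hO.evalFrom_congr hd fun j hj => hagree j (hp ▸ hj)]
  have : Nonempty W := ⟨H.root⟩
  choose! φ hφ hφe using hex
  have hinj : Set.InjOn φ (D.nodes : Set V) := fun v hv w hw h =>
    hS v hv w hw fun a ha => by rw [← hφe v hv a ha, ← hφe w hw a ha, h]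
  -- The map is injective by separation; the bound on the number of nodes of `H` makes it onto. This
  -- also rules out unreachable nodes in `H`.
  have hsurj : ∀ w ∈ H.nodes, ∃ v ∈ D.nodes, φ v = w := fun w hw => by
    obtain ⟨v, hv, h⟩ := Finset.surj_on_of_inj_on_of_card_le (fun v _ => φ v)
      (fun v hv => hφ v hv) (fun v w hv hw h => hinj hv hw h) hcard w hw
    exact ⟨v, hv, h.symm⟩
  -- Separation is transported along the bijection; with it the function of a node determines its
  -- content in `H` as well.
  have hSH : H.Separated m := by
    intro v hv w hw h
    obtain ⟨v, hv', rfl⟩ := hsurj v hv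
    obtain ⟨w, hw', rfl⟩ := hsurj w hw
    rw [hS v hv' w hw' fun a ha => by rw [← hφe v hv' a ha, ← hφe w hw' a ha, h a ha]]
  have hset : ∀ (a : Str) (i : ℕ) (b : Bool), a.length = m → (a.set i b).length = m := by simp
  refine ⟨φ, ⟨fun v hv => hφ v hv, hinj, fun w hw => ?_⟩, ?_, fun v hv => ?_⟩
  · obtain ⟨v, hv, h⟩ := hsurj w hw
    exact ⟨v, hv, h⟩
  · refine hSH _ (hφ _ hO.root_mem) _ hH.root_mem fun a ha => ?_
    have h3 := heq _ ha
    simp only [eval, ha] at h3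
    rw [hφe _ hO.root_mem a ha, h3]
  · cases hcv : D.cell v with
    | sink l =>
      cases hcw : H.cell (φ v) with
      | sink l' =>
        have := hφe v hv (List.replicate m false) (by simp)
        rw [evalFrom_of_sink hcv, evalFrom_of_sink hcw, Option.some.injEq] at this
        rw [this, Cell.map]
      | branch i lo hi =>
        obtain ⟨a, ha, hne⟩ := hSH.exists_ne hH (hφ v hv) hcw
        rw [hφe v hv _ (hset _ _ _ ha), hφe v hv _ (hset _ _ _ ha), evalFrom_of_sink hcv,
          evalFrom_of_sink hcv] at hne
        exact absurd rfl hne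
    | branch i lo hi =>
      obtain ⟨a, ha, hne⟩ := hS.exists_ne hO hv hcv
      cases hcw : H.cell (φ v) with
      | sink l' =>
        rw [← hφe v hv _ (hset _ _ _ ha), ← hφe v hv _ (hset _ _ _ ha), evalFrom_of_sink hcw,
          evalFrom_of_sink hcw] at hne
        exact absurd rfl hne
      | branch j lo' hi' =>
        obtain ⟨a', ha', hne'⟩ := hSH.exists_ne hH (hφ v hv) hcw
        -- The variable with the smaller index matters for one of two equal functions and is ignored
        -- by the other.
        rcases lt_trichotomy i j with hlt | rfl | hlt
        · rw [← hφe v hv _ (hset _ _ _ ha), ← hφe v hv _ (hset _ _ _ ha),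
            hH.evalFrom_set_lt (hφ v hv) (by rwa [level_of_branch hcw]),
            hH.evalFrom_set_lt (hφ v hv) (by rwa [level_of_branch hcw])] at hne
          exact absurd rfl hne
        · have hb : ∀ b : Bool, (if b then hi' else lo') = φ (if b then hi else lo) := by
            intro b
            have hcm := hO.child_mem v hv _ (child_ite hcv b)
            refine hSH _ (hH.child_mem _ (hφ v hv) _ (child_ite hcw b)) _
              (hφ _ hcm) fun a ha => ?_
            rw [← hH.evalFrom_set (hφ v hv) hcw ha b, hφe _ hcm a ha,
              hφe v hv _ (hset _ _ _ ha), hO.evalFrom_set hv hcv ha b]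
          have e1 := hb false
          have e2 := hb true
          simp only [Bool.false_eq_true, if_false, if_true] at e1 e2
          rw [Cell.map, e1, e2]
        · rw [hφe v hv _ (hset _ _ _ ha'), hφe v hv _ (hset _ _ _ ha'),
            hO.evalFrom_set_lt hv (by rwa [level_of_branch hcv]),
            hO.evalFrom_set_lt hv (by rwa [level_of_branch hcv])] at hne'
          exact absurd rfl hne'

end Diagram

/-- Strings that reach pairwise distinct nodes exactly at the level of these nodes are at most as
many as there are nodes. -/
theorem card_le_of_separated {V : Type*} {L : Type} {D : Diagram V L} {m : ℕ}
    (hD : D.IsOrdered m) {f : Str → L} (hf : CorrectMQ D m f) {X : Finset Str}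
    (hX : ∀ a ∈ X, a.length = m ∨ Essential f m a)
    (hsep : ∀ a ∈ X, ∀ b ∈ X, a.length = b.length →
      (∀ s : Str, a.length + s.length = m → f (a ++ s) = f (b ++ s)) → a = b) :
    X.card ≤ D.nodes.card := by
  have hlen : ∀ a ∈ X, a.length ≤ m := by
    intro a ha
    rcases hX a ha with h | ⟨r, -, h, -⟩ <;> omega
  have hex : ∀ p : Str, p.length ≤ m → ∃ w ∈ D.nodes, p.length ≤ D.level m w ∧
      ∀ a : Str, D.evalFrom (p ++ a) m D.root = D.evalFrom (p ++ a) m w :=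
    fun p hp => hD.exists_walk hD.root_mem p hp
  have hne : Nonempty V := ⟨D.root⟩
  choose! g hg hgl hge using hex
  have hval : ∀ a : Str, a.length ≤ m → ∀ s : Str, a.length + s.length = m →
      some (f (a ++ s)) = D.evalFrom (a ++ s) m (g a) := by
    intro a ha s hs
    have hl : (a ++ s).length = m := by simpa using hs
    rw [← hf _ hl, Diagram.eval, hl, hge a ha]
  -- A walk along a may jump beyond level |a|, but then the next bit would be ignored, contradicting
  -- essentiality. So the node determines the length of the string too.
  have hlevel : ∀ a ∈ X, D.level m (g a) = a.length := by
    intro a ha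
    rcases hX a ha with h | ⟨r, hr, hl, hfr⟩
    · have h1 := hgl a h.le
      have h2 := hD.level_le (hg a h.le)
      omega
    · by_contra hcon
      have h1 := hgl a (hlen a ha)
      refine hfr (Option.some_injective _ ?_)
      rw [hval a (hlen a ha) r hl, hval a (hlen a ha) (flip r) (by simpa using hl)]
      refine hD.evalFrom_congr (hg a (hlen a ha)) fun j hj => ?_
      rw [List.getD_append_right _ _ _ _ (by omega), List.getD_append_right _ _ _ _ (by omega)]
      obtain ⟨k, hk⟩ : ∃ k, j - a.length = k + 1 := ⟨j - a.length - 1, by omega⟩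
      rw [hk]
      cases r with
      | nil => exact absurd rfl hr
      | cons b r => simp [flip]
  refine Finset.card_le_card_of_injOn g (fun a ha => hg a (hlen a ha)) ?_
  intro a ha b hb hab
  have hl : a.length = b.length := by rw [← hlevel a ha, ← hlevel b hb, hab]
  refine hsep a ha b hb hl fun s hs => Option.some_injective _ ?_
  rw [hval a (hlen a ha) s hs, hval b (hlen b hb) s (by omega), ← hab]
  refine hD.evalFrom_congr (hg a (hlen a ha)) fun j hj => ?_
  rw [hlevel a ha] at hj
  rw [List.getD_append_right _ _ _ _ hj, List.getD_append_right _ _ _ _ (by omega), hl]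

end OMTBDD

namespace OMTBDD

/-! ### Invariants of the hypothesis -/

namespace OMTBDDAS

variable {L : Type}

/-- The ids of all nodes. -/
def nodeSet (S : OMTBDDAS L) : Finset Str := (S.inner ++ S.sinks.map Prod.fst).toFinset

/-- The ids of length `i`. -/
def level (S : OMTBDDAS L) (i : ℕ) : Finset Str := S.nodeSet.filter fun v => v.length = i

/-- The node `v` has an outgoing edge that begins with bit `b`. -/
def HasOut (S : OMTBDDAS L) (v : Str) (b : Bool) : Prop :=
  ∃ E ∈ S.edges, E.src = v ∧ E.lab.head? = some b

/-- The node `v` has both outgoing edges. -/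
def Full (S : OMTBDDAS L) (v : Str) : Prop := ∀ b, S.HasOut v b

/-- The bound on the number of queries asked for classifications. -/
def weight (S : OMTBDDAS L) : ℕ := 2 * S.edges.length * S.nodeSet.card

theorem mem_nodeSet {S : OMTBDDAS L} {v : Str} :
    v ∈ S.nodeSet ↔ v ∈ S.inner ∨ ∃ l, (v, l) ∈ S.sinks := by
  simp [nodeSet]

theorem mem_level {S : OMTBDDAS L} {v : Str} {i : ℕ} :
    v ∈ S.level i ↔ v ∈ S.nodeSet ∧ v.length = i := by
  simp [level]

theorem nodeSet_addInner (S : OMTBDDAS L) (v : Str) :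
    (S.addInner v).nodeSet = insert v S.nodeSet := by
  ext u; simp [nodeSet, addInner]

theorem nodeSet_addSink (S : OMTBDDAS L) (v : Str) (l : L) :
    (S.addSink v l).nodeSet = insert v S.nodeSet := by
  ext u; simp [nodeSet, addSink]

theorem level_of_nodeSet_insert {S S' : OMTBDDAS L} {v : Str}
    (h : S'.nodeSet = insert v S.nodeSet) : S'.level v.length = insert v (S.level v.length) := by
  rw [level, h, Finset.filter_insert, if_pos rfl]; rfl

theorem level_of_nodeSet_insert_ne {S S' : OMTBDDAS L} {v : Str} {i : ℕ}
    (h : S'.nodeSet = insert v S.nodeSet) (hi : v.length ≠ i) : S'.level i = S.level i := by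
  rw [level, h, Finset.filter_insert, if_neg hi]; rfl

/-- The structural invariant. -/
structure IsValid (f : Str → L) (m : ℕ) (S : OMTBDDAS L) : Prop where
  inner_lt : ∀ v ∈ S.inner, v.length < m
  sink_ok : ∀ p ∈ S.sinks, p.1.length = m ∧ p.2 = f p.1
  root_mem : [] ∈ S.inner
  src_mem : ∀ E ∈ S.edges, E.src ∈ S.inner
  tgt_mem : ∀ E ∈ S.edges, E.tgt ∈ S.nodeSet
  length_eq : ∀ E ∈ S.edges, E.src.length + E.lab.length = E.tgt.length
  lab_ne : ∀ E ∈ S.edges, E.lab ≠ []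
  nodup : S.edges.Nodup
  edge_inj : ∀ E ∈ S.edges, ∀ F ∈ S.edges, E.src = F.src → E.lab.head? = F.lab.head? → E = F

theorem IsValid.length_le {f : Str → L} {m : ℕ} {S : OMTBDDAS L} (h : S.IsValid f m) {v : Str}
    (hv : v ∈ S.nodeSet) : v.length ≤ m := by
  rcases mem_nodeSet.1 hv with hv | ⟨l, hl⟩
  · exact (h.inner_lt v hv).le
  · exact (h.sink_ok _ hl).1.le

theorem IsValid.addEdge {f : Str → L} {m : ℕ} {S : OMTBDDAS L} (h : S.IsValid f m) {E : Edge}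
    (h1 : E.src ∈ S.inner) (h2 : E.tgt ∈ S.nodeSet)
    (h3 : E.src.length + E.lab.length = E.tgt.length) (h4 : E.lab ≠ [])
    (h5 : ∀ F ∈ S.edges, F.src = E.src → F.lab.head? ≠ E.lab.head?) :
    (S.addEdge E).IsValid f m where
  inner_lt := h.inner_lt
  sink_ok := h.sink_ok
  root_mem := h.root_mem
  src_mem := List.forall_mem_cons.2 ⟨h1, h.src_mem⟩
  tgt_mem := List.forall_mem_cons.2 ⟨h2, h.tgt_mem⟩
  length_eq := List.forall_mem_cons.2 ⟨h3, h.length_eq⟩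
  lab_ne := List.forall_mem_cons.2 ⟨h4, h.lab_ne⟩
  nodup := List.nodup_cons.2 ⟨fun hE => h5 E hE rfl rfl, h.nodup⟩
  edge_inj := by
    intro F hF G hG h6 h7
    rcases List.mem_cons.1 hF with rfl | hF' <;> rcases List.mem_cons.1 hG with rfl | hG'
    · rfl
    · exact absurd h7.symm (h5 G hG' h6.symm)
    · exact absurd h7 (h5 F hF' h6)
    · exact h.edge_inj F hF' G hG' h6 h7

theorem IsValid.addInner {f : Str → L} {m : ℕ} {S : OMTBDDAS L} (h : S.IsValid f m) {v : Str}
    (hv : v.length < m) : (S.addInner v).IsValid f m where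
  inner_lt := List.forall_mem_cons.2 ⟨hv, h.inner_lt⟩
  sink_ok := h.sink_ok
  root_mem := List.mem_cons_of_mem _ h.root_mem
  src_mem := fun E hE => List.mem_cons_of_mem _ (h.src_mem E hE)
  tgt_mem := fun E hE => by
    rw [nodeSet_addInner]; exact Finset.mem_insert_of_mem (h.tgt_mem E hE)
  length_eq := h.length_eq
  lab_ne := h.lab_ne
  nodup := h.nodup
  edge_inj := h.edge_inj

theorem IsValid.addSink {f : Str → L} {m : ℕ} {S : OMTBDDAS L} (h : S.IsValid f m) {v : Str}
    (hv : v.length = m) : (S.addSink v (f v)).IsValid f m where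
  inner_lt := h.inner_lt
  sink_ok := List.forall_mem_cons.2 ⟨⟨hv, rfl⟩, h.sink_ok⟩
  root_mem := h.root_mem
  src_mem := h.src_mem
  tgt_mem := fun E hE => by
    rw [nodeSet_addSink]; exact Finset.mem_insert_of_mem (h.tgt_mem E hE)
  length_eq := h.length_eq
  lab_ne := h.lab_ne
  nodup := h.nodup
  edge_inj := h.edge_inj

theorem IsValid.mem_replaceEdge {f : Str → L} {m : ℕ} {S : OMTBDDAS L} (h : S.IsValid f m)
    {E E' F : Edge} : F ∈ (S.replaceEdge E E').edges ↔ F = E' ∨ (F ≠ E ∧ F ∈ S.edges) := by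
  simp [replaceEdge, h.nodup.mem_erase_iff]

/-- The new edge keeps the source and the first bit of the old one and hence occupies the slot that
was freed. -/
theorem IsValid.replaceEdge {f : Str → L} {m : ℕ} {S : OMTBDDAS L} (h : S.IsValid f m)
    {E E' : Edge} (hE : E ∈ S.edges) (h1 : E'.src = E.src) (h2 : E'.tgt ∈ S.nodeSet)
    (h3 : E'.src.length + E'.lab.length = E'.tgt.length) (h4 : E'.lab ≠ [])
    (h5 : E'.lab.head? = E.lab.head?) : (S.replaceEdge E E').IsValid f m := by
  have key : ∀ F ∈ S.edges.erase E, F.src = E'.src → F.lab.head? = E'.lab.head? → False := by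
    intro F hF h6 h7
    rw [h.nodup.mem_erase_iff] at hF
    exact hF.1 (h.edge_inj F hF.2 E hE (h6.trans h1) (h7.trans h5))
  have hsub : ∀ F ∈ S.edges.erase E, F ∈ S.edges := fun F hF => List.mem_of_mem_erase hF
  exact
  { inner_lt := h.inner_lt
    sink_ok := h.sink_ok
    root_mem := h.root_mem
    src_mem := List.forall_mem_cons.2 ⟨h1 ▸ h.src_mem E hE, fun F hF => h.src_mem F (hsub F hF)⟩
    tgt_mem := List.forall_mem_cons.2 ⟨h2, fun F hF => h.tgt_mem F (hsub F hF)⟩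
    length_eq := List.forall_mem_cons.2 ⟨h3, fun F hF => h.length_eq F (hsub F hF)⟩
    lab_ne := List.forall_mem_cons.2 ⟨h4, fun F hF => h.lab_ne F (hsub F hF)⟩
    nodup := List.nodup_cons.2 ⟨fun hF => key E' hF rfl rfl, h.nodup.erase E⟩
    edge_inj := by
      intro F hF G hG h6 h7
      rcases List.mem_cons.1 hF with rfl | hF' <;> rcases List.mem_cons.1 hG with rfl | hG'
      · rfl
      · exact (key G hG' h6.symm h7.symm).elim
      · exact (key F hF' h6 h7).elim
      · exact h.edge_inj F (hsub F hF') G (hsub G hG') h6 h7 }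

theorem length_replaceEdge {S : OMTBDDAS L} {E E' : Edge} (hE : E ∈ S.edges) :
    (S.replaceEdge E E').edges.length = S.edges.length := by
  have := List.length_pos_of_mem hE
  simp only [replaceEdge, List.length_cons, List.length_erase_of_mem hE]
  omega

theorem IsValid.hasOut_replaceEdge {f : Str → L} {m : ℕ} {S : OMTBDDAS L} (h : S.IsValid f m)
    {E E' : Edge} (hE : E ∈ S.edges) (h1 : E'.src = E.src) (h5 : E'.lab.head? = E.lab.head?)
    (v : Str) (b : Bool) : (S.replaceEdge E E').HasOut v b ↔ S.HasOut v b := by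
  constructor
  · rintro ⟨F, hF, h6, h7⟩
    rcases h.mem_replaceEdge.1 hF with rfl | ⟨-, hF⟩
    · exact ⟨E, hE, h1 ▸ h6, h5 ▸ h7⟩
    · exact ⟨F, hF, h6, h7⟩
  · rintro ⟨F, hF, h6, h7⟩
    by_cases hFE : F = E
    · subst hFE
      exact ⟨E', h.mem_replaceEdge.2 (Or.inl rfl), h1.trans h6, h5.trans h7⟩
    · exact ⟨F, h.mem_replaceEdge.2 (Or.inr ⟨hFE, hF⟩), h6, h7⟩

end OMTBDDAS

open OMTBDDAS

/-! ### Growth of a hypothesis under AddEdge -/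

section

variable {L : Type}

/-- The changes made by AddEdge: nodes of length greater than `d` and edges that begin at nodes of
length at least `d` are added; those that begin at old nodes satisfy `P`. -/
structure Grows (d : ℕ) (P : Str → Option Bool → Prop) (h h' : Hyp L) : Prop where
  edges : ∃ new, h'.S.edges = new ++ h.S.edges ∧
    ∀ E ∈ new, d ≤ E.src.length ∧ (E.src ∈ h.S.inner → P E.src E.lab.head?)
  tree_eq : ∀ i ≤ d, h'.T i = h.T i
  level_eq : ∀ i ≤ d, h'.S.level i = h.S.level i
  inner_sub : h.S.inner ⊆ h'.S.inner
  sinks_sub : h.S.sinks ⊆ h'.S.sinks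

/-- The second condition has to imply the first only at nodes of the initial hypothesis; what
happens at nodes created in between is unrestricted. -/
theorem Grows.trans {d d' : ℕ} {P P' : Str → Option Bool → Prop} {h h' h'' : Hyp L}
    (h1 : Grows d P h h') (h2 : Grows d' P' h' h'') (hd : d ≤ d')
    (hP : ∀ u ∈ h.S.inner, ∀ b, P' u b → P u b) : Grows d P h h'' where
  edges := by
    obtain ⟨n1, e1, p1⟩ := h1.edges
    obtain ⟨n2, e2, p2⟩ := h2.edges
    refine ⟨n2 ++ n1, by rw [e2, e1, List.append_assoc], fun E hE => ?_⟩
    rcases List.mem_append.1 hE with hE | hE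
    · exact ⟨hd.trans (p2 E hE).1, fun hs => hP _ hs _ ((p2 E hE).2 (h1.inner_sub hs))⟩
    · exact p1 E hE
  tree_eq := fun i hi => (h2.tree_eq i (hi.trans hd)).trans (h1.tree_eq i hi)
  level_eq := fun i hi => (h2.level_eq i (hi.trans hd)).trans (h1.level_eq i hi)
  inner_sub := fun _ hv => h2.inner_sub (h1.inner_sub hv)
  sinks_sub := fun _ hv => h2.sinks_sub (h1.sinks_sub hv)

theorem Grows.mem_edges {d : ℕ} {P : Str → Option Bool → Prop} {h h' : Hyp L}
    (hg : Grows d P h h') {E : Edge} (hE : E ∈ h.S.edges) : E ∈ h'.S.edges := by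
  obtain ⟨n, e, -⟩ := hg.edges
  rw [e]
  exact List.mem_append_right _ hE

theorem Grows.hasOut {d : ℕ} {P : Str → Option Bool → Prop} {h h' : Hyp L}
    (hg : Grows d P h h') {v : Str} {b : Bool} : h.S.HasOut v b → h'.S.HasOut v b := by
  rintro ⟨E, hE, h1⟩
  exact ⟨E, hg.mem_edges hE, h1⟩

theorem Grows.of_hasOut {d : ℕ} {P : Str → Option Bool → Prop} {h h' : Hyp L}
    (hg : Grows d P h h') {v : Str} {b : Bool} (hv : v ∈ h.S.inner) (ho : h'.S.HasOut v b) :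
    h.S.HasOut v b ∨ P v (some b) := by
  obtain ⟨n, e, hn⟩ := hg.edges
  obtain ⟨E, hE, h1, h2⟩ := ho
  rw [e] at hE
  rcases List.mem_append.1 hE with hE | hE
  · have := (hn E hE).2 (h1 ▸ hv)
    rw [h1, h2] at this
    exact Or.inr this
  · exact Or.inl ⟨E, hE, h1, h2⟩

theorem Grows.node_sub {d : ℕ} {P : Str → Option Bool → Prop} {h h' : Hyp L}
    (hg : Grows d P h h') : h.S.nodeSet ⊆ h'.S.nodeSet := by
  intro v hv
  rcases mem_nodeSet.1 hv with hv | ⟨l, hl⟩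
  · exact mem_nodeSet.2 (Or.inl (hg.inner_sub hv))
  · exact mem_nodeSet.2 (Or.inr ⟨l, hg.sinks_sub hl⟩)

end

/-! ### Invariants level by level, and the correctness and cost of AddEdge -/

variable {L : Type} [DecidableEq L]

/-- The invariant of the tree that classifies the strings of length `i`, where `ns` is the set of
the nodes of this length. -/
structure TreeOK (f : Str → L) (m i : ℕ) (ns : Finset Str) (T : CTree L) : Prop where
  lbl_self : ∀ v ∈ ns, T.lbl f v = some (some v)
  mem_of_lbl : ∀ a u : Str, a.length = i → T.lbl f a = some (some u) → u ∈ ns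
  essential : i < m → ∀ a : Str, a.length = i → T.lbl f a ≠ some none → Essential f m a
  cost_le : ∀ a : Str, T.cost f a ≤ 2 * ns.card
  wf : T.WF (m - i) []

/-- The classification tree for strings of length `i` agrees with the edge `E`. -/
structure EdgeOK (f : Str → L) (i : ℕ) (T : CTree L) (E : Edge) : Prop where
  land : E.src.length + E.lab.length = i → T.lbl f (E.src ++ E.lab) = some (some E.tgt)
  cross : E.src.length < i → i < E.src.length + E.lab.length →
    T.lbl f (E.src ++ E.lab.take (i - E.src.length)) = some none

/-- The invariant that concerns the strings of length `i`. -/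
structure LevelOK (f : Str → L) (m : ℕ) (S : OMTBDDAS L) (i : ℕ) (T : CTree L) : Prop where
  tree : TreeOK f m i (S.level i) T
  edge : ∀ E ∈ S.edges, EdgeOK f i T E

/-- A stuck string is not classified as `μ`, so it was already covered by `essential`; its leaf adds
no test, while the allowance grows with the new node. -/
theorem TreeOK.grow {f : Str → L} {m i : ℕ} {ns : Finset Str} {T : CTree L}
    (h : TreeOK f m i ns T) {a : Str} (hs : T.lbl f a = none) :
    TreeOK f m i (insert a ns) (T.grow f a) where
  lbl_self := by
    intro v hv
    rcases Finset.mem_insert.1 hv with rfl | hv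
    · exact CTree.lbl_grow_self hs
    · exact CTree.lbl_grow_of_some (h.lbl_self v hv)
  mem_of_lbl := by
    intro b u hb hu
    rcases CTree.lbl_grow f a b T with h1 | ⟨-, h1⟩
    · exact Finset.mem_insert_of_mem (h.mem_of_lbl b u hb (h1 ▸ hu))
    · rw [h1] at hu
      simp only [Option.some.injEq] at hu
      exact hu ▸ Finset.mem_insert_self _ _
  essential := by
    intro hi b hb hne
    refine h.essential hi b hb fun h1 => hne (CTree.lbl_grow_of_some h1)
  cost_le := by
    intro b
    rw [CTree.cost_grow]
    exact (h.cost_le b).trans (Nat.mul_le_mul_left 2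
      (Finset.card_le_card (Finset.subset_insert _ _)))
  wf := h.wf.grow f a

theorem EdgeOK.grow {f : Str → L} {i : ℕ} {T : CTree L} {E : Edge} (h : EdgeOK f i T E)
    (a : Str) : EdgeOK f i (T.grow f a) E where
  land := fun h1 => CTree.lbl_grow_of_some (h.land h1)
  cross := fun h1 h2 => CTree.lbl_grow_of_some (h.cross h1 h2)

/-- Both conditions concern levels strictly beyond the source, so an edge that starts at level i or
later constrains nothing there. -/
theorem EdgeOK.of_le {f : Str → L} {i : ℕ} (T : CTree L) {E : Edge} (h : i ≤ E.src.length)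
    (hE : E.lab ≠ []) : EdgeOK f i T E where
  land := fun h1 => by
    have := List.length_pos_iff.2 hE
    omega
  cross := fun h1 _ => by omega

theorem EdgeOK.of_gt {f : Str → L} {i : ℕ} (T : CTree L) {E : Edge}
    (h : E.src.length + E.lab.length < i) : EdgeOK f i T E where
  land := fun h1 => by omega
  cross := fun h1 _ => by omega

theorem LevelOK.mono {f : Str → L} {m i : ℕ} {S S' : OMTBDDAS L} {T : CTree L}
    (h : LevelOK f m S i T) (hl : S'.level i = S.level i)
    (hE : ∀ E ∈ S'.edges, E ∈ S.edges ∨ EdgeOK f i T E) : LevelOK f m S' i T where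
  tree := hl ▸ h.tree
  edge := fun E hE' => (hE E hE').elim (h.edge E) id

/-- Up to level d neither the tree nor the nodes change, and the added edges start too late to
matter. -/
theorem Grows.levelOK {f : Str → L} {m d i : ℕ} {P : Str → Option Bool → Prop} {h h' : Hyp L}
    (hg : Grows d P h h') (hv : h'.S.IsValid f m) (hi : i ≤ d)
    (ho : LevelOK f m h.S i (h.T i)) : LevelOK f m h'.S i (h'.T i) := by
  rw [hg.tree_eq i hi]
  refine ho.mono (hg.level_eq i hi) fun E hE => ?_
  obtain ⟨n, e, hn⟩ := hg.edges
  have hE' := hE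
  rw [e] at hE
  rcases List.mem_append.1 hE with hE | hE
  · exact Or.inr (EdgeOK.of_le _ (hi.trans (hn E hE).1) (hv.lab_ne E hE'))
  · exact Or.inl hE

/-- What AddEdge achieves for an edge that leaves `v` and begins with bit `b`. -/
structure AddEdgePost (f : Str → L) (m : ℕ) (v : Str) (b : Bool) (h h' : Hyp L) : Prop where
  valid : h'.S.IsValid f m
  levels : ∀ i, v.length < i → i ≤ m → LevelOK f m h'.S i (h'.T i)
  top : (h'.T m).IsTop f
  grows : Grows v.length (fun u c => u = v ∧ c = some b) h h'
  out : h'.S.HasOut v b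
  full_new : ∀ u ∈ h'.S.inner, u ∈ h.S.inner ∨ h'.S.Full u

theorem bool_eq_of_ne : ∀ {b b' d : Bool}, b' ≠ b → d ≠ b → d = b' := by decide

/-- Induction on the number of remaining levels, which also decreases in the two recursive calls at
a new node. The last hypothesis records that the earlier prefixes are classified as `μ`, as
`EdgeOK.cross` will demand of the edge. In the cost bound, the nodes shorter than the current index
stand for the levels already tried: the one edge that ends the loop pays for all levels together. -/
theorem addEdgeFrom_spec {f : Str → L} {m : ℕ} (fuel : ℕ) :
    ∀ {v t : Str} {b : Bool} {j : ℕ} {h : Hyp L}, h.S.IsValid f m →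
      (∀ i, v.length < i → i ≤ m → LevelOK f m h.S i (h.T i)) → (h.T m).IsTop f →
      v ∈ h.S.inner → m ≤ v.length + t.length → fuel + v.length + j = m + 1 → 1 ≤ j →
      t.head? = some b → ¬ h.S.HasOut v b →
      (∀ i, 1 ≤ i → i < j → (h.T (v.length + i)).lbl f (v ++ t.take i) = some none) →
      ∃ h' c, Yields f (addEdgeFrom m fuel v t j h) h' c ∧ AddEdgePost f m v b h h' ∧
        c + 2 * (h.S.nodeSet.filter fun u => u.length < v.length + j).card + h.S.weight ≤
          h'.S.weight := by
  induction fuel with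
  | zero =>
    intro v t b j h hV _ hT hv _ hf _ _ _ hμ
    have hlt := hV.inner_lt v hv
    -- Running out of levels would mean that a string of full length was classified as `μ`, which
    -- the value test on level m excludes.
    have h1 := hμ (m - v.length) (by omega) (by omega)
    rw [Nat.add_sub_cancel' hlt.le] at h1
    obtain ⟨u, hu, -⟩ := hT.eq_of_lbl h1
    exact absurd hu (by simp)
  | succ fuel ih =>
    intro v t b j h hV hL hT hv ht hf hj hb ho hμ
    have hlt := hV.inner_lt v hv
    have hLj := hL (v.length + j) (by omega) (by omega)
    have hjt : (t.take j).length = j := by rw [List.length_take]; omega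
    have hlen : (v ++ t.take j).length = v.length + j := by rw [List.length_append, hjt]
    have hne : t.take j ≠ [] := by
      intro h0; rw [h0] at hjt; simp at hjt; omega
    have hhead : (t.take j).head? = some b := by
      rw [List.head?_take, if_neg (by omega), hb]
    have hno : ∀ F ∈ h.S.edges, F.src = v → F.lab.head? ≠ (t.take j).head? := by
      intro F hF h1 h2
      exact ho ⟨F, hF, h1, h2.trans hhead⟩
    have hcost := hLj.tree.cost_le (v ++ t.take j)
    -- Trying one more level uses up the nodes of this level in the allowance of the pending edge.
    have hcard : (h.S.nodeSet.filter fun u => u.length < v.length + j).card +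
        (h.S.level (v.length + j)).card =
        (h.S.nodeSet.filter fun u => u.length < v.length + (j + 1)).card := by
      rw [level, ← Finset.card_union_of_disjoint]
      · congr 1
        ext u
        simp only [Finset.mem_union, Finset.mem_filter]
        constructor
        · rintro (⟨h1, h2⟩ | ⟨h1, h2⟩) <;> exact ⟨h1, by omega⟩
        · rintro ⟨h1, h2⟩
          by_cases h3 : u.length = v.length + j
          · exact Or.inr ⟨h1, h3⟩
          · exact Or.inl ⟨h1, by omega⟩
      · rw [Finset.disjoint_filter]
        intro u _ h1 h2
        omega
    have hcardle := Finset.card_filter_le h.S.nodeSet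
      fun u => u.length < v.length + (j + 1)
    have hcl := CTree.yields_classify f (v ++ t.take j) (h.T (v.length + j))
    rcases hl : (h.T (v.length + j)).lbl f (v ++ t.take j) with _ | _ | u
    · -- stuck
      rw [CTree.result_of_stuck hl] at hcl
      -- Nodes reach their own leaves, so a stuck string is not a node.
      have hnew : v ++ t.take j ∉ h.S.nodeSet := by
        intro hmem
        have := hLj.tree.lbl_self _ (mem_level.2 ⟨hmem, hlen⟩)
        rw [hl] at this
        exact absurd this (by simp)
      set u := v ++ t.take j with hu
      have hedge : ∀ i, v.length < i → EdgeOK f i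
          (Function.update h.T (v.length + j) ((h.T (v.length + j)).grow f u) i)
          ⟨v, t.take j, u⟩ := by
        intro i hi
        rcases lt_trichotomy i (v.length + j) with h1 | rfl | h1
        · refine ⟨fun h2 => by simp only [hjt] at h2; omega, fun _ _ => ?_⟩
          rw [Function.update_of_ne (by omega)]
          simp only
          rw [List.take_take, min_eq_left (by omega)]
          have := hμ (i - v.length) (by omega) (by omega)
          rwa [Nat.add_sub_cancel' hi.le] at this
        · refine ⟨fun _ => ?_, fun _ h2 => by simp only [hjt] at h2; omega⟩
          rw [Function.update_self]
          exact CTree.lbl_grow_self hl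
        · exact EdgeOK.of_gt _ (by simp only [hjt]; omega)
      have hlev : ∀ S' : OMTBDDAS L, S'.nodeSet = insert u h.S.nodeSet →
          (∀ E ∈ S'.edges, E = ⟨v, t.take j, u⟩ ∨ E ∈ h.S.edges) →
          ∀ i, v.length < i → i ≤ m → LevelOK f m S' i
            (Function.update h.T (v.length + j) ((h.T (v.length + j)).grow f u) i) := by
        intro S' hS' hE' i hi him
        by_cases hij : i = v.length + j
        · subst hij
          refine ⟨?_, fun E hE => ?_⟩
          · rw [← hlen, level_of_nodeSet_insert hS', hlen, Function.update_self]
            exact hLj.tree.grow hl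
          · rcases hE' E hE with rfl | hE
            · exact hedge _ hi
            · rw [Function.update_self]
              exact (hLj.edge E hE).grow _
        · rw [Function.update_of_ne hij]
          refine (hL i hi him).mono (level_of_nodeSet_insert_ne hS' (by omega)) fun E hE => ?_
          rcases hE' E hE with rfl | hE
          · exact Or.inr (by simpa only [Function.update_of_ne hij] using hedge i hi)
          · exact Or.inl hE
      have htop : ∀ i, (h.T i).IsTop f → (Function.update h.T (v.length + j)
          ((h.T (v.length + j)).grow f u) i).IsTop f := by
        intro i hi
        by_cases hij : i = v.length + j
        · subst hij
          rw [Function.update_self]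
          exact hi.grow u
        · rwa [Function.update_of_ne hij]
      by_cases hjm : j = m - v.length
      · -- a new sink
        have hvj : v.length + j = m := by omega
        have hval : (h.T (v.length + j)).stuckVal f u = f u := by
          rw [hvj]; exact hT.stuckVal_eq u
        rw [hval] at hcl
        have hVs : ((h.S.addSink u (f u)).addEdge ⟨v, t.take j, u⟩).IsValid f m := by
          refine (hV.addSink (by omega)).addEdge hv ?_ (by simp only [hjt]; omega) hne hno
          rw [nodeSet_addSink]
          exact Finset.mem_insert_self _ _
        have hns : ((h.S.addSink u (f u)).addEdge ⟨v, t.take j, u⟩).nodeSet =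
            insert u h.S.nodeSet := nodeSet_addSink h.S u (f u)
        refine ⟨(h.setTree (v.length + j) ((h.T (v.length + j)).grow f u)).mapS
          fun S => (S.addSink u (f u)).addEdge ⟨v, t.take j, u⟩, (h.T (v.length + j)).cost f u + 0, ?_, ?_, ?_⟩
        · unfold addEdgeFrom
          refine hcl.bind ?_
          simp only
          rw [if_pos hjm]
          exact Yields.pure _
        · refine ⟨hVs, hlev _ hns fun E hE => List.mem_cons.1 hE, htop m hT, ⟨⟨[⟨v, t.take j, u⟩],
            rfl, ?_⟩, fun i hi => ?_, fun i hi => ?_, fun _ => id, fun p hp =>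
            List.mem_cons_of_mem _ hp⟩, ⟨_, List.mem_cons_self, rfl, hhead⟩, fun w hw => Or.inl hw⟩
          · intro E hE
            rw [List.mem_singleton] at hE
            subst hE
            exact ⟨le_rfl, fun _ => ⟨rfl, hhead⟩⟩
          · exact Function.update_of_ne (by omega) _ _
          · exact level_of_nodeSet_insert_ne hns (by omega)
        -- With E edges and N nodes before, 2(E + 1)(N + 1) exceeds 2EN by at least 2N, and all
        -- levels tried cost at most 2N.
        · have e1 : ((h.S.addSink u (f u)).addEdge ⟨v, t.take j, u⟩).weight =
              2 * (h.S.edges.length + 1) * (h.S.nodeSet.card + 1) := by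
            rw [weight, hns, Finset.card_insert_of_notMem hnew]
            rfl
          have e0 : h.S.weight = 2 * h.S.edges.length * h.S.nodeSet.card := rfl
          have e2 : ((h.setTree (v.length + j) ((h.T (v.length + j)).grow f u)).mapS
            fun S => (S.addSink u (f u)).addEdge ⟨v, t.take j, u⟩).S.weight = _ := e1
          rw [e2, e0]
          nlinarith
      · -- a new internal node
        have hum : u.length < m := by omega
        have hVs : ((h.S.addInner u).addEdge ⟨v, t.take j, u⟩).IsValid f m := by
          refine (hV.addInner hum).addEdge (List.mem_cons_of_mem _ hv) ?_
            (by simp only [hjt]; omega) hne hno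
          rw [nodeSet_addInner]
          exact Finset.mem_insert_self _ _
        have hns : ((h.S.addInner u).addEdge ⟨v, t.take j, u⟩).nodeSet =
            insert u h.S.nodeSet := nodeSet_addInner h.S u
        have hui : u ∉ h.S.inner := fun h1 => hnew (mem_nodeSet.2 (Or.inl h1))
        set h1 := (h.setTree (v.length + j) ((h.T (v.length + j)).grow f u)).mapS
          fun S => (S.addInner u).addEdge ⟨v, t.take j, u⟩ with hh1
        have hL1 := hlev _ hns fun E hE => List.mem_cons.1 hE
        -- Sources of edges are inner nodes, so the fresh node has no outgoing edge yet.
        have hno1 : ∀ b, ¬ h1.S.HasOut u b := by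
          rintro b ⟨E, hE, h2, -⟩
          rcases List.mem_cons.1 hE with rfl | hE
          · have : v.length = u.length := congrArg List.length h2
            omega
          · exact hui (h2 ▸ hV.src_mem E hE)
        have hg1 : Grows v.length (fun u c => u = v ∧ c = some b) h h1 := by
          refine ⟨⟨[⟨v, t.take j, u⟩], rfl, ?_⟩, fun i hi => ?_, fun i hi => ?_, fun w hw =>
            List.mem_cons_of_mem _ hw, fun p hp => hp⟩
          · intro E hE
            rw [List.mem_singleton] at hE
            subst hE
            exact ⟨le_rfl, fun _ => ⟨rfl, hhead⟩⟩
          · exact Function.update_of_ne (by omega) _ _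
          · exact level_of_nodeSet_insert_ne hns (by omega)
        have htne : t ≠ [] := by rintro rfl; simp at hb
        obtain ⟨b', hb', hbb⟩ : ∃ b', (flip t).head? = some b' ∧ b' ≠ b := by
          obtain ⟨b', hb'⟩ := Option.isSome_iff_exists.1
            (List.isSome_head?.2 (flip_ne_nil htne))
          exact ⟨b', hb', fun h0 => head?_flip_ne htne (by rw [hb', hb, h0])⟩
        obtain ⟨h2, c2, hy2, hp2, hw2⟩ := ih (v := u) (t := t) (b := b) (j := 1) (h := h1) hVs
          (fun i hi him => hL1 i (by omega) him) (htop m hT) List.mem_cons_self (by omega)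
          (by omega) le_rfl hb (hno1 b) (fun i _ _ => by omega)
        obtain ⟨h3, c3, hy3, hp3, hw3⟩ := ih (v := u) (t := flip t) (b := b') (j := 1) (h := h2)
          hp2.valid hp2.levels hp2.top (hp2.grows.inner_sub List.mem_cons_self)
          (by rw [length_flip]; omega) (by omega) le_rfl hb'
          (fun ho2 => by
            rcases hp2.grows.of_hasOut List.mem_cons_self ho2 with h4 | h4
            · exact hno1 _ h4
            · exact hbb (Option.some_injective _ h4.2))
          (fun i _ _ => by omega)
        refine ⟨h3, (h.T (v.length + j)).cost f u + (c2 + c3), ?_, ?_, ?_⟩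
        · unfold addEdgeFrom
          refine hcl.bind ?_
          simp only
          rw [if_neg hjm]
          exact hy2.bind hy3
        -- Both recursive calls touch old nodes only at `u`. As `u` is itself new, the edge out of
        -- `v` remains the only one added at a node of `h`.
        · have hg13 : Grows u.length (fun w _ => w = u) h1 h3 :=
            Grows.trans (P' := fun w c => w = u ∧ c = some b')
              ⟨by
                obtain ⟨n, e, hn⟩ := hp2.grows.edges
                exact ⟨n, e, fun E hE => ⟨(hn E hE).1, fun h4 => ((hn E hE).2 h4).1⟩⟩,
                hp2.grows.tree_eq, hp2.grows.level_eq, hp2.grows.inner_sub,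
                hp2.grows.sinks_sub⟩ hp3.grows le_rfl fun w _ _ h4 => h4.1
          refine ⟨hp3.valid, fun i hi him => ?_, hp3.top,
            hg1.trans hg13 (by omega) fun w hw _ h4 => absurd (h4 ▸ hw) hui,
            hg13.hasOut ⟨_, List.mem_cons_self, rfl, hhead⟩, fun w hw => ?_⟩
          · by_cases hiu : i ≤ u.length
            · exact hg13.levelOK hp3.valid hiu (hL1 i hi him)
            · exact hp3.levels i (by omega) him
          · rcases hp3.full_new w hw with hw | hw
            · rcases hp2.full_new w hw with hw | hw
              · rcases List.mem_cons.1 hw with rfl | hw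
                · refine Or.inr fun d => ?_
                  by_cases hd : d = b
                  · exact hd ▸ hp3.grows.hasOut hp2.out
                  · have : d = b' := bool_eq_of_ne hbb hd
                    exact this ▸ hp3.out
                · exact Or.inl hw
              · exact Or.inr fun d => hp3.grows.hasOut (hw d)
            · exact Or.inr hw
        · have : h1.S.weight = 2 * (h.S.edges.length + 1) * (h.S.nodeSet.card + 1) := by
            simp only [weight]
            rw [show h1.S.nodeSet = _ from hns, Finset.card_insert_of_notMem hnew]
            rfl
          have e0 : h.S.weight = 2 * h.S.edges.length * h.S.nodeSet.card := rfl
          nlinarith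
    · -- the classification is `μ`
      rw [CTree.result_of_lbl hl] at hcl
      obtain ⟨h', c, hy, hp, hw⟩ := ih (v := v) (t := t) (b := b) (j := j + 1) (h := h) hV hL hT hv
        ht (by omega) (by omega) hb ho (fun i h1 h2 => by
          by_cases hij : i = j
          · exact hij ▸ hl
          · exact hμ i h1 (by omega))
      refine ⟨h', (h.T (v.length + j)).cost f (v ++ t.take j) + c, ?_, hp, ?_⟩
      · unfold addEdgeFrom
        exact hcl.bind hy
      · omega
    · -- an existing node
      rw [CTree.result_of_lbl hl] at hcl
      have hmem := mem_level.1 (hLj.tree.mem_of_lbl _ u hlen hl)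
      have hVs : (h.S.addEdge ⟨v, t.take j, u⟩).IsValid f m :=
        hV.addEdge hv hmem.1 (by simp only [hjt]; omega) hne hno
      refine ⟨h.mapS fun S => S.addEdge ⟨v, t.take j, u⟩,
        (h.T (v.length + j)).cost f (v ++ t.take j) + 0, ?_, ?_, ?_⟩
      · unfold addEdgeFrom
        exact hcl.bind (Yields.pure _)
      · refine ⟨hVs, fun i hi him => (hL i hi him).mono rfl fun E hE => ?_, hT,
          ⟨⟨[⟨v, t.take j, u⟩], rfl, ?_⟩, fun i hi => rfl, fun i hi => rfl, fun _ => id,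
            fun _ => id⟩, ⟨_, List.mem_cons_self, rfl, hhead⟩, fun w hw => Or.inl hw⟩
        · rcases List.mem_cons.1 hE with rfl | hE
          · refine Or.inr ?_
            rcases lt_trichotomy i (v.length + j) with h1 | rfl | h1
            · refine ⟨fun h2 => by simp only [hjt] at h2; omega, fun _ _ => ?_⟩
              simp only
              rw [List.take_take, min_eq_left (by omega)]
              have := hμ (i - v.length) (by omega) (by omega)
              rwa [Nat.add_sub_cancel' hi.le] at this
            · exact ⟨fun _ => hl, fun _ h2 => by simp only [hjt] at h2; omega⟩
            · exact EdgeOK.of_gt _ (by simp only [hjt]; omega)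
          · exact Or.inl hE
        · intro E hE
          rw [List.mem_singleton] at hE
          subst hE
          exact ⟨le_rfl, fun _ => ⟨rfl, hhead⟩⟩
      · have e1 : (h.mapS fun S => S.addEdge ⟨v, t.take j, u⟩).S.weight =
            2 * (h.S.edges.length + 1) * h.S.nodeSet.card := rfl
        have e0 : h.S.weight = 2 * h.S.edges.length * h.S.nodeSet.card := rfl
        rw [e1, e0]
        nlinarith

end OMTBDD

/-! ### AddEdge in both directions and the invariant of the main loop -/

namespace OMTBDD

open OMTBDDAS

/-- The gain 2·(edges) from a new node is what pays for testing the old edges again when a node is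
split. -/
theorem weight_addInner_replaceEdge {L : Type} {S : OMTBDDAS L} {E E' : Edge} {v : Str}
    (hE : E ∈ S.edges) (hv : v ∉ S.nodeSet) :
    ((S.addInner v).replaceEdge E E').weight = S.weight + 2 * S.edges.length := by
  have h1 : ((S.addInner v).replaceEdge E E').nodeSet = insert v S.nodeSet :=
    nodeSet_addInner S v
  rw [weight, h1, Finset.card_insert_of_notMem hv, length_replaceEdge (S := S.addInner v) hE,
    weight]
  simp only [OMTBDDAS.addInner]
  ring

variable {L : Type} [DecidableEq L]

theorem addEdge_spec {f : Str → L} {m : ℕ} {v t : Str} {b : Bool} {h : Hyp L}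
    (hV : h.S.IsValid f m)
    (hL : ∀ i, v.length < i → i ≤ m → LevelOK f m h.S i (h.T i)) (hT : (h.T m).IsTop f)
    (hv : v ∈ h.S.inner) (ht : m ≤ v.length + t.length) (hb : t.head? = some b)
    (ho : ¬ h.S.HasOut v b) :
    ∃ h' c, Yields f (addEdge m v t h) h' c ∧ AddEdgePost f m v b h h' ∧
      c + h.S.weight ≤ h'.S.weight := by
  have hlt := hV.inner_lt v hv
  obtain ⟨h', c, h1, h2, h3⟩ := addEdgeFrom_spec (m - v.length) hV hL hT hv ht (by omega) le_rfl
    hb ho (fun i h1 h2 => by omega)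
  exact ⟨h', c, h1, h2, by omega⟩

/-- What two executions of AddEdge achieve for a new node `v`. -/
structure AddBothPost (f : Str → L) (m : ℕ) (v : Str) (h h' : Hyp L) : Prop where
  valid : h'.S.IsValid f m
  levels : ∀ i, v.length < i → i ≤ m → LevelOK f m h'.S i (h'.T i)
  top : (h'.T m).IsTop f
  grows : Grows v.length (fun u _ => u = v) h h'
  full : h'.S.Full v
  full_new : ∀ u ∈ h'.S.inner, u ∈ h.S.inner ∨ h'.S.Full u

/-- A string and its flip begin with different bits, so the two calls produce the two edges. Of `t`
only its sufficient length is needed. -/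
theorem addBoth_spec {f : Str → L} {m : ℕ} {v t : Str} {h : Hyp L}
    (hV : h.S.IsValid f m)
    (hL : ∀ i, v.length < i → i ≤ m → LevelOK f m h.S i (h.T i)) (hT : (h.T m).IsTop f)
    (hv : v ∈ h.S.inner) (ht : m ≤ v.length + t.length) (ho : ∀ b, ¬ h.S.HasOut v b) :
    ∃ h1 h' c1 c2, Yields f (addEdge m v t h) h1 c1 ∧ Yields f (addEdge m v (flip t) h1) h' c2 ∧
      AddBothPost f m v h h' ∧ c1 + c2 + h.S.weight ≤ h'.S.weight := by
  have hlt := hV.inner_lt v hv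
  have htne : t ≠ [] := by rintro rfl; simp at ht; omega
  obtain ⟨b, hb⟩ := Option.isSome_iff_exists.1 (List.isSome_head?.2 htne)
  obtain ⟨b', hb'⟩ := Option.isSome_iff_exists.1 (List.isSome_head?.2 (flip_ne_nil htne))
  have hbb : b' ≠ b := fun h0 => head?_flip_ne htne (by rw [hb', hb, h0])
  obtain ⟨h1, c1, y1, p1, w1⟩ := addEdge_spec hV hL hT hv ht hb (ho b)
  obtain ⟨h2, c2, y2, p2, w2⟩ := addEdge_spec p1.valid p1.levels p1.top (p1.grows.inner_sub hv)
    (by rwa [length_flip]) hb' (fun h3 => (p1.grows.of_hasOut hv h3).elim (ho b')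
      fun h4 => hbb (Option.some_injective _ h4.2))
  have hg : Grows v.length (fun u _ => u = v) h h1 :=
    ⟨by
      obtain ⟨n, e, hn⟩ := p1.grows.edges
      exact ⟨n, e, fun E hE => ⟨(hn E hE).1, fun h4 => ((hn E hE).2 h4).1⟩⟩,
      p1.grows.tree_eq, p1.grows.level_eq, p1.grows.inner_sub, p1.grows.sinks_sub⟩
  refine ⟨h1, h2, c1, c2, y1, y2, ⟨p2.valid, p2.levels, p2.top,
    hg.trans p2.grows le_rfl fun u _ _ h3 => h3.1, fun d => ?_, fun u hu => ?_⟩, by omega⟩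
  · by_cases hd : d = b
    · exact hd ▸ p2.grows.hasOut p1.out
    · exact bool_eq_of_ne hbb hd ▸ p2.out
  · rcases p2.full_new u hu with hu | hu
    · exact (p1.full_new u hu).imp_right fun hu d => p2.grows.hasOut (hu d)
    · exact Or.inr hu

/-- The invariant of the main loop. -/
structure Inv (f : Str → L) (m : ℕ) (h : Hyp L) : Prop where
  valid : h.S.IsValid f m
  levels : ∀ i, 0 < i → i ≤ m → LevelOK f m h.S i (h.T i)
  top : (h.T m).IsTop f
  full : ∀ v ∈ h.S.inner, v ≠ [] → h.S.Full v
  root_out : ∃ b, h.S.HasOut [] b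
  root_essential : h.S.Full [] → Essential f m []
  sinks_ne : h.S.sinks ≠ []

open Classical in
/-- The number of nodes without a dummy root, plus one. -/
noncomputable def OMTBDDAS.progress (S : OMTBDDAS L) : ℕ :=
  S.nodeSet.card + if S.Full [] then 1 else 0

/-! ### Splitting a node -/

/-- Both p and v reached the leaf p; the new test tells them apart. Strings at `μ` are untouched, so
essentiality is inherited, and the single query is covered by the allowance 2 of the new node. -/
theorem TreeOK.split {f : Str → L} {m d : ℕ} {ns : Finset Str} {T : CTree L}
    (h : TreeOK f m d ns T) {p v e1 : Str} {c x : L} (hp : p ∈ ns)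
    (he1 : e1.length = m - d) (hvl : v ∉ ns) (hTv : T.lbl f v = some (some p))
    (hpc : f (p ++ e1) = c) (hvx : f (v ++ e1) = x) (hxc : x ≠ c) :
    TreeOK f m d (insert v ns) (T.subst (some p)
      (.single e1 [c, x] fun l => if l = c then .leaf (some p) else .leaf (some v))) where
  lbl_self := by
    intro u hu
    rw [CTree.lbl_subst]
    rcases Finset.mem_insert.1 hu with rfl | hu
    · simp [CTree.lbl, hTv, hvx, hxc]
    · by_cases hup : u = p
      · subst hup
        simp [h.lbl_self u hu, CTree.lbl, hpc]
      · rw [h.lbl_self u hu, if_neg (by simpa using hup)]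
  mem_of_lbl := by
    intro a u ha hu
    rw [CTree.lbl_subst] at hu
    split_ifs at hu with h1
    · simp only [CTree.lbl] at hu
      split_ifs at hu with h2 h3
      · simp only [CTree.lbl, Option.some.injEq] at hu
        exact Finset.mem_insert_of_mem (hu ▸ hp)
      · simp only [CTree.lbl, Option.some.injEq] at hu
        exact hu ▸ Finset.mem_insert_self _ _
    · exact Finset.mem_insert_of_mem (h.mem_of_lbl a u ha hu)
  essential := by
    intro hd a ha hne
    refine h.essential hd a ha fun h1 => hne ?_
    rw [CTree.lbl_subst, h1, if_neg (by simp)]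
  cost_le := by
    intro a
    have h1 := h.cost_le a
    have h2 : (CTree.single e1 [c, x] fun l => if l = c then .leaf (some p)
        else .leaf (some v)).cost f a ≤ 1 := by
      simp only [CTree.cost]
      split_ifs <;> simp [CTree.cost]
    rw [CTree.cost_subst, Finset.card_insert_of_notMem hvl]
    split_ifs <;> omega
  wf := h.wf.subst fun last hl => ⟨he1, hl (by simp), fun l _ => by
    dsimp only
    split_ifs <;> exact hl (by simp)⟩

theorem TreeOK.subst_grow {f : Str → L} {m d : ℕ} {ns : Finset Str} {T Te : CTree L} {p a : Str}
    (h : TreeOK f m d ns (T.subst (some p) Te)) (hT : T.lbl f a = some (some p))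
    (hs : Te.lbl f a = none) (hwf : (T.subst (some p) (Te.grow f a)).WF (m - d) []) :
    TreeOK f m d (insert a ns) (T.subst (some p) (Te.grow f a)) where
  lbl_self := by
    intro u hu
    rw [CTree.lbl_subst]
    rcases Finset.mem_insert.1 hu with rfl | hu
    · rw [hT, if_pos rfl, CTree.lbl_grow_self hs]
    · have h1 := h.lbl_self u hu
      rw [CTree.lbl_subst] at h1
      split_ifs at h1 ⊢
      · exact CTree.lbl_grow_of_some h1
      · exact h1
  mem_of_lbl := by
    intro b u hb hu
    have h1 := h.mem_of_lbl b u hb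
    rw [CTree.lbl_subst] at hu h1
    split_ifs at hu h1
    · rcases CTree.lbl_grow f a b Te with h2 | ⟨-, h2⟩
      · exact Finset.mem_insert_of_mem (h1 (h2 ▸ hu))
      · rw [h2] at hu
        simp only [Option.some.injEq] at hu
        exact hu ▸ Finset.mem_insert_self _ _
    · exact Finset.mem_insert_of_mem (h1 hu)
  essential := by
    intro hd b hb hne
    refine h.essential hd b hb fun h1 => hne ?_
    rw [CTree.lbl_subst] at h1 ⊢
    split_ifs at h1 ⊢
    · exact CTree.lbl_grow_of_some h1
    · exact h1
  cost_le := by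
    intro b
    have h1 := h.cost_le b
    rw [CTree.cost_subst] at h1 ⊢
    rw [CTree.cost_grow]
    exact h1.trans (Nat.mul_le_mul_left 2 (Finset.card_le_card (Finset.subset_insert _ _)))
  wf := hwf

/-- The target is seen only by the level on which the edge ends, so redirecting an edge disturbs
that level alone. -/
theorem EdgeOK.retarget {f : Str → L} {i : ℕ} {T : CTree L} {E : Edge} (h : EdgeOK f i T E)
    (hi : i ≠ E.src.length + E.lab.length) (u : Str) : EdgeOK f i T ⟨E.src, E.lab, u⟩ where
  land := fun h1 => absurd h1.symm hi
  cross := h.cross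

theorem EdgeOK.of_land {f : Str → L} {i : ℕ} {T : CTree L} {E : Edge}
    (hi : i = E.src.length + E.lab.length) (h : T.lbl f (E.src ++ E.lab) = some (some E.tgt)) :
    EdgeOK f i T E where
  land := fun _ => h
  cross := fun _ h1 => by omega

/-- The invariant of the loop of NodeSplit: `p` is the node to be split, `d` its length, `T` the
tree of which the leaf `p` is to be replaced by `Te`, and `Fs` are the remaining edges. -/
structure SplitInv (f : Str → L) (m d : ℕ) (p : Str) (T Te : CTree L) (Fs : List Edge)
    (h : Hyp L) : Prop where
  valid : h.S.IsValid f m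
  levels : ∀ i, 0 < i → i ≤ m → i ≠ d → LevelOK f m h.S i (h.T i)
  top : (h.T m).IsTop f
  tree_eq : h.T d = T
  full : ∀ v ∈ h.S.inner, v ≠ [] → h.S.Full v
  tree : TreeOK f m d (h.S.level d) (T.subst (some p) Te)
  edges : ∀ E ∈ h.S.edges, EdgeOK f d (T.subst (some p) Te) E ∨ E ∈ Fs
  pending : ∀ F ∈ Fs, F ∈ h.S.edges ∧ F.tgt = p ∧ EdgeOK f d T F
  nodup : Fs.Nodup
  wf : T.WF (m - d) []
  te_cost : ∀ a : Str, Te.cost f a ≤ 1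
  te_ne : ∀ a : Str, Te.lbl f a ≠ some none
  te_wf : ∀ last : Str, last.length = m - d → Te.WF (m - d) last

/-- This is the step that redirects F to a leaf already present in `Te`; afterwards F agrees with
the substituted tree and is no longer pending. -/
theorem SplitInv.weaken {f : Str → L} {m d : ℕ} {p : Str} {T Te : CTree L} {F : Edge}
    {Fs : List Edge} {h : Hyp L} {u : Str} (hI : SplitInv f m d p T Te (F :: Fs) h)
    (hpd : p.length = d) (hu : Te.lbl f (F.src ++ F.lab) = some (some u)) :
    SplitInv f m d p T Te Fs (h.mapS fun S => S.replaceEdge F ⟨F.src, F.lab, u⟩) := by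
  obtain ⟨hF, hFp, hFT⟩ := hI.pending F List.mem_cons_self
  have hlen := hI.valid.length_eq F hF
  rw [hFp, hpd] at hlen
  have hlbl : (T.subst (some p) Te).lbl f (F.src ++ F.lab) = some (some u) := by
    rw [CTree.lbl_subst, hFT.land hlen, hFp, if_pos rfl, hu]
  have hud := mem_level.1 (hI.tree.mem_of_lbl _ u (by rw [List.length_append, hlen]) hlbl)
  have hnd := List.nodup_cons.1 hI.nodup
  refine ⟨hI.valid.replaceEdge hF rfl hud.1 (by rw [hud.2]; exact hlen) (hI.valid.lab_ne F hF) rfl,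
    fun i hi him hid => (hI.levels i hi him hid).mono rfl fun E hE => ?_, hI.top, hI.tree_eq,
    fun v hv hne b => (hI.valid.hasOut_replaceEdge (E' := ⟨F.src, F.lab, u⟩) hF rfl rfl v b).2
      (hI.full v hv hne b),
    hI.tree, fun E hE => ?_, fun G hG => ?_, hnd.2, hI.wf, hI.te_cost, hI.te_ne, hI.te_wf⟩
  · rcases hI.valid.mem_replaceEdge.1 hE with rfl | ⟨-, hE⟩
    · exact Or.inr (((hI.levels i hi him hid).edge F hF).retarget (by omega) u)
    · exact Or.inl hE
  · rcases hI.valid.mem_replaceEdge.1 hE with rfl | ⟨hEF, hE⟩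
    · exact Or.inl (EdgeOK.of_land hlen.symm hlbl)
    · exact (hI.edges E hE).imp_right fun h1 => (List.mem_cons.1 h1).resolve_left hEF
  · obtain ⟨h1, h2⟩ := hI.pending G (List.mem_cons_of_mem _ hG)
    refine ⟨hI.valid.mem_replaceEdge.2 (Or.inr ⟨?_, h1⟩), h2⟩
    rintro rfl
    exact hnd.1 hG

/-- This is the step for a stuck edge: its end has a value not seen before under the new test, so it
is a further node split off from p. Pending edges survive because AddEdge and the redirection of F
leave them in place. -/
theorem SplitInv.grow {f : Str → L} {m d : ℕ} {p t : Str} {T Te : CTree L} {F : Edge}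
    {Fs : List Edge} {h : Hyp L} (hI : SplitInv f m d p T Te (F :: Fs) h)
    (hpd : p.length = d) (hd : 0 < d) (hdm : d < m) (ht : t.length = m - d)
    (hs : Te.lbl f (F.src ++ F.lab) = none) :
    ∃ h1 h2 c1 c2,
      Yields f (addEdge m (F.src ++ F.lab) t (h.mapS fun S =>
        (S.addInner (F.src ++ F.lab)).replaceEdge F ⟨F.src, F.lab, F.src ++ F.lab⟩)) h1 c1 ∧
      Yields f (addEdge m (F.src ++ F.lab) (flip t) h1) h2 c2 ∧
      SplitInv f m d p T (Te.grow f (F.src ++ F.lab)) Fs h2 ∧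
      h.S.nodeSet ⊆ h2.S.nodeSet ∧ h.S.sinks ⊆ h2.S.sinks ∧
      (∀ b, h2.S.HasOut [] b ↔ h.S.HasOut [] b) ∧
      c1 + c2 + h.S.weight ≤ h2.S.weight := by
  obtain ⟨hF, hFp, hFT⟩ := hI.pending F List.mem_cons_self
  have hlen := hI.valid.length_eq F hF
  rw [hFp, hpd] at hlen
  set v := F.src ++ F.lab with hv
  have hvd : v.length = d := by rw [hv, List.length_append, hlen]
  have hTv : T.lbl f v = some (some p) := by rw [hFT.land hlen, hFp]
  have hlbl : (T.subst (some p) Te).lbl f v = none := by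
    rw [CTree.lbl_subst, hTv, if_pos rfl, hs]
  have hvn : v ∉ h.S.nodeSet := by
    intro h1
    have := hI.tree.lbl_self v (mem_level.2 ⟨h1, hvd⟩)
    rw [hlbl] at this
    exact absurd this (by simp)
  have hnd := List.nodup_cons.1 hI.nodup
  have hVi := hI.valid.addInner (v := v) (by omega)
  have hFi : F ∈ (h.S.addInner v).edges := hF
  set h0 := h.mapS fun S => (S.addInner v).replaceEdge F ⟨F.src, F.lab, v⟩ with hh0
  have hn0 : h0.S.nodeSet = insert v h.S.nodeSet := nodeSet_addInner h.S v
  have hV0 : h0.S.IsValid f m := by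
    refine hVi.replaceEdge hFi rfl ?_ (by rw [hvd]; exact hlen) (hI.valid.lab_ne F hF) rfl
    rw [nodeSet_addInner]
    exact Finset.mem_insert_self _ _
  have hout0 : ∀ u b, h0.S.HasOut u b ↔ h.S.HasOut u b :=
    fun u b => hVi.hasOut_replaceEdge (E' := ⟨F.src, F.lab, v⟩) hFi rfl rfl u b
  have hL0 : ∀ i, 0 < i → i ≤ m → i ≠ d → LevelOK f m h0.S i (h0.T i) := by
    intro i hi him hid
    refine (hI.levels i hi him hid).mono
      (level_of_nodeSet_insert_ne hn0 (by omega)) fun E hE => ?_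
    rcases hVi.mem_replaceEdge.1 hE with rfl | ⟨-, hE⟩
    · exact Or.inr (((hI.levels i hi him hid).edge F hF).retarget (by omega) v)
    · exact Or.inl hE
  have hvi : v ∉ h.S.inner := fun h1 => hvn (mem_nodeSet.2 (Or.inl h1))
  obtain ⟨h1, h2, c1, c2, y1, y2, post, w⟩ := addBoth_spec (v := v) (t := t) hV0
    (fun i hi him => hL0 i (by omega) him (by omega)) hI.top List.mem_cons_self (by omega)
    (fun b hb => by
      obtain ⟨E, hE, h1, -⟩ := (hout0 v b).1 hb
      exact hvi (h1 ▸ hI.valid.src_mem E hE))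
  have hvne : v ≠ [] := by
    intro h0
    rw [h0] at hvd
    simp at hvd
    omega
  have hg := post.grows
  rw [hvd] at hg
  have hlev : h2.S.level d = insert v (h.S.level d) := by
    rw [hg.level_eq d le_rfl, ← hvd]
    exact level_of_nodeSet_insert hn0
  have hwf : ∀ last : Str, last.length = m - d → (Te.grow f v).WF (m - d) last :=
    fun last hl => (hI.te_wf last hl).grow f v
  -- Edges settled earlier stay settled, as growing `Te` only affects stuck strings.
  have hkeep : ∀ a x, (T.subst (some p) Te).lbl f a = some x →
      (T.subst (some p) (Te.grow f v)).lbl f a = some x := by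
    intro a x hx
    rw [CTree.lbl_subst] at hx ⊢
    split_ifs at hx ⊢
    · exact CTree.lbl_grow_of_some hx
    · exact hx
  refine ⟨h1, h2, c1, c2, y1, y2, ⟨post.valid, fun i hi him hid => ?_, post.top, ?_,
    fun u hu hne => ?_, ?_, fun E hE => ?_, fun G hG => ?_, hnd.2, hI.wf, fun a => ?_, fun a ha => ?_,
    hwf⟩, ?_, hg.sinks_sub, fun b => ?_, ?_⟩
  · by_cases hid' : i ≤ d
    · exact hg.levelOK post.valid hid' (hL0 i hi him hid)
    · exact post.levels i (by omega) him
  · rw [hg.tree_eq d le_rfl]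
    exact hI.tree_eq
  · rcases post.full_new u hu with hu | hu
    · rcases List.mem_cons.1 hu with rfl | hu
      · exact post.full
      · exact fun b => hg.hasOut ((hout0 u b).2 (hI.full u hu hne b))
    · exact hu
  · rw [hlev]
    exact hI.tree.subst_grow hTv hs (hI.wf.subst fun last hl => hwf last (hl (by simp)))
  · obtain ⟨n, e, hn⟩ := hg.edges
    have hE' := hE
    rw [e] at hE
    rcases List.mem_append.1 hE with hE | hE
    · exact Or.inl (EdgeOK.of_le _ (hn E hE).1 (post.valid.lab_ne E hE'))
    · rcases hVi.mem_replaceEdge.1 hE with rfl | ⟨hEF, hE⟩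
      · refine Or.inl (EdgeOK.of_land hlen.symm ?_)
        rw [← hv, CTree.lbl_subst, hTv, if_pos rfl]
        exact CTree.lbl_grow_self hs
      · rcases hI.edges E hE with h3 | h3
        · exact Or.inl ⟨fun h4 => hkeep _ _ (h3.land h4), fun h4 h5 => hkeep _ _ (h3.cross h4 h5)⟩
        · exact Or.inr ((List.mem_cons.1 h3).resolve_left hEF)
  · obtain ⟨h3, h4⟩ := hI.pending G (List.mem_cons_of_mem _ hG)
    refine ⟨hg.mem_edges (hVi.mem_replaceEdge.2 (Or.inr ⟨?_, h3⟩)), h4⟩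
    rintro rfl
    exact hnd.1 hG
  · rw [CTree.cost_grow]
    exact hI.te_cost a
  · rcases CTree.lbl_grow f v a Te with h3 | ⟨-, h3⟩
    · exact hI.te_ne a (h3 ▸ ha)
    · rw [h3] at ha
      exact absurd ha (by simp)
  · exact ((Finset.subset_insert v _).trans hn0.ge).trans hg.node_sub
  · constructor
    · intro h3
      rcases hg.of_hasOut (List.mem_cons_of_mem _ hI.valid.root_mem) h3 with h4 | h4
      · exact (hout0 _ _).1 h4
      · exact absurd h4.symm hvne
    · exact fun h3 => hg.hasOut ((hout0 _ _).2 h3)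
  · have : h0.S.weight = h.S.weight + 2 * h.S.edges.length :=
      weight_addInner_replaceEdge hF hvn
    omega

end OMTBDD

namespace OMTBDD

open OMTBDDAS

/-- A new node counts only if the root does not fall back to being a dummy; hence the condition on
the edges of the root. -/
theorem OMTBDDAS.progress_lt {L : Type} {S S' : OMTBDDAS L} {v : Str} (hv : v ∈ S'.nodeSet)
    (hv' : v ∉ S.nodeSet) (hsub : S.nodeSet ⊆ S'.nodeSet)
    (ho : ∀ b, S.HasOut [] b → S'.HasOut [] b) : S.progress < S'.progress := by
  have h1 : S.nodeSet.card < S'.nodeSet.card :=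
    Finset.card_lt_card (Finset.ssubset_iff_subset_ne.2 ⟨hsub, fun h => hv' (h ▸ hv)⟩)
  have h2 : S.Full [] → S'.Full [] := fun h b => ho b (h b)
  unfold OMTBDDAS.progress
  split_ifs with h3 h4
  · omega
  · exact absurd (h2 h3) h4
  · omega
  · omega

variable {L : Type} [DecidableEq L]

/-- `Te` is one single-test node, so each pending edge costs one query beyond what AddEdge covers by
the potential. -/
theorem splitLoop_spec {f : Str → L} {m d : ℕ} {p t : Str} {T : CTree L} (hpd : p.length = d)
    (hd : 0 < d) (hdm : d < m) (ht : t.length = m - d) (Fs : List Edge) :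
    ∀ {h : Hyp L} {Te : CTree L}, SplitInv f m d p T Te Fs h →
      ∃ h' Te' c, Yields f (splitLoop m t Fs h Te) (h', Te') c ∧ SplitInv f m d p T Te' [] h' ∧
        h.S.nodeSet ⊆ h'.S.nodeSet ∧ h.S.sinks ⊆ h'.S.sinks ∧
        (∀ b, h'.S.HasOut [] b ↔ h.S.HasOut [] b) ∧ c + h.S.weight ≤ h'.S.weight + Fs.length := by
  induction Fs with
  | nil =>
    intro h Te hI
    exact ⟨h, Te, 0, Yields.pure _, hI, fun _ => id, fun _ => id, fun _ => Iff.rfl, by simp⟩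
  | cons F Fs ih =>
    intro h Te hI
    have hcl := CTree.yields_classify f (F.src ++ F.lab) Te
    have hcost := hI.te_cost (F.src ++ F.lab)
    rcases hl : Te.lbl f (F.src ++ F.lab) with _ | _ | u
    · rw [CTree.result_of_stuck hl] at hcl
      obtain ⟨h1, h2, c1, c2, y1, y2, hI2, hn, hsk, ho, hw⟩ := hI.grow hpd hd hdm ht hl
      obtain ⟨h3, Te3, c3, y3, hI3, hn3, hs3, ho3, hw3⟩ := ih hI2
      refine ⟨h3, Te3, Te.cost f (F.src ++ F.lab) + (c1 + (c2 + c3)), ?_, hI3, hn.trans hn3,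
        fun _ hx => hs3 (hsk hx), fun b => (ho3 b).trans (ho b), ?_⟩
      · unfold splitLoop
        exact hcl.bind (y1.bind (y2.bind y3))
      · rw [List.length_cons]
        omega
    · exact absurd hl (hI.te_ne _)
    · rw [CTree.result_of_lbl hl] at hcl
      have hF := (hI.pending F List.mem_cons_self).1
      obtain ⟨h3, Te3, c3, y3, hI3, hn3, hs3, ho3, hw3⟩ := ih (hI.weaken hpd hl)
      refine ⟨h3, Te3, Te.cost f (F.src ++ F.lab) + c3, ?_, hI3, hn3, hs3, fun b => (ho3 b).trans
        (hI.valid.hasOut_replaceEdge (E' := ⟨F.src, F.lab, u⟩) hF rfl rfl [] b), ?_⟩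
      · unfold splitLoop
        exact hcl.bind y3
      · have e1 : (h.mapS fun S => S.replaceEdge F ⟨F.src, F.lab, u⟩).S.weight = h.S.weight := by
          have := length_replaceEdge (E' := ⟨F.src, F.lab, u⟩) hF
          simp only [weight, Hyp.mapS, this]
          rfl
        rw [e1] at hw3
        rw [List.length_cons]
        omega

/-- The edge end and its target share a leaf but disagree after the suffix of e, so the edge end is
a genuinely new node. -/
theorem nodeSplit_spec {f : Str → L} {m : ℕ} {h : Hyp L} {e : Str} {E : Edge} {c x : L}
    (hI : Inv f m h) (he : e.length = m) (hE : E ∈ h.S.edges)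
    (hc : f (E.tgt ++ e.drop E.tgt.length) = c)
    (hx : f (E.src ++ E.lab ++ e.drop E.tgt.length) = x) (hxc : x ≠ c) :
    ∃ h' q, Yields f (nodeSplit m h e E c x) h' q ∧ Inv f m h' ∧
      h.S.progress < h'.S.progress ∧ q + h.S.weight ≤ h'.S.weight := by
  have hlen := hI.valid.length_eq E hE
  have hlab := List.length_pos_iff.2 (hI.valid.lab_ne E hE)
  have htm := hI.valid.length_le (hI.valid.tgt_mem E hE)
  set p := E.tgt with hp
  set d := p.length with hd
  set v := E.src ++ E.lab with hv
  have hvd : v.length = d := by rw [hv, List.length_append, hlen]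
  have hd0 : 0 < d := by omega
  have hLd := hI.levels d hd0 htm
  have hTv : (h.T d).lbl f v = some (some p) := (hLd.edge E hE).land hlen
  -- A sink is never split: on level m the leaf is determined by the value, and the two values
  -- differ.
  have hdm : d < m := by
    refine lt_of_le_of_ne htm fun h0 => hxc ?_
    rw [h0] at hTv
    obtain ⟨u, hu, hfu⟩ := hI.top.eq_of_lbl hTv
    rw [← hx, ← hc, List.drop_of_length_le (by omega), List.append_nil, List.append_nil,
      ← hfu, Option.some.inj hu]
  have hvp : v ≠ p := by
    intro h0
    rw [h0, hc] at hx
    exact hxc hx.symm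
  have hvn : v ∉ h.S.nodeSet := by
    intro h1
    have := hLd.tree.lbl_self v (mem_level.2 ⟨h1, hvd⟩)
    rw [hTv] at this
    exact hvp (Option.some.inj (Option.some.inj this)).symm
  have hvi : v ∉ h.S.inner := fun h1 => hvn (mem_nodeSet.2 (Or.inl h1))
  have hvne : v ≠ [] := by
    intro h0
    rw [h0] at hvd
    simp at hvd
    omega
  -- A labelled leaf that some string reaches is found by `lastTwin`, so the default `[]` in the
  -- algorithm is not used, and well-formedness gives the length of t.
  obtain ⟨t, ht⟩ := Option.isSome_iff_exists.1 (CTree.isSome_lastTwin [] hTv)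
  have htl : t.length = m - d := hLd.tree.wf.length_lastTwin ht
  set e1 := e.drop d with he1
  have he1l : e1.length = m - d := by rw [he1, List.length_drop, he]
  set Te : CTree L := .single e1 [c, x] fun l => if l = c then .leaf (some p)
    else .leaf (some v) with hTe
  have hVi := hI.valid.addInner (v := v) (by omega)
  have hEi : E ∈ (h.S.addInner v).edges := hE
  set h0 := h.mapS fun S => (S.addInner v).replaceEdge E ⟨E.src, E.lab, v⟩ with hh0
  have hn0 : h0.S.nodeSet = insert v h.S.nodeSet := nodeSet_addInner h.S v
  have hV0 : h0.S.IsValid f m := by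
    refine hVi.replaceEdge hEi rfl ?_ (by rw [hvd]; exact hlen) (hI.valid.lab_ne E hE) rfl
    rw [nodeSet_addInner]
    exact Finset.mem_insert_self _ _
  have hout0 : ∀ u b, h0.S.HasOut u b ↔ h.S.HasOut u b :=
    fun u b => hVi.hasOut_replaceEdge (E' := ⟨E.src, E.lab, v⟩) hEi rfl rfl u b
  have hL0 : ∀ i, 0 < i → i ≤ m → i ≠ d → LevelOK f m h0.S i (h0.T i) := by
    intro i hi him hid
    refine (hI.levels i hi him).mono
      (level_of_nodeSet_insert_ne hn0 (by omega)) fun F hF => ?_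
    rcases hVi.mem_replaceEdge.1 hF with rfl | ⟨-, hF⟩
    · exact Or.inr (((hI.levels i hi him).edge E hE).retarget (by omega) v)
    · exact Or.inl hF
  obtain ⟨h1, h2, c1, c2, y1, y2, post, w⟩ := addBoth_spec (v := v) (t := t) hV0
    (fun i hi him => hL0 i (by omega) him (by omega)) hI.top List.mem_cons_self (by omega)
    (fun b hb => by
      obtain ⟨F, hF, h1, -⟩ := (hout0 v b).1 hb
      exact hvi (h1 ▸ hI.valid.src_mem F hF))
  have hg := post.grows
  rw [hvd] at hg
  have hlev : h2.S.level d = insert v (h.S.level d) := by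
    rw [hg.level_eq d le_rfl, ← hvd]
    exact level_of_nodeSet_insert hn0
  set Fs := h2.S.edges.filter fun F => F.tgt = p with hFs
  have hout2 : ∀ b, h2.S.HasOut [] b ↔ h.S.HasOut [] b := by
    intro b
    constructor
    · intro h3
      rcases hg.of_hasOut (List.mem_cons_of_mem _ hI.valid.root_mem) h3 with h4 | h4
      · exact (hout0 _ _).1 h4
      · exact absurd h4.symm hvne
    · exact fun h3 => hg.hasOut ((hout0 _ _).2 h3)
  have hmem2 : ∀ F ∈ h2.S.edges, d ≤ F.src.length ∨ F = ⟨E.src, E.lab, v⟩ ∨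
      (F ≠ E ∧ F ∈ h.S.edges) := by
    intro F hF
    obtain ⟨n, en, hn⟩ := hg.edges
    rw [en] at hF
    rcases List.mem_append.1 hF with hF | hF
    · exact Or.inl (hn F hF).1
    · exact Or.inr (hVi.mem_replaceEdge.1 hF)
  -- Edges added by AddEdge start on level d or later and cannot end in p, so only old edges are
  -- tested again.
  have hFsl : Fs.length ≤ h.S.edges.length := by
    obtain ⟨n, en, hn⟩ := hg.edges
    have : n.filter (fun F => F.tgt = p) = [] := by
      rw [List.filter_eq_nil_iff]
      intro F hF h3
      have h4 : F ∈ h2.S.edges := by rw [en]; exact List.mem_append_left _ hF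
      have h5 := post.valid.length_eq F h4
      have h6 := List.length_pos_iff.2 (post.valid.lab_ne F h4)
      have h7 := (hn F hF).1
      have h8 : F.tgt.length = d := by rw [of_decide_eq_true h3]
      omega
    rw [hFs, en, List.filter_append, this, List.nil_append]
    refine (List.length_filter_le _ _).trans (le_of_eq ?_)
    exact length_replaceEdge hEi
  have hSI : SplitInv f m d p (h.T d) Te Fs h2 := by
    refine ⟨post.valid, fun i hi him hid => ?_, post.top, hg.tree_eq d le_rfl, fun u hu hne => ?_,
      ?_, fun F hF => ?_, fun F hF => ?_, post.valid.nodup.filter _, hLd.tree.wf, fun a => ?_,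
      fun a => ?_, fun last hl => ⟨he1l, hl, fun l _ => ?_⟩⟩
    · by_cases hid' : i ≤ d
      · exact hg.levelOK post.valid hid' (hL0 i hi him hid)
      · exact post.levels i (by omega) him
    · rcases post.full_new u hu with hu | hu
      · rcases List.mem_cons.1 hu with rfl | hu
        · exact post.full
        · exact fun b => hg.hasOut ((hout0 u b).2 (hI.full u hu hne b))
      · exact hu
    · rw [hlev]
      exact hLd.tree.split (mem_level.2 ⟨hI.valid.tgt_mem E hE, rfl⟩) he1l
        (fun h3 => hvn (mem_level.1 h3).1) hTv hc hx hxc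
    · rcases hmem2 F hF with h3 | rfl | ⟨hFE, h3⟩
      · exact Or.inl (EdgeOK.of_le _ h3 (post.valid.lab_ne F hF))
      · refine Or.inl (EdgeOK.of_land hlen.symm ?_)
        rw [← hv, CTree.lbl_subst, hTv, if_pos rfl]
        simp [hTe, CTree.lbl, hx, hxc]
      · by_cases hFp : F.tgt = p
        · exact Or.inr (List.mem_filter.2 ⟨hF, decide_eq_true hFp⟩)
        · have h4 := hLd.edge F h3
          refine Or.inl ⟨fun h5 => ?_, fun h5 h6 => ?_⟩
          · rw [CTree.lbl_subst, h4.land h5, if_neg (by simpa using hFp)]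
          · rw [CTree.lbl_subst, h4.cross h5 h6, if_neg (by simp)]
    · obtain ⟨hF, hFp⟩ := List.mem_filter.1 hF
      have hFp : F.tgt = p := of_decide_eq_true hFp
      refine ⟨hF, hFp, ?_⟩
      rcases hmem2 F hF with h3 | rfl | ⟨hFE, h3⟩
      · exact EdgeOK.of_le _ h3 (post.valid.lab_ne F hF)
      · exact absurd hFp hvp
      · exact hLd.edge F h3
    · simp only [hTe, CTree.cost]
      split_ifs <;> simp [CTree.cost]
    · simp only [hTe, CTree.lbl]
      split_ifs <;> simp [CTree.lbl]
    · dsimp only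
      split_ifs <;> exact hl
  obtain ⟨h3, Te3, c3, y3, hI3, hn3, hs3, ho3, hw3⟩ :=
    splitLoop_spec (t := t) rfl hd0 hdm htl Fs hSI
  have hw0 : h0.S.weight = h.S.weight + 2 * h.S.edges.length :=
    weight_addInner_replaceEdge hE hvn
  refine ⟨h3.setTree v.length ((h3.T v.length).subst (some p) Te3), c1 + (c2 + (c3 + 0)), ?_,
    ⟨hI3.valid, fun i hi him => ?_, ?_, hI3.full, ?_, fun h4 => ?_, ?_⟩, ?_, ?_⟩
  · unfold nodeSplit
    have ht' : t = ((h0.T v.length).lastTwin p []).getD [] := by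
      rw [hvd]
      exact (congrArg (Option.getD · []) ht).symm
    rw [ht'] at y1 y2 y3
    exact y1.bind (y2.bind (y3.bind (Yields.pure _)))
  · rw [hvd]
    by_cases hid : i = d
    · subst hid
      simp only [Hyp.setTree, Function.update_self]
      rw [hI3.tree_eq]
      refine ⟨hI3.tree, fun F hF => (hI3.edges F hF).resolve_right (by simp)⟩
    · simp only [Hyp.setTree, Function.update_of_ne hid]
      exact hI3.levels i hi him hid
  · simp only [Hyp.setTree, hvd, Function.update_of_ne hdm.ne']
    exact hI3.top
  · obtain ⟨b, hb⟩ := hI.root_out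
    exact ⟨b, (ho3 b).2 ((hout2 b).2 hb)⟩
  · exact hI.root_essential fun b => (hout2 b).1 ((ho3 b).1 (h4 b))
  · intro h4
    obtain ⟨s, hs⟩ := List.exists_mem_of_ne_nil _ hI.sinks_ne
    have : s ∈ h3.S.sinks := hs3 (hg.sinks_sub hs)
    exact absurd this (by
      have h5 : h3.S.sinks = [] := h4
      rw [h5]; simp)
  · have hv0 : v ∈ h0.S.nodeSet := by rw [hn0]; exact Finset.mem_insert_self _ _
    refine progress_lt (hn3 (hg.node_sub hv0)) hvn ?_ fun b hb => (ho3 b).2 ((hout2 b).2 hb)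
    exact (((Finset.subset_insert v _).trans hn0.ge).trans hg.node_sub).trans hn3
  -- The loop exceeds its potential by at most the number of old edges, half of what inserting v
  -- contributed.
  · have : (h3.setTree v.length ((h3.T v.length).subst (some p) Te3)).S.weight = h3.S.weight := rfl
    omega

end OMTBDD

namespace OMTBDD

open OMTBDDAS

variable {L : Type} [DecidableEq L]

/-! ### Inserting a branching node -/

theorem lbl_twin_leaf (f : Str → L) (a v r : Str) (z c : L) :
    (CTree.twin r z c (.leaf (some v)) (.leaf none)).lbl f a =
      if f (a ++ r) = z ∧ f (a ++ flip r) = c then some (some v) else some none := by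
  simp [CTree.lbl]

/-- A string that passes the twin test has different values on r and its flip, so the test itself
witnesses essentiality. Its two queries are exactly the allowance of the new node. -/
theorem TreeOK.branch {f : Str → L} {m d : ℕ} {ns : Finset Str} {T : CTree L}
    (h : TreeOK f m d ns T) {v r : Str} {z c : L} (hvl : v ∉ ns)
    (hTv : T.lbl f v = some none) (hr : r.length = m - d) (hrne : r ≠ [])
    (hz : f (v ++ r) = z) (hc : f (v ++ flip r) = c) (hzc : z ≠ c) :
    TreeOK f m d (insert v ns)
      (T.subst none (.twin r z c (.leaf (some v)) (.leaf none))) where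
  lbl_self := by
    intro u hu
    rw [CTree.lbl_subst]
    rcases Finset.mem_insert.1 hu with rfl | hu
    · rw [hTv, if_pos rfl, lbl_twin_leaf, if_pos ⟨hz, hc⟩]
    · rw [h.lbl_self u hu, if_neg (by simp)]
  mem_of_lbl := by
    intro a u ha hu
    rw [CTree.lbl_subst, lbl_twin_leaf] at hu
    split_ifs at hu with h1 h2
    · simp only [Option.some.injEq] at hu
      exact hu ▸ Finset.mem_insert_self _ _
    · simp at hu
    · exact Finset.mem_insert_of_mem (h.mem_of_lbl a u ha hu)
  essential := by
    intro hd a ha hne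
    rw [CTree.lbl_subst, lbl_twin_leaf] at hne
    split_ifs at hne with h1 h2
    · exact ⟨r, hrne, by omega, by rw [h2.1, h2.2]; exact hzc⟩
    · exact absurd rfl hne
    · exact h.essential hd a ha hne
  cost_le := by
    intro a
    have h1 := h.cost_le a
    rw [CTree.cost_subst, Finset.card_insert_of_notMem hvl]
    have h2 : (CTree.twin r z c (.leaf (some v)) (.leaf none)).cost f a = 2 := by
      simp [CTree.cost]
    rw [h2]
    split_ifs <;> omega
  wf := h.wf.subst fun last _ => ⟨hr, hr, trivial⟩

/-- An edge crossing level d has its prefix classified as `μ`, hence it arrives at the new twin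
test. On a hit it is shortened to end in v; on a miss the prefix is still `μ` and the edge may stay.
-/
theorem branchLoop_spec {f : Str → L} {m d : ℕ} {v r : Str} {z c : L} {T : CTree L}
    (hvd : v.length = d) (Fs : List Edge) :
    ∀ {h : Hyp L}, h.S.IsValid f m → v ∈ h.S.nodeSet →
      (∀ i, 0 < i → i ≤ m → i ≠ d → ∀ E ∈ h.S.edges, EdgeOK f i (h.T i) E) →
      (∀ E ∈ h.S.edges,
        EdgeOK f d (T.subst none (.twin r z c (.leaf (some v)) (.leaf none))) E ∨ E ∈ Fs) →
      (∀ F ∈ Fs, F ∈ h.S.edges ∧ F.src.length < d ∧ d < F.tgt.length ∧ EdgeOK f d T F) →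
      Fs.Nodup →
      ∃ h' q, Yields f (branchLoop v (.twin r z c (.leaf (some v)) (.leaf none)) Fs h) h' q ∧
        h'.S.IsValid f m ∧ h'.T = h.T ∧ h'.S.inner = h.S.inner ∧ h'.S.sinks = h.S.sinks ∧
        h'.S.edges.length = h.S.edges.length ∧
        (∀ u b, h'.S.HasOut u b ↔ h.S.HasOut u b) ∧
        (∀ i, 0 < i → i ≤ m → i ≠ d → ∀ E ∈ h'.S.edges, EdgeOK f i (h'.T i) E) ∧
        (∀ E ∈ h'.S.edges,
          EdgeOK f d (T.subst none (.twin r z c (.leaf (some v)) (.leaf none))) E) ∧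
        q ≤ 2 * Fs.length := by
  induction Fs with
  | nil =>
    intro h hV hv hL hE hF hnd
    exact ⟨h, 0, Yields.pure _, hV, rfl, rfl, rfl, rfl, fun _ _ => Iff.rfl, hL,
      fun E h1 => (hE E h1).resolve_right (by simp), le_rfl⟩
  | cons F Fs ih =>
    intro h hV hv hL hE hF hnd
    obtain ⟨hFm, hFs, hFt, hFT⟩ := hF F List.mem_cons_self
    have hlen := hV.length_eq F hFm
    have hnd' := List.nodup_cons.1 hnd
    have hcl := CTree.yields_classify f (F.src ++ F.lab.take (v.length - F.src.length))
      (.twin r z c (.leaf (some v)) (.leaf none))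
    have hcost : (CTree.twin r z c (.leaf (some v)) (.leaf none)).cost f
        (F.src ++ F.lab.take (v.length - F.src.length)) = 2 := by simp [CTree.cost]
    have hcr := hFT.cross hFs (by omega)
    rw [hcost] at hcl
    have hl := lbl_twin_leaf f (F.src ++ F.lab.take (v.length - F.src.length)) v r z c
    by_cases hhit : f (F.src ++ F.lab.take (v.length - F.src.length) ++ r) = z ∧
        f (F.src ++ F.lab.take (v.length - F.src.length) ++ flip r) = c
    · rw [if_pos hhit] at hl
      rw [CTree.result_of_lbl hl] at hcl
      set g := F.lab.take (v.length - F.src.length) with hg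
      have hgl : F.src.length + g.length = d := by
        rw [hg, List.length_take]
        omega
      have hgne : g ≠ [] := by
        intro h0
        rw [h0] at hgl
        simp at hgl
        omega
      have hgh : g.head? = F.lab.head? := by
        rw [hg, List.head?_take, if_neg (by omega)]
      have hV1 : (h.S.replaceEdge F ⟨F.src, g, v⟩).IsValid f m :=
        hV.replaceEdge hFm rfl hv (hgl.trans hvd.symm) hgne hgh
      obtain ⟨h', q, y, h1, h2, h3, h4, h5, h6, h7, h8, h9⟩ := ih
        (h := h.mapS fun S => S.replaceEdge F ⟨F.src, g, v⟩) hV1 hv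
        (fun i hi him hid E hE' => by
          rcases hV.mem_replaceEdge.1 hE' with rfl | ⟨-, hE'⟩
          · rcases lt_or_gt_of_ne hid with h1 | h1
            · refine ⟨fun h2 => by simp only at h2; omega, fun h2 h3 => ?_⟩
              have h4 := (hL i hi him hid F hFm).cross h2 (by omega)
              simp only [hg, List.take_take]
              rw [min_eq_left (by omega)]
              exact h4
            · exact EdgeOK.of_gt _ (by simp only; omega)
          · exact hL i hi him hid E hE')
        (fun E hE' => by
          rcases hV.mem_replaceEdge.1 hE' with rfl | ⟨hEF, hE'⟩
          · refine Or.inl (EdgeOK.of_land hgl.symm ?_)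
            rw [← hvd] at hcr
            rw [CTree.lbl_subst]
            simp only
            rw [hg, hcr, if_pos rfl]
            exact hl
          · exact (hE E hE').imp_right fun h1 => (List.mem_cons.1 h1).resolve_left hEF)
        (fun G hG => by
          obtain ⟨h1, h2⟩ := hF G (List.mem_cons_of_mem _ hG)
          refine ⟨hV.mem_replaceEdge.2 (Or.inr ⟨?_, h1⟩), h2⟩
          rintro rfl
          exact hnd'.1 hG) hnd'.2
      refine ⟨h', 2 + q, ?_, h1, h2, h3, h4, h5.trans (length_replaceEdge hFm),
        fun u b => (h6 u b).trans
          (hV.hasOut_replaceEdge (E' := ⟨F.src, g, v⟩) hFm rfl hgh u b), h7, h8, ?_⟩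
      · unfold branchLoop
        exact hcl.bind y
      · rw [List.length_cons]; omega
    · rw [if_neg hhit] at hl
      rw [CTree.result_of_lbl hl] at hcl
      obtain ⟨h', q, y, h1, h2, h3, h4, h5, h6, h7, h8, h9⟩ := ih hV hv hL
        (fun E hE' => by
          by_cases hEF : E = F
          · subst hEF
            refine Or.inl ⟨fun h2 => by omega, fun h2 h3 => ?_⟩
            rw [← hvd] at hcr
            rw [CTree.lbl_subst, ← hvd, hcr, if_pos rfl]
            exact hl
          · exact (hE E hE').imp_right fun h1 => (List.mem_cons.1 h1).resolve_left hEF)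
        (fun G hG => hF G (List.mem_cons_of_mem _ hG)) hnd'.2
      refine ⟨h', 2 + q, ?_, h1, h2, h3, h4, h5, h6, h7, h8, ?_⟩
      · unfold branchLoop
        exact hcl.bind y
      · rw [List.length_cons]; omega

theorem drop_take_drop_append (e : Str) {s n k : ℕ} (hk : k ≤ n) (hn : s + n ≤ e.length) :
    ((e.drop s).take n).drop k ++ e.drop (s + n) = e.drop (s + k) := by
  have h1 : (e.drop s).take n ++ e.drop (s + n) = e.drop s := by
    rw [← List.drop_drop, List.take_append_drop]
  have h2 : k ≤ ((e.drop s).take n).length := by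
    rw [List.length_take, List.length_drop]
    omega
  rw [← List.drop_append_of_le_length h2, h1, List.drop_drop]

/-- What the search for the first relevant bit on an edge label yields. -/
theorem exists_branching_bit {f : Str → L} {m : ℕ} {e : Str} {E : Edge} {c y : L}
    (he : e.length = m) (hlen : E.src.length + E.lab.length = E.tgt.length)
    (htm : E.tgt.length ≤ m) (hlab : E.lab ≠ [])
    (hc : f (E.src ++ E.lab ++ e.drop E.tgt.length) = c)
    (hy : f (E.src ++ e.drop E.src.length) = y) (hyc : y ≠ c) :
    ∃ j z q, 0 < j ∧ j ≤ E.lab.length ∧ q ≤ Nat.clog 2 m ∧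
      Yields f (bsearch (fun j => ask (E.src ++
        cro E.lab ((e.drop E.src.length).take E.lab.length) j ++ e.drop E.tgt.length))
        c E.lab.length 0 E.lab.length y) (j, z) q ∧
      z ≠ c ∧
      f (E.src ++ E.lab.take (E.lab.length - j) ++
        e.drop (E.src ++ E.lab.take (E.lab.length - j)).length) = z ∧
      f (E.src ++ E.lab.take (E.lab.length - j) ++
        flip (e.drop (E.src ++ E.lab.take (E.lab.length - j)).length)) = c ∧
      ∃ b, (e.drop (E.src ++ E.lab.take (E.lab.length - j)).length).head? = some b ∧
        (E.lab.drop (E.lab.length - j)).head? = some (!b) := by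
  have hpos := List.length_pos_iff.2 hlab
  set q := E.lab with hq
  set s := E.src.length with hs
  set g : ℕ → L := fun j => f (E.src ++ cro q ((e.drop s).take q.length) j ++
    e.drop E.tgt.length) with hg
  -- Reindexed from the front: keep the first k bits of the label and continue with e.
  have hgj : ∀ k ≤ q.length, g (q.length - k) = f (E.src ++ q.take k ++ e.drop (s + k)) := by
    intro k hk
    have h1 : ((e.drop s).take q.length).length = q.length := by
      rw [List.length_take, List.length_drop]; omega
    simp only [hg, cro, h1]
    rw [Nat.sub_sub_self hk, ← List.append_assoc, List.append_assoc (E.src ++ q.take k), ← hlen,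
      drop_take_drop_append e hk (by omega)]
  have hg0 : g 0 = c := by
    have := hgj q.length le_rfl
    rw [Nat.sub_self, List.take_length, hlen] at this
    rw [this, hc]
  have hgl : g q.length = y := by
    have := hgj 0 (Nat.zero_le _)
    rw [Nat.sub_zero, List.take_zero, List.append_nil, Nat.add_zero] at this
    rw [this, hy]
  obtain ⟨j, n, hj0, hjl, hgj1, hgjc, hn, hyl⟩ := Yields.bsearch (f := f) (g := g)
    (phi := fun j => ask (E.src ++ cro q ((e.drop s).take q.length) j ++ e.drop E.tgt.length))
    (c := c) (fun j => Yields.ask _) q.length 0 q.length (Nat.clog 2 m) hpos (by omega)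
    (by
      have := Nat.le_pow_clog (b := 2) (by norm_num) m
      omega) hg0 (by rw [hgl]; exact hyc)
  rw [hgl] at hyl
  obtain ⟨k, hk⟩ : ∃ k, k = q.length - j := ⟨_, rfl⟩
  have hkl : k < q.length := by omega
  have hkj : q.length - k = j := by omega
  have hkj1 : q.length - (k + 1) = j - 1 := by omega
  have hvl : (E.src ++ q.take k).length = s + k := by
    rw [List.length_append, List.length_take, min_eq_left hkl.le]
  have hz := hgj k hkl.le
  rw [hkj] at hz
  have hz1 := hgj (k + 1) hkl
  rw [hkj1, hgj1] at hz1
  refine ⟨j, g j, n, hj0, hjl, hn, hyl, hgjc, ?_⟩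
  rw [← hk, hvl]
  have hse : s + k < e.length := by omega
  have hdrop : e.drop (s + k) = e[s + k] :: e.drop (s + (k + 1)) :=
    List.drop_eq_getElem_cons hse
  have htake : q.take (k + 1) = q.take k ++ [q[k]] := (List.take_append_getElem hkl).symm
  have hz1' : c = f (E.src ++ q.take k ++ (q[k] :: e.drop (s + (k + 1)))) := by
    rw [hz1, htake]
    simp only [List.append_assoc, List.singleton_append]
  -- If label and e agreed at this position, both sides of the jump would be the same string, yet
  -- their values differ.
  have hne : q[k] = !e[s + k] := by
    by_contra h0
    have h1 : q[k] = e[s + k] := by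
      revert h0
      cases q[k] <;> cases e[s + k] <;> simp
    rw [h1, ← hdrop] at hz1'
    exact hgjc (hz.trans hz1'.symm)
  refine ⟨hz.symm, ?_, e[s + k], by rw [hdrop]; rfl, ?_⟩
  · rw [hdrop, flip, ← hne]
    exact hz1'.symm
  · rw [List.drop_eq_getElem_cons hkl, hne]
    rfl

/-- The position found inside the label is essential although it was classified as `μ`. The
hypothesis `hstep` says that e left the source by its own bit unless the source is a dummy root;
this confines the case of a position at the very beginning of the label to the dummy root. -/
theorem newBranchingNode_spec {f : Str → L} {m : ℕ} {h : Hyp L} {e : Str} {E : Edge} {c y : L}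
    (hI : Inv f m h) (he : e.length = m) (hE : E ∈ h.S.edges)
    (hstep : E.lab.head? = some (e.getD E.src.length false) ∨ E.src = [] ∧ ¬ h.S.Full [])
    (hc : f (E.src ++ E.lab ++ e.drop E.tgt.length) = c)
    (hy : f (E.src ++ e.drop E.src.length) = y) (hyc : y ≠ c) :
    ∃ h' q, Yields f (newBranchingNode m h e E c y) h' q ∧ Inv f m h' ∧
      h.S.progress < h'.S.progress ∧ q + h.S.weight ≤ Nat.clog 2 m + h'.S.weight := by
  have hlen := hI.valid.length_eq E hE
  have htm := hI.valid.length_le (hI.valid.tgt_mem E hE)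
  obtain ⟨j, z, n, hj0, hjl, hn, hyl, hzc, hz, hcf, b, hb, hqb⟩ :=
    exists_branching_bit he hlen htm (hI.valid.lab_ne E hE) hc hy hyc
  set q := E.lab with hq
  have hql : E.lab.length = q.length := rfl
  obtain ⟨k, hk⟩ : ∃ k, k = q.length - j := ⟨_, rfl⟩
  rw [← hk] at hz hcf hb hqb
  have hkl : k < q.length := by omega
  set v := E.src ++ q.take k with hv
  have hvl : v.length = E.src.length + k := by
    rw [hv, List.length_append, List.length_take, min_eq_left hkl.le]
  have hvm : v.length < m := by omega
  set r := e.drop v.length with hr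
  have hrl : r.length = m - v.length := by rw [hr, List.length_drop, he]
  have hrne : r ≠ [] := by
    intro h0
    rw [h0] at hb
    simp at hb
  have hess : Essential f m v := ⟨r, hrne, by omega, by rw [hz, hcf]; exact hzc⟩
  by_cases hjq : j = q.length
  · -- the root gets its second edge
    have hk0 : k = 0 := by omega
    have hvE : v = E.src := by rw [hv, hk0, List.take_zero, List.append_nil]
    rw [hk0, List.drop_zero] at hqb
    rw [hvE] at hr
    have hb2 : e.getD E.src.length false = b := by
      rw [hr, List.head?_drop] at hb
      rw [List.getD, hb]
      rfl
    -- The label and e differ in their first bit here, so e can only have passed a dummy root, whose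
    -- missing edge is the one to be added.
    rcases hstep with h1 | ⟨h1, h2⟩
    · rw [hqb, hb2] at h1
      simp at h1
    · have hv0 : v = [] := hvE.trans h1
      have hno : ¬ h.S.HasOut v b := by
        intro h3
        refine h2 fun b' => ?_
        by_cases h4 : b' = b
        · rw [h4, ← hv0]; exact h3
        · have : b' = !b := by revert h4; cases b <;> cases b' <;> simp
          exact ⟨E, hE, h1, by rw [this]; exact hqb⟩
      obtain ⟨h', c1, y1, p1, w1⟩ := addEdge_spec (v := v) (t := r) hI.valid
        (fun i hi him => hI.levels i (by omega) him) hI.top (hv0 ▸ hI.valid.root_mem)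
        (by omega) hb hno
      refine ⟨h', n + c1, ?_, ⟨p1.valid, fun i hi him => ?_, p1.top, fun u hu hne => ?_,
        ⟨b, hv0 ▸ p1.out⟩, fun _ => hv0 ▸ hess, fun h4 => ?_⟩, ?_, by omega⟩
      · unfold newBranchingNode
        refine hyl.bind ?_
        simp only
        rw [if_neg (by simpa using hjq), ← hk]
        exact y1
      · exact p1.levels i (by rw [hv0]; simpa using hi) him
      · rcases p1.full_new u hu with h4 | h4
        · exact fun b => p1.grows.hasOut (hI.full u h4 hne b)
        · exact h4
      · obtain ⟨s, hs⟩ := List.exists_mem_of_ne_nil _ hI.sinks_ne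
        have := p1.grows.sinks_sub hs
        rw [h4] at this
        simp at this
      · have hF : h'.S.Full [] := by
          intro b'
          by_cases h4 : b' = b
          · rw [h4, ← hv0]; exact p1.out
          · have : b' = !b := by revert h4; cases b <;> cases b' <;> simp
            exact p1.grows.hasOut ⟨E, hE, h1, by rw [this]; exact hqb⟩
        have := Finset.card_le_card p1.grows.node_sub
        unfold OMTBDDAS.progress
        rw [if_neg h2, if_pos hF]
        omega
  · -- a new node is inserted
    have hk0 : 0 < k := by omega
    set d := v.length with hd
    have hLd := hI.levels d (by omega) hvm.le
    -- The string v lies strictly inside a label, where `EdgeOK.cross` gives `μ`; so v was no node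
    -- and its tree can be extended at `μ`.
    have hTv : (h.T d).lbl f v = some none := by
      have := (hLd.edge E hE).cross (by omega) (by omega)
      rwa [show d - E.src.length = k by omega] at this
    have hvn : v ∉ h.S.nodeSet := by
      intro h1
      have := hLd.tree.lbl_self v (mem_level.2 ⟨h1, rfl⟩)
      rw [hTv] at this
      simp at this
    have hvi : v ∉ h.S.inner := fun h1 => hvn (mem_nodeSet.2 (Or.inl h1))
    have hvne : v ≠ [] := by
      intro h0
      have : d = 0 := by rw [hd, h0]; rfl
      omega
    have htl : (q.take k).length = k := by rw [List.length_take, min_eq_left hkl.le]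
    have htne : q.take k ≠ [] := by
      intro h0; rw [h0] at htl; simp at htl; omega
    have hdl : (q.drop k).length = q.length - k := List.length_drop
    have hdne : q.drop k ≠ [] := by
      intro h0; rw [h0] at hdl; simp at hdl; omega
    have hhead : (q.take k).head? = q.head? := by
      rw [List.head?_take, if_neg (by omega)]
    have hVi := hI.valid.addInner (v := v) hvm
    have hEi : E ∈ (h.S.addInner v).edges := hE
    have hvin : v ∈ (h.S.addInner v).nodeSet := by
      rw [nodeSet_addInner]; exact Finset.mem_insert_self _ _
    have hVr : ((h.S.addInner v).replaceEdge E ⟨E.src, q.take k, v⟩).IsValid f m :=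
      hVi.replaceEdge hEi rfl hvin (by simp only [htl]; omega) htne hhead
    have hnov : ∀ F ∈ ((h.S.addInner v).replaceEdge E ⟨E.src, q.take k, v⟩).edges,
        F.src ≠ v := by
      intro F hF h1
      rcases hVi.mem_replaceEdge.1 hF with rfl | ⟨-, hF⟩
      · have : E.src.length = d := congrArg List.length h1
        omega
      · exact hvi (h1 ▸ hI.valid.src_mem F hF)
    set h0 := h.mapS fun S => ((S.addInner v).replaceEdge E ⟨E.src, q.take k, v⟩).addEdge
      ⟨v, q.drop k, E.tgt⟩ with hh0
    have hn0 : h0.S.nodeSet = insert v h.S.nodeSet := nodeSet_addInner h.S v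
    have hV0 : h0.S.IsValid f m := by
      refine hVr.addEdge List.mem_cons_self ?_ (by simp only [hdl]; omega) hdne
        fun F hF h1 => absurd h1 (hnov F hF)
      change E.tgt ∈ (h.S.addInner v).nodeSet
      rw [nodeSet_addInner]
      exact Finset.mem_insert_of_mem (hI.valid.tgt_mem E hE)
    have hmem0 : ∀ F ∈ h0.S.edges, F = ⟨v, q.drop k, E.tgt⟩ ∨ F = ⟨E.src, q.take k, v⟩ ∨
        (F ≠ E ∧ F ∈ h.S.edges) := by
      intro F hF
      rcases List.mem_cons.1 hF with hF | hF
      · exact Or.inl hF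
      · exact Or.inr (hVi.mem_replaceEdge.1 hF)
    have hout0 : ∀ u, u ≠ v → ∀ b, h0.S.HasOut u b ↔ h.S.HasOut u b := by
      intro u hu b
      have h1 := hVi.hasOut_replaceEdge (E' := ⟨E.src, q.take k, v⟩) hEi rfl hhead u b
      refine Iff.trans ⟨?_, ?_⟩ h1
      · rintro ⟨F, hF, h2, h3⟩
        rcases List.mem_cons.1 hF with rfl | hF
        · exact absurd h2.symm hu
        · exact ⟨F, hF, h2, h3⟩
      · rintro ⟨F, hF, h2, h3⟩
        exact ⟨F, List.mem_cons_of_mem _ hF, h2, h3⟩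
    -- Prefixes along the second half are prefixes along the old edge, so both halves inherit the
    -- old classifications.
    have hv2 : ∀ i, d < i → v ++ (q.drop k).take (i - d) = E.src ++ q.take (i - E.src.length) := by
      intro i hi
      rw [hv, List.append_assoc, show i - E.src.length = k + (i - d) by omega, List.take_add]
    have hE0 : ∀ i, 0 < i → i ≤ m → i ≠ d → ∀ F ∈ h0.S.edges, EdgeOK f i (h0.T i) F := by
      intro i hi him hid F hF
      have hLE := (hI.levels i hi him).edge E hE
      rcases hmem0 F hF with rfl | rfl | ⟨-, hF⟩
      · refine ⟨fun h1 => ?_, fun h1 h2 => ?_⟩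
        · simp only [hdl] at h1
          have h3 := hLE.land (by omega)
          simp only
          rw [hv, List.append_assoc, List.take_append_drop]
          exact h3
        · simp only [hdl] at h1 h2
          have h3 := hLE.cross (by omega) (by omega)
          simp only
          rw [hv2 i h1]
          exact h3
      · rcases lt_or_gt_of_ne hid with h1 | h1
        · refine ⟨fun h2 => by simp only [htl] at h2; omega, fun h2 h3 => ?_⟩
          simp only [htl] at h2 h3
          simp only [List.take_take]
          rw [min_eq_left (by omega)]
          exact hLE.cross h2 (by omega)
        · exact EdgeOK.of_gt _ (by simp only [htl]; omega)
      · exact (hI.levels i hi him).edge F hF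
    set Tr : CTree L := .twin r z c (.leaf (some v)) (.leaf none) with hTr
    have hTrv : Tr.lbl f v = some (some v) := by rw [hTr, lbl_twin_leaf, if_pos ⟨hz, hcf⟩]
    set Fs := h0.S.edges.filter fun F => F.src.length < d ∧ d < F.tgt.length with hFs
    obtain ⟨h1, q1, y1, hV1, hT1, hin1, hsk1, hel1, hout1, hE1, hEd1, hq1⟩ :=
      branchLoop_spec (T := h.T d) (v := v) (r := r) (z := z) (c := c) rfl Fs
        (h := h0) hV0 (by rw [hn0]; exact Finset.mem_insert_self _ _) hE0
        (fun F hF => by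
          rcases hmem0 F hF with rfl | rfl | ⟨-, hF'⟩
          · exact Or.inl (EdgeOK.of_le _ le_rfl hdne)
          · refine Or.inl (EdgeOK.of_land (by simp only [htl]; omega) ?_)
            rw [CTree.lbl_subst]
            simp only
            rw [← hv, hTv, if_pos rfl]
            exact hTrv
          · have h4 := hLd.edge F hF'
            by_cases hcr : F.src.length < d ∧ d < F.tgt.length
            · exact Or.inr (List.mem_filter.2 ⟨hF, decide_eq_true hcr⟩)
            · refine Or.inl ⟨fun h5 => ?_, fun h5 h6 => ?_⟩
              · rw [CTree.lbl_subst, h4.land h5, if_neg (by simp)]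
              · have := hI.valid.length_eq F hF'
                exact absurd ⟨h5, by omega⟩ hcr)
        (fun F hF => by
          obtain ⟨h3, h4⟩ := List.mem_filter.1 hF
          have h4 : F.src.length < d ∧ d < F.tgt.length := of_decide_eq_true h4
          refine ⟨h3, h4.1, h4.2, ?_⟩
          rcases hmem0 F h3 with rfl | rfl | ⟨-, hF'⟩
          · exact absurd h4.1 (lt_irrefl _)
          · exact absurd h4.2 (lt_irrefl _)
          · exact hLd.edge F hF') (hV0.nodup.filter _)
    have hn1 : h1.S.nodeSet = insert v h.S.nodeSet := by
      rw [← hn0, nodeSet, hin1, hsk1, ← nodeSet]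
    have hel0 : h0.S.edges.length = h.S.edges.length + 1 := by
      have := length_replaceEdge (E' := ⟨E.src, q.take k, v⟩) hEi
      exact congrArg (· + 1) this
    set h2 := h1.setTree d ((h1.T d).subst none Tr) with hh2
    have hL2 : ∀ i, 0 < i → i ≤ m → LevelOK f m h2.S i (h2.T i) := by
      intro i hi him
      by_cases hid : i = d
      · subst hid
        have h3 : h2.T d = (h.T d).subst none Tr := by
          rw [hh2, Hyp.setTree, hT1]
          exact Function.update_self _ _ _
        rw [h3]
        refine ⟨?_, hEd1⟩
        have h4 : h2.S.level d = insert v (h.S.level d) := level_of_nodeSet_insert hn1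
        rw [h4]
        exact hLd.tree.branch (fun h3 => hvn (mem_level.1 h3).1) hTv hrl hrne hz hcf hzc
      · have h3 : h2.T i = h.T i := by
          rw [hh2, Hyp.setTree, hT1]
          exact Function.update_of_ne hid _ _
        rw [h3]
        refine ⟨?_, fun F hF => ?_⟩
        · have h4 : h2.S.level i = h.S.level i := level_of_nodeSet_insert_ne hn1 (Ne.symm hid)
          rw [h4]
          exact (hI.levels i hi him).tree
        · have := hE1 i hi him hid F hF
          rw [hT1] at this
          exact this
    have hout2 : ∀ u, u ≠ v → ∀ b, h2.S.HasOut u b ↔ h.S.HasOut u b :=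
      fun u hu b => (hout1 u b).trans (hout0 u hu b)
    have hno : ¬ h2.S.HasOut v b := by
      intro h3
      obtain ⟨F, hF, h4, h5⟩ := (hout1 v b).1 h3
      rcases List.mem_cons.1 hF with rfl | hF
      · rw [hqb] at h5
        simp at h5
      · exact hnov F hF h4
    have hvout : h2.S.HasOut v (!b) := (hout1 v _).2 ⟨_, List.mem_cons_self, rfl, hqb⟩
    have hinner : h2.S.inner = v :: h.S.inner := hin1
    have htop : (h2.T m).IsTop f := by
      have h3 : h2.T m = h.T m := by
        rw [hh2, Hyp.setTree, hT1]
        exact Function.update_of_ne hvm.ne' _ _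
      rw [h3]; exact hI.top
    obtain ⟨h', c1, y2, p1, w1⟩ := addEdge_spec (v := v) (t := r) (h := h2) hV1
      (fun i hi him => hL2 i (by omega) him) htop
      (by rw [hinner]; exact List.mem_cons_self) (by omega) hb hno
    have hroot : ∀ b, h'.S.HasOut [] b ↔ h.S.HasOut [] b := by
      intro b
      rw [← hout2 [] hvne.symm b]
      refine ⟨fun h3 => ?_, p1.grows.hasOut⟩
      refine (p1.grows.of_hasOut ?_ h3).resolve_right fun h4 => hvne h4.1.symm
      rw [hinner]
      exact List.mem_cons_of_mem _ hI.valid.root_mem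
    refine ⟨h', n + (q1 + c1), ?_, ⟨p1.valid, fun i hi him => ?_, p1.top, fun u hu hne => ?_,
      ?_, fun h4 => ?_, fun h4 => ?_⟩, ?_, ?_⟩
    · unfold newBranchingNode
      refine hyl.bind ?_
      simp only
      rw [if_pos (by simpa using hjq), ← hk]
      exact y1.bind y2
    · by_cases hid : i ≤ d
      · exact p1.grows.levelOK p1.valid hid (hL2 i hi him)
      · exact p1.levels i (by omega) him
    · rcases p1.full_new u hu with h4 | h4
      · rw [hinner] at h4
        intro b'
        by_cases huv : u = v
        · subst huv
          by_cases h5 : b' = b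
          · exact h5 ▸ p1.out
          · have : b' = !b := by revert h5; cases b <;> cases b' <;> simp
            exact this ▸ p1.grows.hasOut hvout
        · exact p1.grows.hasOut ((hout2 u huv b').2
            (hI.full u ((List.mem_cons.1 h4).resolve_left huv) hne b'))
      · exact h4
    · obtain ⟨b', hb'⟩ := hI.root_out
      exact ⟨b', (hroot b').2 hb'⟩
    · exact hI.root_essential fun b => (hroot b).1 (h4 b)
    · obtain ⟨s, hs⟩ := List.exists_mem_of_ne_nil _ hI.sinks_ne
      have hs2 : s ∈ h2.S.sinks := by
        have : h2.S.sinks = h.S.sinks := hsk1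
        rw [this]; exact hs
      have := p1.grows.sinks_sub hs2
      rw [h4] at this
      simp at this
    · have hn2 : h2.S.nodeSet = insert v h.S.nodeSet := hn1
      refine progress_lt (v := v) (p1.grows.node_sub ?_) hvn
        (fun u hu => p1.grows.node_sub ?_) fun b' hb' => (hroot b').2 hb'
      · rw [hn2]; exact Finset.mem_insert_self _ _
      · rw [hn2]; exact Finset.mem_insert_of_mem hu
    -- Splitting the edge raises both factors by one. With E old edges the gain is at least 2(E +
    -- 1), enough for two queries per tested edge.
    · have hw2 : h2.S.weight = 2 * (h.S.edges.length + 1) * (h.S.nodeSet.card + 1) := by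
        have : h2.S.weight = 2 * h1.S.edges.length * h1.S.nodeSet.card := rfl
        rw [this, hel1, hel0, hn1, Finset.card_insert_of_notMem hvn]
      have hw : h.S.weight = 2 * h.S.edges.length * h.S.nodeSet.card := rfl
      have hFl : Fs.length ≤ h.S.edges.length + 1 := by
        rw [← hel0]; exact List.length_filter_le _ _
      nlinarith

end OMTBDD

namespace OMTBDD

open OMTBDDAS

/-! ### Paths -/

namespace OMTBDDAS

variable {L : Type}

theorem exists_edge? {S : OMTBDDAS L} {v : Str} {b : Bool} (h : S.HasOut v b) :
    ∃ E, S.edge? v b = some E ∧ E ∈ S.edges ∧ E.src = v ∧ E.lab.head? = some b := by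
  obtain ⟨F, hF, h1, h2⟩ := h
  have : (S.edge? v b).isSome := by
    rw [edge?, List.find?_isSome]
    exact ⟨F, List.mem_filter.2 ⟨hF, decide_eq_true h1⟩, decide_eq_true h2⟩
  obtain ⟨E, hE⟩ := Option.isSome_iff_exists.1 this
  have h3 := List.mem_filter.1 (List.mem_of_find?_eq_some hE)
  have h4 := List.find?_some (p := fun E : Edge => E.lab.head? = some b) hE
  exact ⟨E, hE, h3.1, of_decide_eq_true h3.2, of_decide_eq_true h4⟩

/-- Two different edges at the root would begin with different bits and make it full, so a root that
is not full but has an outgoing edge has exactly one. -/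
theorem exists_dummyEdge? {f : Str → L} {m : ℕ} {S : OMTBDDAS L} (hV : S.IsValid f m)
    (hr : ∃ b, S.HasOut [] b) (hF : ¬ S.Full []) :
    ∃ E, S.dummyEdge? = some E ∧ E ∈ S.edges ∧ E.src = [] := by
  obtain ⟨b, E, hE, h1, h2⟩ := hr
  have hall : ∀ F ∈ S.out [], F = E := by
    intro F hF'
    obtain ⟨h3, h4⟩ := List.mem_filter.1 hF'
    have h4 : F.src = [] := of_decide_eq_true h4
    refine hV.edge_inj F h3 E hE (h4.trans h1.symm) ?_
    by_contra h5
    refine hF fun b' => ?_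
    by_cases h6 : b' = b
    · exact ⟨E, hE, h1, h6 ▸ h2⟩
    · obtain ⟨c, hc⟩ := Option.isSome_iff_exists.1 (List.isSome_head?.2 (hV.lab_ne F h3))
      have hcb : c ≠ b := fun h7 => h5 (by rw [hc, h2, h7])
      have : b' = c := bool_eq_of_ne hcb h6
      exact ⟨F, h3, h4, this ▸ hc⟩
  have hmem : E ∈ S.out [] := List.mem_filter.2 ⟨hE, decide_eq_true h1⟩
  have hnd : (S.out []).Nodup := hV.nodup.filter _
  refine ⟨E, ?_, hE, h1⟩
  unfold dummyEdge?
  rcases ho : S.out [] with _ | ⟨F, _ | ⟨G, l⟩⟩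
  · rw [ho] at hmem; simp at hmem
  · rw [hall F (by rw [ho]; simp)]
  · rw [ho] at hnd
    have h3 := hall F (by rw [ho]; simp)
    have h4 := hall G (by rw [ho]; simp)
    rw [h3, h4] at hnd
    simp at hnd

theorem dummyEdge?_eq_none {S : OMTBDDAS L} (hF : S.Full []) : S.dummyEdge? = none := by
  obtain ⟨E, hE, h1, h2⟩ := hF false
  obtain ⟨F, hF, h3, h4⟩ := hF true
  have hEm : E ∈ S.out [] := List.mem_filter.2 ⟨hE, decide_eq_true h1⟩
  have hFm : F ∈ S.out [] := List.mem_filter.2 ⟨hF, decide_eq_true h3⟩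
  unfold dummyEdge?
  split
  · rename_i G hG
    rw [hG, List.mem_singleton] at hEm hFm
    rw [hEm] at h2
    rw [hFm, h2] at h4
    simp at h4
  · rfl

theorem next?_eq_edge? {S : OMTBDDAS L} {e v : Str} (hv : v ≠ [] ∨ S.Full []) :
    S.next? e v = S.edge? v (e.getD v.length false) := by
  unfold next?
  by_cases h0 : v = []
  · rw [if_pos h0, dummyEdge?_eq_none (hv.resolve_left (not_not_intro h0))]
  · rw [if_neg h0]

theorem lookup_sinks {f : Str → L} {l : List (Str × L)} (h : ∀ p ∈ l, p.2 = f p.1) {v : Str}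
    (hv : ∃ x, (v, x) ∈ l) : l.lookup v = some (f v) := by
  induction l with
  | nil => simp at hv
  | cons p l ih =>
    obtain ⟨a, b⟩ := p
    by_cases hva : v = a
    · have : b = f a := h (a, b) List.mem_cons_self
      rw [hva, List.lookup_cons_self, this]
    · rw [List.lookup_cons, beq_false_of_ne hva]
      obtain ⟨x, hx⟩ := hv
      refine ih (fun p hp => h p (List.mem_cons_of_mem _ hp)) ⟨x, ?_⟩
      rcases List.mem_cons.1 hx with hx | hx
      · exact absurd (congrArg Prod.fst hx) hva
      · exact hx

theorem lookup_sinks_eq_none {l : List (Str × L)} {v : Str} (h : ∀ p ∈ l, p.1 ≠ v) :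
    l.lookup v = none := by
  induction l with
  | nil => rfl
  | cons p l ih =>
    obtain ⟨a, b⟩ := p
    rw [List.lookup_cons, beq_false_of_ne (h (a, b) List.mem_cons_self).symm]
    exact ih fun p hp => h p (List.mem_cons_of_mem _ hp)

/-- `P` is the list of the edges that `e` passes from `v` to `w`. -/
def IsPath (S : OMTBDDAS L) (e : Str) : Str → List Edge → Str → Prop
  | v, [], w => v = w
  | v, E :: P, w => S.next? e v = some E ∧ E.src = v ∧ E ∈ S.edges ∧ S.IsPath e E.tgt P w

theorem IsPath.getD_length {S : OMTBDDAS L} {e v w : Str} {P : List Edge}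
    (h : S.IsPath e v P w) : (v :: P.map Edge.tgt).getD P.length [] = w := by
  induction P generalizing v with
  | nil => exact h
  | cons E P ih =>
    have := ih h.2.2.2
    simpa using this

theorem IsPath.getLastD {S : OMTBDDAS L} {e v w : Str} {P : List Edge}
    (h : S.IsPath e v P w) : (v :: P.map Edge.tgt).getLastD [] = w := by
  induction P generalizing v with
  | nil => exact h
  | cons E P ih =>
    have := ih h.2.2.2
    simpa using this

theorem IsPath.getElem {S : OMTBDDAS L} {e v w : Str} {P : List Edge}
    (h : S.IsPath e v P w) {i : ℕ} {E : Edge} (hi : P[i]? = some E) :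
    (v :: P.map Edge.tgt).getD i [] = E.src ∧ (v :: P.map Edge.tgt).getD (i + 1) [] = E.tgt ∧
      S.next? e E.src = some E ∧ E ∈ S.edges := by
  induction P generalizing v i with
  | nil => simp at hi
  | cons F P ih =>
    cases i with
    | zero =>
      simp only [List.getElem?_cons_zero, Option.some.injEq] at hi
      subst hi
      exact ⟨h.2.1.symm, rfl, h.2.1 ▸ h.1, h.2.2.1⟩
    | succ i =>
      have := ih h.2.2.2 (i := i) (by simpa using hi)
      simpa using this

end OMTBDDAS

variable {L : Type} [DecidableEq L]

section Invariant

variable {f : Str → L} {m : ℕ} {h : Hyp L} (hI : Inv f m h)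

include hI

/-- A dummy root is left by its only edge whatever the bit of e, which is why agreement with the
first bit of the label can fail there. -/
theorem Inv.exists_next? {e v : Str} (hv : v ∈ h.S.inner) :
    ∃ E, h.S.next? e v = some E ∧ E ∈ h.S.edges ∧ E.src = v ∧
      (E.lab.head? = some (e.getD E.src.length false) ∨ E.src = [] ∧ ¬ h.S.Full []) := by
  by_cases h0 : v ≠ [] ∨ h.S.Full []
  · have hF : h.S.Full v := by
      by_cases h1 : v = []
      · rw [h1]; exact h0.resolve_left (not_not_intro h1)
      · exact hI.full v hv h1
    obtain ⟨E, h1, h2, h3, h4⟩ := exists_edge? (hF (e.getD v.length false))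
    exact ⟨E, (next?_eq_edge? h0).trans h1, h2, h3, Or.inl (h3 ▸ h4)⟩
  · push Not at h0
    obtain ⟨E, h1, h2, h3⟩ := exists_dummyEdge? hI.valid hI.root_out h0.2
    refine ⟨E, ?_, h2, h3.trans h0.1.symm, Or.inr ⟨h3, h0.2⟩⟩
    unfold next?
    rw [if_pos h0.1, h1]

theorem Inv.next?_eq_none {e v : Str} (hm : 0 < m) (hv : v.length = m) :
    h.S.next? e v = none := by
  have hne : v ≠ [] := by rintro rfl; simp at hv; omega
  rw [next?_eq_edge? (Or.inl hne), edge?, List.find?_eq_none]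
  intro E hE
  obtain ⟨h1, h2⟩ := List.mem_filter.1 hE
  have h3 := hI.valid.inner_lt _ (hI.valid.src_mem E h1)
  rw [of_decide_eq_true h2] at h3
  omega

/-- Every edge lengthens the node string and inner nodes are never dead ends, so the path reaches a
sink within m steps. -/
theorem Inv.exists_isPath {e : Str} (hm : 0 < m) (fuel : ℕ) :
    ∀ {v : Str}, v ∈ h.S.nodeSet → m ≤ fuel + v.length →
      ∃ w, (∃ x, (w, x) ∈ h.S.sinks) ∧ h.S.IsPath e v (h.S.pathFrom e fuel v) w ∧
        (h.S.pathFrom e fuel v).length + v.length ≤ m := by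
  induction fuel with
  | zero =>
    intro v hv hf
    rcases mem_nodeSet.1 hv with h1 | h1
    · have := hI.valid.inner_lt v h1
      omega
    · exact ⟨v, h1, rfl, by have := hI.valid.length_le hv; simpa [pathFrom] using this⟩
  | succ fuel ih =>
    intro v hv hf
    rcases mem_nodeSet.1 hv with h1 | h1
    · obtain ⟨E, h2, h3, h4, -⟩ := hI.exists_next? (e := e) h1
      have hlen := hI.valid.length_eq E h3
      have hpos := List.length_pos_iff.2 (hI.valid.lab_ne E h3)
      rw [h4] at hlen
      obtain ⟨w, hw, hp, hl⟩ := ih (hI.valid.tgt_mem E h3) (by omega)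
      have e1 : h.S.pathFrom e (fuel + 1) v = E :: h.S.pathFrom e fuel E.tgt := by
        simp only [pathFrom, h2]
      rw [e1]
      exact ⟨w, hw, ⟨h2, h4, h3, hp⟩, by rw [List.length_cons]; omega⟩
    · obtain ⟨x, hx⟩ := h1
      have hl : v.length = m := (hI.valid.sink_ok _ hx).1
      have e1 : h.S.pathFrom e (fuel + 1) v = [] := by
        simp only [pathFrom, hI.next?_eq_none hm hl]
      rw [e1]
      exact ⟨v, ⟨x, hx⟩, rfl, by simp [hl]⟩

theorem Inv.sinkLabel_eq [Zero L] {w : Str} (hw : ∃ x, (w, x) ∈ h.S.sinks) :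
    h.S.sinkLabel w = f w := by
  rw [sinkLabel, lookup_sinks (fun p hp => (hI.valid.sink_ok p hp).2) hw]
  rfl

/-- At the sink the interpolated value is that of the hypothesis, at the root it is that of the
target; they differ, so some edge of the path carries the change. The queries beyond the potential
are two binary searches over at most m positions and the one for x. -/
theorem Inv.updateHypothesis_spec [Zero L] (hm : 0 < m) {e : Str} (he : e.length = m)
    (hne : h.S.value e ≠ f e) :
    ∃ h' q, Yields f (updateHypothesis m h e (f e)) h' q ∧ Inv f m h' ∧
      h.S.progress < h'.S.progress ∧ q + h.S.weight ≤ 2 * Nat.clog 2 m + 1 + h'.S.weight := by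
  obtain ⟨w, hw, hp, hl⟩ := hI.exists_isPath (e := e) hm e.length (v := [])
    (mem_nodeSet.2 (Or.inl hI.valid.root_mem)) (by simp [he])
  have hp' : h.S.IsPath e [] (h.S.path e) w := hp
  have hl' : (h.S.path e).length ≤ m := by simpa [OMTBDDAS.path] using hl
  have hids : h.S.ids e = [] :: (h.S.path e).map Edge.tgt := rfl
  set k := (h.S.path e).length with hk
  have hwm : w.length = m := by
    obtain ⟨x, hx⟩ := hw
    exact (hI.valid.sink_ok _ hx).1
  have hval : h.S.value e = f w := by
    rw [value, hids, hp'.getLastD, hI.sinkLabel_eq hw]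
  set c := h.S.value e with hc
  set p := fun i => (h.S.ids e).getD i [] with hpdef
  set g : ℕ → L := fun s => f (p (k - s) ++ e.drop (p (k - s)).length) with hg
  have hpk : p k = w := by
    simp only [hpdef, hids, hk]
    exact hp'.getD_length
  have hg0 : g 0 = c := by
    simp only [hg, Nat.sub_zero, hpk]
    rw [List.drop_of_length_le (by omega), List.append_nil, hval]
  -- Index k is the root, where nothing of e is replaced.
  have hgk : g k = f e := by
    simp only [hg, Nat.sub_self]
    rfl
  have hkpos : 0 < k := by
    rcases Nat.eq_zero_or_pos k with h0 | h0
    · rw [h0, hg0] at hgk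
      exact absurd hgk hne
    · exact h0
  obtain ⟨s, q, hs0, hsk, hgs1, hgsc, hq, y⟩ := Yields.bsearch (f := f) (g := g)
    (phi := fun s => ask (p (k - s) ++ e.drop (p (k - s)).length)) (c := c)
    (fun s => Yields.ask _) k 0 k (Nat.clog 2 m) hkpos (by omega)
    (by
      have := Nat.le_pow_clog (b := 2) (by norm_num) m
      omega) hg0 (by rw [hgk]; exact hne.symm)
  rw [hgk] at y
  have hlt : k - s < (h.S.path e).length := by omega
  obtain ⟨E, hE⟩ : ∃ E, (h.S.path e)[k - s]? = some E := ⟨_, List.getElem?_eq_getElem hlt⟩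
  obtain ⟨h1, h2, h3, h4⟩ := hp'.getElem hE
  have hsrc : p (k - s) = E.src := h1
  have htgt : p (k - (s - 1)) = E.tgt := by
    rw [show k - (s - 1) = k - s + 1 by omega]
    exact h2
  have hy : f (E.src ++ e.drop E.src.length) = g s := by simp only [hg, hsrc]
  have htc : f (E.tgt ++ e.drop E.tgt.length) = c := by
    rw [← hgs1]
    simp only [hg, htgt]
  obtain ⟨E', h5, -, -, h6⟩ := hI.exists_next? (e := e) (hI.valid.src_mem E h4)
  rw [h3, Option.some.injEq] at h5
  subst h5
  by_cases hx : f (E.src ++ E.lab ++ e.drop E.tgt.length) = c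
  · obtain ⟨h', q', y', hI', hpr, hw'⟩ :=
      newBranchingNode_spec hI he h4 h6 hx hy hgsc
    refine ⟨h', q + (1 + q'), ?_, hI', hpr, by omega⟩
    unfold updateHypothesis
    refine y.bind ?_
    simp only [← hk, hE]
    refine (Yields.ask _).bind ?_
    rw [if_neg (not_not_intro hx)]
    exact y'
  · obtain ⟨h', q', y', hI', hpr, hw'⟩ := nodeSplit_spec hI he h4 htc rfl hx
    refine ⟨h', q + (1 + q'), ?_, hI', hpr, by omega⟩
    unfold updateHypothesis
    refine y.bind ?_
    simp only [← hk, hE]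
    refine (Yields.ask _).bind ?_
    rw [if_pos hx]
    exact y'

/-! ### The diagram of the hypothesis -/

theorem Inv.cell_sink {v : Str} (hv : ∃ x, (v, x) ∈ h.S.sinks) :
    h.S.toDiagram.cell v = .sink (f v) := by
  simp only [toDiagram]
  rw [lookup_sinks (fun p hp => (hI.valid.sink_ok p hp).2) hv]

theorem Inv.cell_inner {v : Str} (hv : v ∈ h.S.inner) (h0 : v ≠ [] ∨ h.S.Full []) :
    ∃ E : Bool → Edge, (∀ b, E b ∈ h.S.edges ∧ (E b).src = v ∧ h.S.edge? v b = some (E b)) ∧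
      h.S.toDiagram.cell v = .branch v.length (E false).tgt (E true).tgt := by
  have hF : h.S.Full v := by
    by_cases h1 : v = []
    · rw [h1]; exact h0.resolve_left (not_not_intro h1)
    · exact hI.full v hv h1
  choose E h1 h2 h3 _ using fun b => exists_edge? (hF b)
  refine ⟨E, fun b => ⟨h2 b, h3 b, h1 b⟩, ?_⟩
  have hlt := hI.valid.inner_lt v hv
  simp only [toDiagram]
  rw [lookup_sinks_eq_none, h1, h1]
  · rfl
  · rintro p hp rfl
    exact hlt.ne (hI.valid.sink_ok p hp).1

theorem Inv.mem_nodes {v : Str} :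
    v ∈ h.S.toDiagram.nodes ↔ v ∈ h.S.nodeSet ∧ (v ≠ [] ∨ h.S.Full []) := by
  by_cases hF : h.S.Full []
  · simp only [toDiagram, dummyEdge?_eq_none hF, hF, or_true, and_true]
    rfl
  · obtain ⟨E, hE, -⟩ := exists_dummyEdge? hI.valid hI.root_out hF
    simp only [toDiagram, hE, hF, or_false, Finset.mem_erase]
    exact and_comm

/-- A dummy root is counted in `nodeSet` but removed from the diagram; a full root counts twice in
`progress`. In both cases the difference is one. -/
theorem Inv.card_nodes : h.S.toDiagram.nodes.card + 1 = h.S.progress := by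
  have hroot : [] ∈ h.S.nodeSet := mem_nodeSet.2 (Or.inl hI.valid.root_mem)
  by_cases hF : h.S.Full []
  · have : h.S.toDiagram.nodes = h.S.nodeSet := by
      ext v; rw [hI.mem_nodes]; simp [hF]
    rw [this, progress, if_pos hF]
  · have : h.S.toDiagram.nodes = h.S.nodeSet.erase [] := by
      ext v; rw [hI.mem_nodes]; simp [hF, and_comm]
    rw [this, progress, if_neg hF, Finset.card_erase_add_one hroot]
    rfl

theorem Inv.tgt_ne_nil {E : Edge} (hE : E ∈ h.S.edges) : E.tgt ≠ [] := by
  intro h0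
  have h1 := hI.valid.length_eq E hE
  have h2 := List.length_pos_iff.2 (hI.valid.lab_ne E hE)
  rw [h0, List.length_nil] at h1
  omega

theorem Inv.isOrdered (hm : 0 < m) : h.S.toDiagram.IsOrdered m := by
  have htgt : ∀ E ∈ h.S.edges, E.tgt ∈ h.S.toDiagram.nodes := fun E hE =>
    hI.mem_nodes.2 ⟨hI.valid.tgt_mem E hE, Or.inl (hI.tgt_ne_nil hE)⟩
  have hcell : ∀ v ∈ h.S.toDiagram.nodes,
      ((∃ x, (v, x) ∈ h.S.sinks) ∧ v.length = m ∧ h.S.toDiagram.cell v = .sink (f v)) ∨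
      (v.length < m ∧ ∃ E : Bool → Edge, (∀ b, E b ∈ h.S.edges ∧ (E b).src = v) ∧
        h.S.toDiagram.cell v = .branch v.length (E false).tgt (E true).tgt) := by
    intro v hv
    obtain ⟨h1, h2⟩ := hI.mem_nodes.1 hv
    rcases mem_nodeSet.1 h1 with h3 | h3
    · obtain ⟨E, h4, h5⟩ := hI.cell_inner h3 h2
      exact Or.inr ⟨hI.valid.inner_lt v h3, E, fun b => ⟨(h4 b).1, (h4 b).2.1⟩, h5⟩
    · obtain ⟨x, hx⟩ := h3
      exact Or.inl ⟨⟨x, hx⟩, (hI.valid.sink_ok _ hx).1, hI.cell_sink ⟨x, hx⟩⟩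
  have hchild : ∀ v ∈ h.S.toDiagram.nodes, ∀ w, h.S.toDiagram.Child v w →
      w ∈ h.S.toDiagram.nodes ∧ v.length < w.length := by
    rintro v hv w ⟨i, lo, hi, hc, hw⟩
    rcases hcell v hv with ⟨-, -, h1⟩ | ⟨-, E, hE, h1⟩
    · rw [h1] at hc; simp at hc
    · rw [h1] at hc
      simp only [Cell.branch.injEq] at hc
      obtain ⟨-, rfl, rfl⟩ := hc
      have key : ∀ b, (E b).tgt ∈ h.S.toDiagram.nodes ∧ v.length < (E b).tgt.length := by
        intro b
        have h2 := hI.valid.length_eq _ (hE b).1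
        have h3 := List.length_pos_iff.2 (hI.valid.lab_ne _ (hE b).1)
        rw [(hE b).2] at h2
        exact ⟨htgt _ (hE b).1, by omega⟩
      rcases hw with rfl | rfl
      · exact key false
      · exact key true
  refine ⟨?_, fun v hv w hw => (hchild v hv w hw).1, ?_, ?_, ?_⟩
  · by_cases hF : h.S.Full []
    · have : h.S.toDiagram.root = [] := by simp only [toDiagram, dummyEdge?_eq_none hF]
      rw [this, hI.mem_nodes]
      exact ⟨mem_nodeSet.2 (Or.inl hI.valid.root_mem), Or.inr hF⟩
    · obtain ⟨E, hE, hE', -⟩ := exists_dummyEdge? hI.valid hI.root_out hF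
      have : h.S.toDiagram.root = E.tgt := by simp only [toDiagram, hE]
      rw [this]
      exact htgt E hE'
  · intro v hv i lo hi hc
    rcases hcell v hv with ⟨-, -, h1⟩ | ⟨hlt, E, -, h1⟩
    · rw [h1] at hc; simp at hc
    · rw [h1] at hc
      simp only [Cell.branch.injEq] at hc
      omega
  · intro v hv i lo hi hc w hw j lo' hi' hc'
    obtain ⟨hwn, hlt⟩ := hchild v hv w hw
    rcases hcell v hv with ⟨-, -, h1⟩ | ⟨-, E, -, h1⟩
    · rw [h1] at hc; simp at hc
    · rcases hcell w hwn with ⟨-, -, h2⟩ | ⟨-, E', -, h2⟩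
      · rw [h2] at hc'; simp at hc'
      · rw [h1] at hc
        rw [h2] at hc'
        simp only [Cell.branch.injEq] at hc hc'
        omega
  · intro v hv w hw l hcv hcw
    rcases hcell v hv with ⟨-, hv1, h1⟩ | ⟨-, E, -, h1⟩
    · rcases hcell w hw with ⟨-, hw1, h2⟩ | ⟨-, E', -, h2⟩
      · rw [h1] at hcv
        rw [h2] at hcw
        simp only [Cell.sink.injEq] at hcv hcw
        -- On the last level only the empty suffix can be tested, so sinks with equal values reach
        -- the same leaf and are equal.
        have hL := (hI.levels m hm le_rfl).tree
        have e1 := hL.lbl_self v (mem_level.2 ⟨(hI.mem_nodes.1 hv).1, hv1⟩)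
        have e2 := hL.lbl_self w (mem_level.2 ⟨(hI.mem_nodes.1 hw).1, hw1⟩)
        have e3 := hL.wf.lbl_congr (f := f) (a := v) (b := w) fun s hs => by
          rw [Nat.sub_self, List.length_eq_zero_iff] at hs
          rw [hs, List.append_nil, List.append_nil, hcv, hcw]
        rw [e1, e2] at e3
        simpa using e3
      · rw [h2] at hcw; simp at hcw
    · rw [h1] at hcv; simp at hcv

/-- Diagram and path have independent fuels because a dummy root uses up one step of the path but
none of the diagram. -/
theorem Inv.evalFrom_eq [Zero L] (hm : 0 < m) (a : Str) (n : ℕ) :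
    ∀ {v : Str} {k : ℕ}, v ∈ h.S.nodeSet → (v ≠ [] ∨ h.S.Full []) → m ≤ n + v.length →
      m ≤ k + v.length → h.S.toDiagram.evalFrom a n v =
        some (h.S.sinkLabel ((v :: (h.S.pathFrom a k v).map Edge.tgt).getLastD [])) := by
  induction n with
  | zero =>
    intro v k hv h0 hn hk
    obtain ⟨w, hw, hp, hl⟩ := hI.exists_isPath (e := a) hm k hv hk
    have hnil : h.S.pathFrom a k v = [] := List.length_eq_zero_iff.1 (by omega)
    rw [hnil] at hp
    have hp : v = w := hp
    subst hp
    rw [hnil, Diagram.evalFrom_of_sink (hI.cell_sink hw)]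
    rw [List.map_nil, List.getLastD_cons, List.getLastD_nil, hI.sinkLabel_eq hw]
  | succ n ih =>
    intro v k hv h0 hn hk
    rcases mem_nodeSet.1 hv with h1 | h1
    · obtain ⟨E, hE, hc⟩ := hI.cell_inner h1 h0
      have hlt := hI.valid.inner_lt v h1
      obtain ⟨k, rfl⟩ : ∃ k', k = k' + 1 := ⟨k - 1, by omega⟩
      obtain ⟨hb1, hb2, hb3⟩ := hE (a.getD v.length false)
      have h2 := hI.valid.length_eq _ hb1
      have h3 := List.length_pos_iff.2 (hI.valid.lab_ne _ hb1)
      rw [hb2] at h2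
      have e1 : h.S.pathFrom a (k + 1) v = E (a.getD v.length false) ::
          h.S.pathFrom a k (E (a.getD v.length false)).tgt := by
        simp only [pathFrom, next?_eq_edge? h0, hb3]
      have e2 : (if a.getD v.length false then (E true).tgt else (E false).tgt) =
          (E (a.getD v.length false)).tgt := by
        cases a.getD v.length false <;> rfl
      rw [Diagram.evalFrom_succ hc, e2, e1,
        ih (k := k) (hI.valid.tgt_mem _ hb1) (Or.inl (hI.tgt_ne_nil hb1)) (by omega) (by omega),
        List.map_cons, List.getLastD_cons, List.getLastD_cons, List.getLastD_cons]
    · obtain ⟨x, hx⟩ := h1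
      have hl : v.length = m := (hI.valid.sink_ok _ hx).1
      have e1 : h.S.pathFrom a k v = [] := by
        cases k with
        | zero => rfl
        | succ k => simp only [pathFrom, hI.next?_eq_none hm hl]
      rw [e1, Diagram.evalFrom_of_sink (hI.cell_sink ⟨x, hx⟩), List.map_nil, List.getLastD_cons,
        List.getLastD_nil, hI.sinkLabel_eq ⟨x, hx⟩]

theorem Inv.eval_toDiagram [Zero L] (hm : 0 < m) {a : Str} (ha : a.length = m) :
    h.S.toDiagram.eval a = some (h.S.value a) := by
  have hroot : [] ∈ h.S.nodeSet := mem_nodeSet.2 (Or.inl hI.valid.root_mem)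
  rw [Diagram.eval, value, ids, path, ha]
  by_cases hF : h.S.Full []
  · have : h.S.toDiagram.root = [] := by simp only [toDiagram, dummyEdge?_eq_none hF]
    rw [this]
    exact hI.evalFrom_eq hm a m hroot (Or.inr hF) (by simp) (by simp)
  · obtain ⟨E, hE, hE', hE2⟩ := exists_dummyEdge? hI.valid hI.root_out hF
    have : h.S.toDiagram.root = E.tgt := by simp only [toDiagram, hE]
    have h2 := hI.valid.length_eq _ hE'
    have h3 := List.length_pos_iff.2 (hI.valid.lab_ne _ hE')
    rw [hE2, List.length_nil] at h2
    obtain ⟨m', hm'⟩ : ∃ m', m = m' + 1 := ⟨m - 1, by omega⟩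
    have e1 : h.S.pathFrom a m [] = E :: h.S.pathFrom a m' E.tgt := by
      rw [hm']
      simp only [pathFrom, next?, if_true, hE]
    rw [this, e1, hI.evalFrom_eq hm a m (k := m') (hI.valid.tgt_mem _ hE')
      (Or.inl (hI.tgt_ne_nil hE')) (by omega) (by omega),
      List.map_cons, List.getLastD_cons, List.getLastD_cons, List.getLastD_cons]

end Invariant

end OMTBDD

namespace OMTBDD

open OMTBDDAS

theorem Diagram.const_isOrdered {L : Type*} (l : L) (m : ℕ) : (Diagram.const l).IsOrdered m where
  root_mem := Finset.mem_singleton_self _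
  child_mem := by rintro v - w ⟨i, lo, hi, h, -⟩; simp [Diagram.const] at h
  var_lt := by intro v _ i lo hi h; simp [Diagram.const] at h
  ordered := by intro v _ i lo hi h; simp [Diagram.const] at h
  sink_unique := by
    intro v hv w hw l _ _
    rw [Finset.mem_singleton.1 hv, Finset.mem_singleton.1 hw]

theorem Diagram.eval_const {L : Type*} (l : L) (a : Str) : (Diagram.const l).eval a = some l :=
  Diagram.evalFrom_of_sink rfl _ _

variable {L : Type} [DecidableEq L]

/-! ### Bounds -/

section Bounds

variable {V : Type*} {D : Diagram V L} {m : ℕ} {f : Str → L} {h : Hyp L}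

/-- The nodes are essential by the trees, or by `root_essential` for a root that is not a dummy.
Nodes of equal length have different leaves and hence different residuals. -/
theorem Inv.card_le (hI : Inv f m h) (hD : D.IsOrdered m) (hf : CorrectMQ D m f) :
    h.S.toDiagram.nodes.card ≤ D.nodes.card := by
  refine card_le_of_separated hD hf (fun a ha => ?_) fun a ha b hb hl hab => ?_
  · obtain ⟨h1, h2⟩ := hI.mem_nodes.1 ha
    have hle := hI.valid.length_le h1
    rcases hle.eq_or_lt with h3 | h3
    · exact Or.inl h3
    · refine Or.inr ?_
      by_cases h0 : a = []
      · rw [h0]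
        exact hI.root_essential (h2.resolve_left (not_not_intro h0))
      · have hL := (hI.levels a.length (List.length_pos_iff.2 h0) hle).tree
        refine hL.essential h3 a rfl ?_
        rw [hL.lbl_self a (mem_level.2 ⟨h1, rfl⟩)]
        simp
  · by_cases h0 : a = []
    · rw [h0, List.length_nil] at hl
      rw [h0, List.length_eq_zero_iff.1 hl.symm]
    · have h1 := (hI.mem_nodes.1 ha).1
      have h2 := (hI.mem_nodes.1 hb).1
      have hle := hI.valid.length_le h1
      have hL := (hI.levels a.length (List.length_pos_iff.2 h0) hle).tree
      have e1 := hL.lbl_self a (mem_level.2 ⟨h1, rfl⟩)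
      have e2 := hL.lbl_self b (mem_level.2 ⟨h2, hl.symm⟩)
      have e3 := hL.wf.lbl_congr (f := f) (a := a) (b := b) fun s hs => hab s (by omega)
      rw [e1, e2] at e3
      simpa using e3

/-- An edge is determined by its source and first bit, and at least one node is a sink and has no
outgoing edge. -/
theorem Inv.length_edges_le (hI : Inv f m h) :
    h.S.edges.length + 2 ≤ 2 * h.S.nodeSet.card := by
  obtain ⟨s, hs⟩ := List.exists_mem_of_ne_nil _ hI.sinks_ne
  have hsn : s.1 ∈ h.S.nodeSet := mem_nodeSet.2 (Or.inr ⟨s.2, hs⟩)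
  have h1 : h.S.edges.toFinset.card ≤ ((h.S.nodeSet.erase s.1) ×ˢ (Finset.univ : Finset Bool)).card := by
    refine Finset.card_le_card_of_injOn (fun E => (E.src, E.lab.head?.getD false)) ?_ ?_
    · intro E hE
      have hE : E ∈ h.S.edges := List.mem_toFinset.1 hE
      have hin := hI.valid.src_mem E hE
      simp only [Finset.coe_product, Finset.coe_univ, Set.mem_prod, Set.mem_univ, and_true,
        Finset.mem_coe, Finset.mem_erase]
      refine ⟨fun h2 => ?_, mem_nodeSet.2 (Or.inl hin)⟩
      have h3 := hI.valid.inner_lt _ hin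
      rw [h2] at h3
      exact h3.ne (hI.valid.sink_ok s hs).1
    · intro E hE F hF hEF
      have hE : E ∈ h.S.edges := List.mem_toFinset.1 hE
      have hF : F ∈ h.S.edges := List.mem_toFinset.1 hF
      obtain ⟨b, hb⟩ := Option.isSome_iff_exists.1 (List.isSome_head?.2 (hI.valid.lab_ne E hE))
      obtain ⟨c, hc⟩ := Option.isSome_iff_exists.1 (List.isSome_head?.2 (hI.valid.lab_ne F hF))
      simp only [hb, hc, Option.getD_some, Prod.mk.injEq] at hEF
      exact hI.valid.edge_inj E hE F hF hEF.1 (by rw [hb, hc, hEF.2])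
  rw [List.toFinset_card_of_nodup hI.valid.nodup, Finset.card_product, Finset.card_erase_of_mem hsn,
    Finset.card_univ, Fintype.card_bool] at h1
  have := Finset.card_pos.2 ⟨_, hsn⟩
  omega

theorem Inv.progress_le (hI : Inv f m h) (hD : D.IsOrdered m) (hf : CorrectMQ D m f) :
    h.S.progress ≤ D.nodes.card + 1 := by
  have h1 := hI.card_le hD hf
  have h2 := hI.card_nodes
  omega

/-- With n nodes in D, `nodeSet` has at most n + 1 elements (a dummy root may be added), so there
are at most 2n edges. -/
theorem Inv.weight_le (hI : Inv f m h) (hD : D.IsOrdered m) (hf : CorrectMQ D m f) :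
    h.S.weight ≤ 4 * D.nodes.card * (D.nodes.card + 1) := by
  have h1 := hI.progress_le hD hf
  have h2 := hI.length_edges_le
  have h3 : h.S.nodeSet.card ≤ h.S.progress := by unfold progress; omega
  unfold weight
  exact Nat.mul_le_mul (by omega) (by omega)

end Bounds

/-! ### The main loop -/

theorem run_ask {L : Type} (MQ : Str → L) (EQ : ℕ → Diagram Str L → Option Str) (a : Str)
    (nE nM : ℕ) : (ask a).run MQ EQ nE nM = (MQ a, nE, nM + 1) := rfl

theorem run_askEq {L : Type} (MQ : Str → L) (EQ : ℕ → Diagram Str L → Option Str) (H : Diagram Str L)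
    (nE nM : ℕ) : (askEq H).run MQ EQ nE nM = (EQ nE H, nE + 1, nM) := rfl

/-- Induction on r, the number of updates that are still possible before `progress` would exceed n +
1. Each update spends at most one equivalence query and one query for the value of the
counterexample; one more equivalence query ends the loop. -/
theorem mainLoop_spec [Zero L] {V : Type*} {D : Diagram V L} {m : ℕ} {f : Str → L} (hm : 0 < m)
    (hD : D.IsReduced m) (hf : CorrectMQ D m f) {EQ : ℕ → Diagram Str L → Option Str}
    (hEQ : CorrectEQ D m EQ) (r : ℕ) :
    ∀ {h : Hyp L} {e : Str} {nE nM : ℕ}, Inv f m h → e.length = m →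
      D.nodes.card + 1 ≤ h.S.progress + r →
      ∃ H nE' nM', (∀ fuel ≥ r + 1,
          (mainLoop m fuel h e (f e)).run f EQ nE nM = (some H, nE', nM')) ∧
        D.Iso H ∧ nE' ≤ nE + r + 1 ∧
        nM' + h.S.weight ≤
          nM + r * (2 * Nat.clog 2 m + 2) + 4 * D.nodes.card * (D.nodes.card + 1) := by
  have hO := hD.toIsOrdered
  induction r with
  | zero =>
    intro h e nE nM hI he hr
    -- With no update left the hypothesis is correct everywhere: a counterexample would push
    -- `progress` beyond its bound.
    have hup : ∀ {e : Str}, e.length = m → h.S.value e = f e := by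
      intro e he
      by_contra hne
      obtain ⟨h', q, -, hI', hp, -⟩ := hI.updateHypothesis_spec hm he hne
      have := hI'.progress_le hO hf
      omega
    have hnone : EQ nE h.S.toDiagram = none := by
      rcases hq : EQ nE h.S.toDiagram with _ | e'
      · rfl
      · obtain ⟨h1, h2⟩ := (hEQ nE _ (hI.isOrdered hm)).2 e' hq
        rw [hI.eval_toDiagram hm h1, hf e' h1, hup h1] at h2
        exact absurd rfl h2
    refine ⟨h.S.toDiagram, nE + 1, nM, fun fuel hfuel => ?_, ?_, le_rfl, ?_⟩
    · obtain ⟨fuel, rfl⟩ : ∃ k, fuel = k + 1 := ⟨fuel - 1, by omega⟩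
      rw [mainLoop, if_pos (hup he), Prog.run_bind, run_askEq]
      simp only [hnone]
      rfl
    · exact hD.iso (hI.isOrdered hm) ((hEQ nE _ (hI.isOrdered hm)).1 hnone) (hI.card_le hO hf)
    · have := hI.weight_le hO hf
      omega
  | succ r ih =>
    intro h e nE nM hI he hr
    -- One update and the rest of the run, shared by the case of an old counterexample that still
    -- applies and that of a fresh one.
    have hup : ∀ {e : Str} (nE nM : ℕ), e.length = m → h.S.value e ≠ f e →
        ∃ H nE' nM', (∀ fuel ≥ r + 1, (updateHypothesis m h e (f e) >>= fun h =>
          mainLoop m fuel h e (f e)).run f EQ nE nM = (some H, nE', nM')) ∧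
        D.Iso H ∧ nE' ≤ nE + r + 1 ∧
        nM' + h.S.weight ≤ nM + (2 * Nat.clog 2 m + 1) +
          r * (2 * Nat.clog 2 m + 2) + 4 * D.nodes.card * (D.nodes.card + 1) := by
      intro e nE nM he hne
      obtain ⟨h', q, y, hI', hp, hw⟩ := hI.updateHypothesis_spec hm he hne
      obtain ⟨H, nE', nM', hrun, hiso, hE, hM⟩ := ih (nE := nE) (nM := nM + q) hI' he (by omega)
      refine ⟨H, nE', nM', fun fuel hfuel => ?_, hiso, hE, by omega⟩
      rw [Prog.run_bind, y]
      exact hrun fuel hfuel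
    rw [Nat.succ_mul]
    by_cases hv : h.S.value e = f e
    · rcases hq : EQ nE h.S.toDiagram with _ | e'
      · refine ⟨h.S.toDiagram, nE + 1, nM, fun fuel hfuel => ?_, ?_, by omega, ?_⟩
        · obtain ⟨fuel, rfl⟩ : ∃ k, fuel = k + 1 := ⟨fuel - 1, by omega⟩
          rw [mainLoop, if_pos hv, Prog.run_bind, run_askEq]
          simp only [hq]
          rfl
        · exact hD.iso (hI.isOrdered hm) ((hEQ nE _ (hI.isOrdered hm)).1 hq) (hI.card_le hO hf)
        · have := hI.weight_le hO hf
          omega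
      · obtain ⟨h1, h2⟩ := (hEQ nE _ (hI.isOrdered hm)).2 e' hq
        rw [hI.eval_toDiagram hm h1, hf e' h1] at h2
        obtain ⟨H, nE', nM', hrun, hiso, hE, hM⟩ := hup (nE + 1) (nM + 1) h1
          fun h3 => h2 (congrArg some h3)
        refine ⟨H, nE', nM', fun fuel hfuel => ?_, hiso, by omega, by omega⟩
        obtain ⟨fuel, rfl⟩ : ∃ k, fuel = k + 1 := ⟨fuel - 1, by omega⟩
        rw [mainLoop, if_pos hv, Prog.run_bind, run_askEq]
        simp only [hq]
        rw [Prog.run_bind, run_ask]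
        exact hrun fuel (by omega)
    · obtain ⟨H, nE', nM', hrun, hiso, hE, hM⟩ := hup nE nM he hv
      refine ⟨H, nE', nM', fun fuel hfuel => ?_, hiso, by omega, by omega⟩
      obtain ⟨fuel, rfl⟩ : ∃ k, fuel = k + 1 := ⟨fuel - 1, by omega⟩
      rw [mainLoop, if_neg hv]
      exact hrun fuel (by omega)

/-! ### The initial hypothesis -/

/-- The initial hypothesis for the level `k = m - i` of the first node. -/
def startHyp (m : ℕ) (e' : Str) (l' : L) (e : Str) (i : ℕ) (y : L) : Hyp L where
  S := {
    inner := if i = m then [[]] else [[], e'.take (m - i)]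
    sinks := [(e', l'), (cro e' e i, y)]
    edges := if i = m then [⟨e'.take (m - i), e'.drop (m - i), e'⟩,
        ⟨e'.take (m - i), e.drop (m - i), cro e' e i⟩]
      else [⟨[], e'.take (m - i), e'.take (m - i)⟩, ⟨e'.take (m - i), e'.drop (m - i), e'⟩,
        ⟨e'.take (m - i), e.drop (m - i), cro e' e i⟩] }
  T := fun d =>
    if d = m then
      .single [] [l', y] fun a => if a = l' then .leaf (some e') else .leaf (some (cro e' e i))
    else if d = m - i then
      .twin (e.drop (m - i)) y l' (.leaf (some (e'.take (m - i)))) (.leaf none)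
    else .leaf none

theorem treeOK_leaf (f : Str → L) (m i : ℕ) : TreeOK f m i ∅ (.leaf none) where
  lbl_self := by simp
  mem_of_lbl := by intro a u _ h; simp [CTree.lbl] at h
  essential := by intro _ a _ h; simp [CTree.lbl] at h
  cost_le := by simp [CTree.cost]
  wf := trivial

theorem treeOK_top {f : Str → L} {m : ℕ} {ns : Finset Str} {e' w : Str} {l' y : L}
    (h1 : f e' = l') (h2 : f w = y) (hne : y ≠ l') (hns : ∀ v, v ∈ ns ↔ v = e' ∨ v = w) :
    TreeOK f m m ns
      (.single [] [l', y] fun a => if a = l' then .leaf (some e') else .leaf (some w)) where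
  lbl_self := by
    intro v hv
    rcases (hns v).1 hv with rfl | rfl
    · simp [CTree.lbl, h1]
    · simp [CTree.lbl, h2, hne]
  mem_of_lbl := by
    intro a u _ h
    rw [hns]
    simp only [CTree.lbl] at h
    split_ifs at h with h3 h4
    · simp only [CTree.lbl, Option.some.injEq] at h; exact Or.inl h.symm
    · simp only [CTree.lbl, Option.some.injEq] at h; exact Or.inr h.symm
  essential := fun h => absurd h (lt_irrefl m)
  cost_le := by
    intro a
    have : 0 < ns.card := Finset.card_pos.2 ⟨e', (hns e').2 (Or.inl rfl)⟩
    refine le_trans (b := 1) ?_ (by omega)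
    simp only [CTree.cost]
    split_ifs <;> simp [CTree.cost]
  wf := by
    refine ⟨by simp, by simp, fun l _ => ?_⟩
    dsimp only
    split_ifs <;> simp [CTree.WF]

theorem isValid_of_edges_nil {L : Type} {f : Str → L} {m : ℕ} {inner : List Str} {sinks : List (Str × L)}
    (h1 : ∀ v ∈ inner, v.length < m) (h2 : ∀ p ∈ sinks, p.1.length = m ∧ p.2 = f p.1)
    (h3 : [] ∈ inner) : OMTBDDAS.IsValid f m ⟨inner, sinks, []⟩ where
  inner_lt := h1
  sink_ok := h2
  root_mem := h3
  src_mem := by simp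
  tgt_mem := by simp
  length_eq := by simp
  lab_ne := by simp
  nodup := List.nodup_nil
  edge_inj := by simp

end OMTBDD

namespace OMTBDD

open OMTBDDAS

variable {L : Type} [DecidableEq L]

/-- Two edges that leave `v` and end in the sinks `e'` and `w`. -/
theorem IsValid.addFork {L : Type} {f : Str → L} {m : ℕ} {inner : List Str} {sinks : List (Str × L)}
    {v s t e' w : Str} {b : Bool} (hV : OMTBDDAS.IsValid f m ⟨inner, sinks, []⟩)
    (hv : v ∈ inner) (he' : ∃ x, (e', x) ∈ sinks) (hw : ∃ x, (w, x) ∈ sinks)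
    (hs : e' = v ++ s) (ht : w = v ++ t) (hsb : s.head? = some (!b)) (htb : t.head? = some b) :
    OMTBDDAS.IsValid f m ⟨inner, sinks, [⟨v, s, e'⟩, ⟨v, t, w⟩]⟩ := by
  have hsne : s ≠ [] := by rintro rfl; simp at hsb
  have htne : t ≠ [] := by rintro rfl; simp at htb
  refine (hV.addEdge (E := ⟨v, t, w⟩) hv (mem_nodeSet.2 (Or.inr hw)) (by simp [ht]) htne
    (by simp)).addEdge (E := ⟨v, s, e'⟩) hv (mem_nodeSet.2 (Or.inr he')) (by simp [hs]) hsne ?_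
  intro F hF _
  have hF : F = ⟨v, t, w⟩ := List.mem_singleton.1 hF
  rw [hF, hsb]
  simp [htb]

/-- The first node is essential with the suffix of e as witness and forks into the two sinks. The
bound 4 counts this node, the two sinks and one more: the dummy root, or the bonus for a full root
if the node is the root itself. -/
theorem startHyp_spec {f : Str → L} {m i : ℕ} {e' e : Str} {y : L} {b : Bool} (hi0 : 0 < i)
    (him : i ≤ m) (he' : e'.length = m) (he : e.length = m) (hne : y ≠ f e')
    (hy : f (e'.take (m - i) ++ e.drop (m - i)) = y)
    (hc : f (e'.take (m - i) ++ flip (e.drop (m - i))) = f e')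
    (hb : (e.drop (m - i)).head? = some b) (hb' : (e'.drop (m - i)).head? = some (!b)) :
    Inv f m (startHyp m e' (f e') e i y) ∧ 4 ≤ (startHyp m e' (f e') e i y).S.progress := by
  have hwe : cro e' e i = e'.take (m - i) ++ e.drop (m - i) := by rw [cro, he', he]
  have hm : 0 < m := by omega
  obtain ⟨k, hk⟩ : ∃ k, k = m - i := ⟨_, rfl⟩
  rw [← hk] at hy hc hb hb' hwe
  have hkm : k < m := by omega
  set w := cro e' e i with hw
  set v := e'.take k with hv
  set h := startHyp m e' (f e') e i y with hh
  have hvl : v.length = k := by rw [hv, List.length_take]; omega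
  have hfw : f w = y := by rw [hwe, hy]
  have hwl : w.length = m := by rw [hwe, List.length_append, hvl, List.length_drop]; omega
  have hew : e' ≠ w := fun h0 => hne (by rw [← hfw, ← h0])
  have hdl : (e.drop k).length = m - k := by rw [List.length_drop, he]
  have hdne : e.drop k ≠ [] := by intro h0; rw [h0] at hb; simp at hb
  have hess : Essential f m v := ⟨e.drop k, hdne, by omega, by rw [hy, hc]; exact hne⟩
  have hsk : ∀ p ∈ [(e', f e'), (w, y)], p.1.length = m ∧ p.2 = f p.1 := by
    intro p hp
    simp only [List.mem_cons, List.not_mem_nil, or_false] at hp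
    rcases hp with rfl | rfl
    · exact ⟨he', rfl⟩
    · exact ⟨hwl, hfw.symm⟩
  have hfork : ∀ inner : List Str, (∀ u ∈ inner, u.length < m) → [] ∈ inner → v ∈ inner →
      OMTBDDAS.IsValid f m ⟨inner, [(e', f e'), (w, y)],
        [⟨v, e'.drop k, e'⟩, ⟨v, e.drop k, w⟩]⟩ := by
    intro inner h1 h2 h3
    refine IsValid.addFork (b := b) (isValid_of_edges_nil h1 hsk h2) h3 ⟨_, List.mem_cons_self⟩
      ⟨y, by simp⟩ (List.take_append_drop _ _).symm hwe hb' hb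
  have hTm : h.T m = .single [] [f e', y] fun a => if a = f e' then .leaf (some e')
      else .leaf (some w) := by
    simp only [hh, startHyp, if_true]
    rfl
  have htop : (h.T m).IsTop f := by
    rw [hTm]
    refine ⟨_, _, rfl, fun l hl => ?_⟩
    simp only [List.mem_cons, List.not_mem_nil, or_false] at hl
    rcases hl with rfl | rfl
    · exact ⟨e', if_pos rfl, rfl⟩
    · exact ⟨w, if_neg hne, hfw⟩
  have hTi : ∀ j, j ≠ m → j ≠ k → h.T j = .leaf none := by
    intro j h1 h2
    simp only [hh, startHyp, if_neg h1]
    rw [if_neg (by omega)]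
  have hTk : h.T k = .twin (e.drop k) y (f e') (.leaf (some v)) (.leaf none) := by
    simp only [hh, startHyp, if_neg hkm.ne]
    rw [if_pos hk, ← hk]
  have hlblm : (h.T m).lbl f e' = some (some e') ∧ (h.T m).lbl f w = some (some w) := by
    rw [hTm]
    simp [CTree.lbl, hfw, hne]
  -- Between level k and level m all trees are a bare `μ`, so an edge from v to a sink crosses them
  -- correctly.
  have hEOK : ∀ (s x : Str), v ++ s = x → x.length = m → s ≠ [] →
      (h.T m).lbl f x = some (some x) → ∀ j ≤ m, EdgeOK f j (h.T j) ⟨v, s, x⟩ := by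
    intro s x hx hxl hs hlbl j hjm
    have hl : v.length + s.length = m := by rw [← List.length_append, hx, hxl]
    rcases Nat.lt_or_ge k j with h1 | h1
    · rcases hjm.eq_or_lt with rfl | h2
      · refine EdgeOK.of_land hl.symm ?_
        simp only [hx]
        exact hlbl
      · refine ⟨fun h3 => ?_, fun _ _ => ?_⟩
        · simp only at h3; omega
        · rw [hTi j h2.ne (by omega)]; rfl
    · exact EdgeOK.of_le _ (by simpa [hvl] using h1) hs
  have hEe' := hEOK (e'.drop k) e' (List.take_append_drop _ _) he'
    (by intro h0; rw [h0] at hb'; simp at hb') hlblm.1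
  have hEe := hEOK (e.drop k) w hwe.symm hwl hdne hlblm.2
  have hout : h.S.Full v := by
    intro c
    have h1 : (⟨v, e'.drop k, e'⟩ : Edge) ∈ h.S.edges := by
      simp only [hh, startHyp, ← hk]
      split_ifs <;> simp [hv]
    have h2 : (⟨v, e.drop k, w⟩ : Edge) ∈ h.S.edges := by
      simp only [hh, startHyp, ← hk]
      split_ifs <;> simp [hv, hw]
    by_cases hcb : c = b
    · exact ⟨_, h2, rfl, hcb ▸ hb⟩
    · have : c = !b := by revert hcb; cases b <;> cases c <;> simp
      exact ⟨_, h1, rfl, this ▸ hb'⟩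
  have hsinks : h.S.sinks = [(e', f e'), (w, y)] := rfl
  have hsne : h.S.sinks ≠ [] := by rw [hsinks]; simp
  by_cases hk0 : k = 0
  · have himm : i = m := by omega
    have hv0 : v = [] := by rw [hv, hk0, List.take_zero]
    have hS : h.S = ⟨[[]], [(e', f e'), (w, y)], [⟨v, e'.drop k, e'⟩, ⟨v, e.drop k, w⟩]⟩ := by
      simp only [hh, startHyp, if_pos himm, ← hk]
      rfl
    have hnode : ∀ u, u ∈ h.S.nodeSet ↔ u = [] ∨ u = e' ∨ u = w := by
      intro u; rw [hS]; simp [nodeSet]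
    refine ⟨⟨?_, fun j hj hjm => ⟨?_, fun E hE => ?_⟩, htop, fun u hu hne => ?_,
      ⟨b, hv0 ▸ hout b⟩, fun _ => hv0 ▸ hess, hsne⟩, ?_⟩
    · rw [hS]
      exact hfork _ (by simpa using hm) (by simp) (by simp [hv0])
    · by_cases hj' : j = m
      · subst hj'
        rw [hTm]
        refine treeOK_top rfl hfw hne fun u => ?_
        rw [mem_level, hnode]
        constructor
        · rintro ⟨rfl | h1, h2⟩
          · simp at h2; omega
          · exact h1
        · rintro (rfl | rfl)
          · exact ⟨Or.inr (Or.inl rfl), he'⟩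
          · exact ⟨Or.inr (Or.inr rfl), hwl⟩
      · have : h.S.level j = ∅ := by
          ext u
          rw [mem_level, hnode]
          simp only [Finset.notMem_empty, iff_false]
          rintro ⟨rfl | rfl | rfl, h2⟩
          · simp at h2; omega
          · omega
          · omega
        rw [this, hTi j hj' (by omega)]
        exact treeOK_leaf f m j
    · rw [hS] at hE
      simp only [List.mem_cons, List.not_mem_nil, or_false] at hE
      rcases hE with rfl | rfl
      · exact hEe' j hjm
      · exact hEe j hjm
    · rw [hS] at hu
      exact absurd (List.mem_singleton.1 hu) hne
    · have hF : h.S.Full [] := hv0 ▸ hout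
      have hN : h.S.nodeSet = {[], e', w} := by ext u; rw [hnode]; simp
      have h1 : ([] : Str) ∉ ({e', w} : Finset Str) := by
        simp only [Finset.mem_insert, Finset.mem_singleton]
        rintro (h1 | h1)
        · have := congrArg List.length h1; rw [List.length_nil, he'] at this; omega
        · have := congrArg List.length h1; rw [List.length_nil, hwl] at this; omega
      rw [progress, if_pos hF, hN, Finset.card_insert_of_notMem h1, Finset.card_pair hew]
  · have himm : i ≠ m := by omega
    have hvne : v ≠ [] := by intro h0; rw [h0] at hvl; simp at hvl; omega
    have hS : h.S = ⟨[[], v], [(e', f e'), (w, y)],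
        [⟨[], v, v⟩, ⟨v, e'.drop k, e'⟩, ⟨v, e.drop k, w⟩]⟩ := by
      simp only [hh, startHyp, if_neg himm, ← hk]
      rfl
    have hnode : ∀ u, u ∈ h.S.nodeSet ↔ u = [] ∨ u = v ∨ u = e' ∨ u = w := by
      intro u; rw [hS]; simp [nodeSet]
    have hcl : ∀ j, h.S.level j = ∅ ∨ j = 0 ∨ j = k ∨ j = m := by
      intro j
      by_contra! h1
      obtain ⟨⟨u, hu⟩, h2, h3, h4⟩ := h1
      rw [mem_level, hnode] at hu
      obtain ⟨rfl | rfl | rfl | rfl, h5⟩ := hu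
      · simp at h5; omega
      all_goals omega
    refine ⟨⟨?_, fun j hj hjm => ⟨?_, fun E hE => ?_⟩, htop, fun u hu hne => ?_, ?_,
      fun hF => ?_, hsne⟩, ?_⟩
    · rw [hS]
      refine (hfork [[], v] (by simp [hm, hvl, hkm]) (by simp) (by simp)).addEdge
        (E := ⟨[], v, v⟩) (by simp) ?_ (by simp) hvne fun F hF h1 => ?_
      · exact mem_nodeSet.2 (Or.inl (by simp))
      · simp only [List.mem_cons, List.not_mem_nil, or_false] at hF
        rcases hF with rfl | rfl <;> exact absurd h1 hvne
    · by_cases hj' : j = m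
      · subst hj'
        rw [hTm]
        refine treeOK_top rfl hfw hne fun u => ?_
        rw [mem_level, hnode]
        constructor
        · rintro ⟨rfl | rfl | h1, h2⟩
          · simp at h2; omega
          · omega
          · exact h1
        · rintro (rfl | rfl)
          · exact ⟨Or.inr (Or.inr (Or.inl rfl)), he'⟩
          · exact ⟨Or.inr (Or.inr (Or.inr rfl)), hwl⟩
      · by_cases hjk : j = k
        · subst hjk
          have h1 := (treeOK_leaf f m j).branch (v := v) (r := e.drop j) (z := y) (c := f e')
            (by simp) rfl hdl hdne hy hc hne
          have h2 : h.S.level j = insert v ∅ := by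
            ext u
            rw [mem_level, hnode]
            simp only [Finset.mem_insert, Finset.notMem_empty, or_false]
            constructor
            · rintro ⟨rfl | rfl | rfl | rfl, h2⟩
              · simp at h2; omega
              · rfl
              · omega
              · omega
            · rintro rfl
              exact ⟨Or.inr (Or.inl rfl), hvl⟩
          rw [h2, hTk]
          simpa only [CTree.subst, if_true] using h1
        · rw [(hcl j).resolve_right (by omega), hTi j hj' hjk]
          exact treeOK_leaf f m j
    · rw [hS] at hE
      simp only [List.mem_cons, List.not_mem_nil, or_false] at hE
      rcases hE with rfl | rfl | rfl
      · rcases lt_trichotomy j k with h1 | rfl | h1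
        · refine ⟨fun h2 => by simp only [List.length_nil, hvl] at h2; omega, fun _ _ => ?_⟩
          rw [hTi j (by omega) (by omega)]
          rfl
        · refine EdgeOK.of_land (by simp [hvl]) ?_
          rw [hTk, lbl_twin_leaf]
          simp only [List.nil_append]
          rw [if_pos ⟨hy, hc⟩]
        · exact EdgeOK.of_gt _ (by simpa [hvl] using h1)
      · exact hEe' j hjm
      · exact hEe j hjm
    · rw [hS] at hu
      simp only [List.mem_cons, List.not_mem_nil, or_false] at hu
      rcases hu with rfl | rfl
      · exact absurd rfl hne
      · exact hout
    · obtain ⟨c, hc⟩ := Option.isSome_iff_exists.1 (List.isSome_head?.2 hvne)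
      refine ⟨c, ⟨[], v, v⟩, ?_, rfl, hc⟩
      rw [hS]
      exact List.mem_cons_self
    · exfalso
      have key : ∀ c, v.head? = some c := by
        intro c
        obtain ⟨E, hE, h1, h2⟩ := hF c
        rw [hS] at hE
        simp only [List.mem_cons, List.not_mem_nil, or_false] at hE
        rcases hE with rfl | rfl | rfl
        · exact h2
        · exact absurd h1 hvne
        · exact absurd h1 hvne
      have h1 := (key false).symm.trans (key true)
      simp at h1
    · have hN : h.S.nodeSet = {[], v, e', w} := by ext u; rw [hnode]; simp
      have h1 : ([] : Str) ∉ ({v, e', w} : Finset Str) := by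
        simp only [Finset.mem_insert, Finset.mem_singleton]
        rintro (h1 | h1 | h1)
        · exact hvne h1.symm
        · rw [← h1] at he'; simp at he'; omega
        · rw [← h1] at hwl; simp at hwl; omega
      have h2 : v ∉ ({e', w} : Finset Str) := by
        simp only [Finset.mem_insert, Finset.mem_singleton]
        rintro (h1 | h1) <;> rw [h1] at hvl <;> omega
      rw [progress, hN, Finset.card_insert_of_notMem h1, Finset.card_insert_of_notMem h2,
        Finset.card_pair hew]
      omega

/-- The whole string e' is treated as the label of one edge from the root to a sink; the search for
an essential position inside a label then gives the first node. -/
theorem initialHypothesis_spec {f : Str → L} {m : ℕ} {e' e : Str} (hm : 0 < m)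
    (he' : e'.length = m) (he : e.length = m) (hne : f e ≠ f e') :
    ∃ h q, Yields f (initialHypothesis m e' (f e') e (f e)) h q ∧ Inv f m h ∧
      4 ≤ h.S.progress ∧ q ≤ Nat.clog 2 m := by
  have he'ne : e' ≠ [] := by rintro rfl; simp at he'; omega
  obtain ⟨i, y, q, hi0, him, hq, hyl, hyc, hy, hc, b, hb, hb'⟩ :=
    exists_branching_bit (f := f) (m := m) (e := e) (E := ⟨[], e', e'⟩) (c := f e') (y := f e)
      he (by simp) he'.le he'ne
      (by simp only [List.nil_append]; rw [List.drop_of_length_le (by omega), List.append_nil])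
      (by simp) hne
  have htl : (e'.take (m - i)).length = m - i := by rw [List.length_take]; omega
  simp only [List.nil_append, List.length_nil, List.drop_zero, he',
    List.take_of_length_le he.le, List.drop_of_length_le he.le, List.append_nil, htl]
    at hyl hy hc hb hb' him
  obtain ⟨hI, hp⟩ := startHyp_spec hi0 him he' he hyc hy hc hb hb'
  refine ⟨startHyp m e' (f e') e i y, q + 0, ?_, hI, hp, hq⟩
  unfold initialHypothesis
  exact hyl.bind (Yields.pure _)

end OMTBDD

/-! ### The theorem: constant targets, then the main loop with the final count -/

theorem theorem1 {K m : ℕ} [NeZero K] (hK : 2 ≤ K) (hm : 1 ≤ m) {V : Type*}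
    (D : OMTBDD.Diagram V (Fin K)) (hD : D.IsReduced m)
    (MQ : OMTBDD.Str → Fin K) (hMQ : OMTBDD.CorrectMQ D m MQ)
    (EQ : ℕ → OMTBDD.Diagram OMTBDD.Str (Fin K) → Option OMTBDD.Str)
    (hEQ : OMTBDD.CorrectEQ D m EQ) :
    ∃ (H : OMTBDD.Diagram OMTBDD.Str (Fin K)) (nE nM N : ℕ),
      (∀ fuel ≥ N, (OMTBDD.qLearn m fuel).run MQ EQ 0 0 = (some H, nE, nM)) ∧
      D.Iso H ∧
      nM ≤ 2 * D.nodes.card * (⌈Real.logb 2 m⌉₊ + 3 * D.nodes.card) ∧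
      ((¬ ∃ l : Fin K, l ≠ 0 ∧ D.cell D.root = .sink l) → nE ≤ D.nodes.card) ∧
      ((∃ l : Fin K, l ≠ 0 ∧ D.cell D.root = .sink l) → nE = 2) := by
  have hlog : ⌈Real.logb 2 m⌉₊ = Nat.clog 2 m := by
    exact_mod_cast Real.natCeil_logb_natCast 2 m
  rw [hlog]
  have hO := hD.toIsOrdered
  have hn : 1 ≤ D.nodes.card := Finset.card_pos.2 ⟨_, hO.root_mem⟩
  have hconst : ∀ (t : ℕ) (l : Fin K), EQ t (.const l) = none → D.Iso (.const l) := by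
    intro t l h
    refine hD.iso (OMTBDD.Diagram.const_isOrdered l m)
      ((hEQ t _ (OMTBDD.Diagram.const_isOrdered l m)).1 h) ?_
    exact hn
  have hcex : ∀ (t : ℕ) (l : Fin K) (e : OMTBDD.Str), EQ t (.const l) = some e →
      e.length = m ∧ MQ e ≠ l := by
    intro t l e h
    obtain ⟨h1, h2⟩ := (hEQ t _ (OMTBDD.Diagram.const_isOrdered l m)).2 e h
    rw [OMTBDD.Diagram.eval_const, hMQ e h1] at h2
    exact ⟨h1, fun h3 => h2 (congrArg some h3.symm)⟩
  have hsink : ∀ l, D.cell D.root = .sink l → ∀ a : OMTBDD.Str, a.length = m → MQ a = l := by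
    intro l h a ha
    have h1 := hMQ a ha
    rw [OMTBDD.Diagram.eval, OMTBDD.Diagram.evalFrom_of_sink h] at h1
    exact (Option.some.inj h1).symm
  -- Early termination identifies D as a single sink, which decides between the two claims about
  -- equivalence queries.
  have hisosink : ∀ l : Fin K, D.Iso (.const l : OMTBDD.Diagram OMTBDD.Str (Fin K)) →
      D.cell D.root = .sink l := by
    rintro l ⟨φ, -, -, h⟩
    have h1 := h D.root hO.root_mem
    cases hc : D.cell D.root with
    | sink l' =>
      rw [hc] at h1
      simp only [OMTBDD.Diagram.const, OMTBDD.Cell.map, OMTBDD.Cell.sink.injEq] at h1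
      rw [h1]
    | branch i lo hi =>
      rw [hc] at h1
      simp [OMTBDD.Diagram.const, OMTBDD.Cell.map] at h1
  rcases h0 : EQ 0 (.const 0) with _ | e'
  · have hiso := hconst 0 0 h0
    refine ⟨.const 0, 1, 0, 0, fun fuel _ => ?_, hiso, Nat.zero_le _, fun _ => hn, ?_⟩
    · rw [OMTBDD.qLearn, OMTBDD.Prog.run_bind, OMTBDD.run_askEq]
      simp only [h0]
      rfl
    · rintro ⟨l, hl, hc⟩
      rw [hisosink 0 hiso] at hc
      simp only [OMTBDD.Cell.sink.injEq] at hc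
      exact absurd hc.symm hl
  obtain ⟨he', hl'⟩ := hcex 0 0 e' h0
  rcases h1 : EQ 1 (.const (MQ e')) with _ | e
  · have hiso := hconst 1 _ h1
    refine ⟨.const (MQ e'), 2, 1, 0, fun fuel _ => ?_, hiso, ?_,
      fun h2 => absurd ⟨_, hl', hisosink _ hiso⟩ h2, fun _ => rfl⟩
    · rw [OMTBDD.qLearn, OMTBDD.Prog.run_bind, OMTBDD.run_askEq]
      simp only [h0]
      rw [OMTBDD.Prog.run_bind, OMTBDD.run_ask]
      simp only
      rw [OMTBDD.Prog.run_bind, OMTBDD.run_askEq]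
      simp only [zero_add, h1]
      rfl
    · nlinarith [Nat.zero_le (Nat.clog 2 m)]
  obtain ⟨he, hl⟩ := hcex 1 _ e h1
  obtain ⟨h, q, hy, hI, hp, hq⟩ := OMTBDD.initialHypothesis_spec hm he' he hl
  have hpn := hI.progress_le hO hMQ
  -- From 4 ≤ `progress` ≤ n + 1 one gets n ≥ 3, and t = n - 3 updates suffice. With the two queries
  -- for constants this gives 2 + t + 1 = n equivalence queries.
  obtain ⟨t, ht⟩ : ∃ t, D.nodes.card = t + 3 := ⟨D.nodes.card - 3, by omega⟩
  obtain ⟨H, nE, nM, hrun, hiso, hE, hM⟩ := OMTBDD.mainLoop_spec (nE := 2) (nM := 2 + q) hm hD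
    hMQ hEQ t hI he (by omega)
  refine ⟨H, nE, nM, t + 1, fun fuel hf => ?_, hiso, ?_, fun _ => by omega, ?_⟩
  · rw [OMTBDD.qLearn, OMTBDD.Prog.run_bind, OMTBDD.run_askEq]
    simp only [h0]
    rw [OMTBDD.Prog.run_bind, OMTBDD.run_ask]
    simp only
    rw [OMTBDD.Prog.run_bind, OMTBDD.run_askEq]
    simp only [zero_add, h1]
    rw [OMTBDD.Prog.run_bind, OMTBDD.run_ask]
    simp only
    rw [OMTBDD.Prog.run_bind, hy]
    exact hrun fuel hf
  -- Writing C for `Nat.clog 2 m`, the total is at most 2 + C + (n - 3)(2C + 2) + 4n(n + 1), which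
  -- is at most 2n(C + 3n) for n ≥ 3.
  · rw [ht] at hM ⊢
    nlinarith
  -- A single sink is impossible here, since two assignments with different values have been seen.
  · rintro ⟨l, -, hc⟩
    exact absurd ((hsink l hc e he).trans (hsink l hc e' he').symm) hl
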